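/- Let $\mathcal H$ be the upper half-plane. Let $D=\{(\tau,z)\in\mathcal H\times\mathbb C : z\notin\mathbb Z+\tau\mathbb Z\}$, and regard functions on $\mathcal H\times\mathbb C$ with poles only at the points $z\in\mathbb Z+\tau\mathbb Z$ as functions on $D$. A function $f\colon D\to\mathbb C$ is *singular* if it is holomorphic on $D$; $f(\tau,z+1)=f(\tau,z)=f(\tau+1,z)$; for each $\tau$ the function $z\mapsto f(\tau,z)$ is meromorphic on $\mathbb C$, with poles (necessarily in $\mathbb Z+\tau\mathbb Z$) of order bounded by an integer independent of the lattice point and of $\tau$; and the Laurent coefficients of $z\mapsto f(\tau,z)$ at $z=0$ are holomorphic functions of $\tau$ on $\mathcal H$ and at infinity. For $A=\left(\begin{pmatrix}a&b\\c&d\end{pmatrix},(\lambda,\mu)\right)\in \mathrm{SL}(2,\mathbb Z)\ltimes\mathbb Z^2$ put $$(f|_kA)(\tau,z)=(c\tau+d)^{-k}f\!\left(\tfrac{a\tau+b}{c\tau+d},\tfrac{z+\lambda\tau+\mu}{c\tau+d}\right),\quad X(A)=\tfrac{c}{c\tau+d},\quad Y(A)=\tfrac{cz+c\mu-d\lambda}{c\tau+d}.$$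 For $k\in\mathbb Z_{\ge0}$, a singular function $f$ is a *quasi-Jacobi singular form of index zero and weight $k$* if there are $s_1,s_2\ge0$ and singular functions $f_{j_1,j_2}$ ($0\le j_i\le s_i$) with $f|_kA=\sum_{j_1=0}^{s_1}\sum_{j_2=0}^{s_2} f_{j_1,j_2}X(A)^{j_1}Y(A)^{j_2}$ for all $A$. Let $\mathrm{JS}^\infty_k$ be the vector space of these forms and $\mathrm{JS}^\infty=\bigoplus_{k\ge0}\mathrm{JS}^\infty_k$ the graded algebra of quasi-Jacobi singular forms. Let $\mathrm M=\bigoplus_{k\ge 0}\mathrm M_k$ be the algebra of modular forms on $\mathrm{SL}(2,\mathbb Z)$, viewed as functions of $(\tau,z)$ that do not depend on $z$. Let $$\mathrm E_1(\tau,z)=\lim_{N\to\infty}\sum_{n=-N}^{N}\Bigl(\lim_{M\to\infty}\sum_{m=-M}^{M}\frac1{z+m+n\tau}\Bigr),$$ $\partial_z=\frac{\partial}{\partial z}$, $\partial_\tau=\frac{\pi}{2i}\frac{\partial}{\partial\tau}$ and $d=\partial_\tau+\frac14\mathrm E_1\partial_z$. **Proposition.** There is a unique sequence $(\llbracket\cdot,\cdot\rrbracket_n)_{n\ge0}$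 of bilinear maps $\mathrm{JS}^\infty\times\mathrm{JS}^\infty\to\mathrm{JS}^\infty$ such that, for all $n,k,\ell\ge0$, $f\in\mathrm{JS}^\infty_k$ and $g\in\mathrm{JS}^\infty_\ell$, $$\llbracket f,g\rrbracket_n=\sum_{r=0}^n(-1)^r\binom{k+n-1}{n-r}\binom{\ell+n-1}{r}\,d^r(f)\,d^{\,n-r}(g),$$ and: 1. $\llbracket\mathrm{JS}^\infty_k,\mathrm{JS}^\infty_\ell\rrbracket_n\subset\mathrm{JS}^\infty_{k+\ell+2n}$ for all $n,k,\ell\ge0$. 2. The sequence $(\llbracket\cdot,\cdot\rrbracket_n)_{n\ge0}$ is a formal deformation of $\mathrm{JS}^\infty$: $\llbracket f,g\rrbracket_0=fg$, and the product on $\mathrm{JS}^\infty[[\hbar]]$ that extends $f\star g=\sum_{n\ge0}\llbracket f,g\rrbracket_n\hbar^n$ ($f,g\in\mathrm{JS}^\infty$) $\hbar$-bilinearly, $\bigl(\sum_i f_i\hbar^i\bigr)\star\bigl(\sum_j g_j\hbar^j\bigr)=\sum_{n,i,j}\llbracket f_i,g_j\rrbracket_n\hbar^{n+i+j}$, is associative.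 3. $\mathrm M$ is a subalgebra of $\mathrm{JS}^\infty$ that is stable under all the maps $\llbracket\cdot,\cdot\rrbracket_n$, and their restriction to $\mathrm M$ coincides with the classical Rankin–Cohen brackets: for $f\in\mathrm M_k$ and $g\in\mathrm M_\ell$, $\llbracket f,g\rrbracket_n\in \mathrm M_{k+\ell+2n}$ and $$\llbracket f,g\rrbracket_n=\sum_{r=0}^n(-1)^r\binom{k+n-1}{n-r}\binom{\ell+n-1}{r}\partial_\tau^r(f)\,\partial_\tau^{n-r}(g)=\pi^{2n}\sum_{r=0}^n(-1)^r\binom{k+n-1}{n-r}\binom{\ell+n-1}{r}D^r(f)\,D^{n-r}(g),\qquad D=\tfrac1{2\pi i}\tfrac{d}{d\tau}.$$ -/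

import Mathlib

open scoped UpperHalfPlane Manifold MatrixGroups

namespace QuasiJacobi

noncomputable section

open Topology Filter SummationFilter

/-! ### Functions on the half-plane times the plane, with poles on the lattice -/

/-- The pairs `(τ, z)` with `τ` in the upper half-plane and `z` outside the lattice `ℤ + τℤ`. -/
def dom : Set (ℂ × ℂ) := {p | 0 < p.1.im ∧ ∀ m n : ℤ, p.2 ≠ m + n * p.1}

/-- The algebra of all complex functions of `(τ, z)`, `z ∉ ℤ + τℤ`, with pointwise operations.
A function that is meromorphic in `z` with poles in the lattice is an element of it. -/
abbrev Fn : Type := dom → ℂ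

open Classical in
/-- `f(τ, z)`, with the value `0` assigned outside the domain. -/
def ext (f : Fn) (τ z : ℂ) : ℂ := if h : (τ, z) ∈ dom then f ⟨(τ, z), h⟩ else 0

/-- Singular functions. -/
structure IsSingular (f : Fn) : Prop where
  /-- `f` is holomorphic where it is defined. -/
  holo : DifferentiableOn ℂ (fun p : ℂ × ℂ => ext f p.1 p.2) dom
  z_add_one : ∀ τ z : ℂ, ext f τ (z + 1) = ext f τ z
  tau_add_one : ∀ τ z : ℂ, ext f (τ + 1) z = ext f τ z
  /-- `z ↦ f(τ, z)` is meromorphic at the lattice points, and the order of the poles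
  is bounded independently of the lattice point and of `τ`. -/
  poles : ∃ N : ℕ, ∀ (τ : ℍ) (m n : ℤ),
    MeromorphicAt (ext f τ) (m + n * (τ : ℂ)) ∧
      ((-(N : ℤ) : ℤ) : WithTop ℤ) ≤ meromorphicOrderAt (ext f τ) (m + n * (τ : ℂ))
  /-- The Laurent expansion `f(τ, z) = ∑ A n τ * z ^ (n - N)` at `z = 0` has coefficients that are
  holomorphic on the upper half-plane and at infinity (being `1`-periodic in `τ`, they are
  holomorphic at infinity exactly when they are bounded at `i∞`). -/
  laurent : ∃ (N : ℕ) (A : ℕ → ℍ → ℂ),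
    (∀ n, MDiff (A n) ∧ UpperHalfPlane.IsBoundedAtImInfty (A n)) ∧
    ∀ τ : ℍ, ∀ᶠ z in 𝓝[≠] (0 : ℂ), HasSum (fun n => A n τ * z ^ n) (z ^ N * ext f τ z)

/-! ### The action of the Jacobi group and quasi-Jacobi forms -/

/-- The weight `k`, index zero action of `(g, (l, m))` in the Jacobi group `SL(2, ℤ) ⋉ ℤ²`. -/
def slash (k : ℕ) (g : SL(2, ℤ)) (l m : ℤ) (f : Fn) : Fn := fun p =>
  ((g 1 0 : ℂ) * p.1.1 + g 1 1) ^ (-(k : ℤ)) *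
    ext f (((g 0 0 : ℂ) * p.1.1 + g 0 1) / ((g 1 0 : ℂ) * p.1.1 + g 1 1))
      ((p.1.2 + l * p.1.1 + m) / ((g 1 0 : ℂ) * p.1.1 + g 1 1))

/-- The function `X(A) = c / (cτ + d)`. -/
def X (g : SL(2, ℤ)) : Fn := fun p => (g 1 0 : ℂ) / ((g 1 0 : ℂ) * p.1.1 + g 1 1)

/-- The function `Y(A) = (cz + cμ - dλ) / (cτ + d)`, where `(λ, μ) = (l, m)`. -/
def Y (g : SL(2, ℤ)) (l m : ℤ) : Fn := fun p =>
  ((g 1 0 : ℂ) * p.1.2 + g 1 0 * m - g 1 1 * l) / ((g 1 0 : ℂ) * p.1.1 + g 1 1)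

/-- `f` is a singular quasi-Jacobi form of index zero and weight `k`
(and of some depths at most `s₁`, `s₂`). -/
def IsQuasiJacobi (k : ℕ) (f : Fn) : Prop :=
  IsSingular f ∧ ∃ (s₁ s₂ : ℕ) (F : ℕ → ℕ → Fn), (∀ i j, IsSingular (F i j)) ∧
    ∀ (g : SL(2, ℤ)) (l m : ℤ), slash k g l m f =
      ∑ i ∈ Finset.range (s₁ + 1), ∑ j ∈ Finset.range (s₂ + 1), F i j * X g ^ i * Y g l m ^ j

/-! ### Closure properties -/

lemma ext_of_mem (f : Fn) {τ z : ℂ} (h : (τ, z) ∈ dom) : ext f τ z = f ⟨(τ, z), h⟩ := by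
  simp [ext, h]

lemma ext_add (f g : Fn) (τ z : ℂ) : ext (f + g) τ z = ext f τ z + ext g τ z := by
  unfold ext; split_ifs <;> simp

lemma ext_mul (f g : Fn) (τ z : ℂ) : ext (f * g) τ z = ext f τ z * ext g τ z := by
  unfold ext; split_ifs <;> simp

lemma mem_dom_z (τ z : ℂ) : (τ, z + 1) ∈ dom ↔ (τ, z) ∈ dom := by
  simp only [dom, Set.mem_ofPred_eq]
  refine and_congr_right fun _ => ⟨fun h m n e => h (m + 1) n ?_, fun h m n e => h (m - 1) n ?_⟩
  · rw [e]; push_cast; ring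
  · push_cast; linear_combination e

lemma mem_dom_tau (τ z : ℂ) : (τ + 1, z) ∈ dom ↔ (τ, z) ∈ dom := by
  simp only [dom, Set.mem_ofPred_eq]
  refine and_congr (by simp) ⟨fun h m n e => h (m - n) n ?_, fun h m n e => h (m + n) n ?_⟩
  · rw [e]; push_cast; ring
  · rw [e]; push_cast; ring

lemma lattice_isolated (τ : ℍ) (m n : ℤ) :
    ∀ᶠ z in 𝓝[≠] ((m : ℂ) + n * (τ : ℂ)), ((τ : ℂ), z) ∈ dom := by
  have hr : 0 < min τ.im 1 := lt_min τ.im_pos one_pos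
  filter_upwards [self_mem_nhdsWithin, mem_nhdsWithin_of_mem_nhds (Metric.ball_mem_nhds _ hr)]
    with z hz hzr
  refine ⟨τ.im_pos, fun m' n' e => hz ?_⟩
  rw [mem_ball_iff_norm] at hzr
  simp only at e
  have e1 : z - ((m : ℂ) + n * (τ : ℂ)) = ((m' - m : ℤ) : ℂ) + ((n' - n : ℤ) : ℂ) * τ := by
    rw [e]; push_cast; ring
  rw [e1] at hzr
  have him := (Complex.abs_im_le_norm _).trans_lt (hzr.trans_le (min_le_left _ _))
  have hn : n' - n = 0 := by
    by_contra h0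
    have h1 : (1 : ℝ) ≤ |((n' - n : ℤ) : ℝ)| := by exact_mod_cast Int.one_le_abs h0
    have h2 : (((m' - m : ℤ) : ℂ) + ((n' - n : ℤ) : ℂ) * (τ : ℂ)).im
        = ((n' - n : ℤ) : ℝ) * τ.im := by
      rw [Complex.add_im, Complex.intCast_im, Complex.mul_im, Complex.intCast_im,
        Complex.intCast_re]
      simp
    rw [h2, abs_mul, abs_of_pos τ.im_pos] at him
    nlinarith [τ.im_pos]
  rw [hn] at hzr
  have hm : m' - m = 0 := by
    by_contra h0
    have h1 : (1 : ℝ) ≤ |((m' - m : ℤ) : ℝ)| := by exact_mod_cast Int.one_le_abs h0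
    have h2 := hzr.trans_le (min_le_right _ _)
    rw [Int.cast_zero, zero_mul, add_zero, Complex.norm_intCast] at h2
    linarith
  rw [e, show m' = m by omega, show n' = n by omega]
  rfl

lemma isSingular_const (c : ℂ) : IsSingular (fun _ => c) where
  holo := (differentiableOn_const c).congr fun p hp => ext_of_mem _ hp
  z_add_one τ z := by classical simpa [ext] using if_congr (mem_dom_z τ z) rfl rfl
  tau_add_one τ z := by classical simpa [ext] using if_congr (mem_dom_tau τ z) rfl rfl
  poles := by
    refine ⟨0, fun τ m n => ?_⟩
    have h : (fun _ => c) =ᶠ[𝓝[≠] ((m : ℂ) + n * (τ : ℂ))] ext (fun _ => c) τ :=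
      (lattice_isolated τ m n).mono fun z hz => (ext_of_mem (fun _ => c) hz).symm
    refine ⟨(MeromorphicAt.const c _).congr h, ?_⟩
    rw [← meromorphicOrderAt_congr h]
    simpa using (analyticAt_const (v := c)).meromorphicOrderAt_nonneg
  laurent := by
    refine ⟨0, fun n _ => if n = 0 then c else 0, fun n => ⟨mdifferentiable_const, ?_⟩,
      fun τ => ?_⟩
    · exact const_boundedAtFilter _ _
    · have h := lattice_isolated τ 0 0
      simp only [Int.cast_zero, zero_mul, add_zero] at h
      filter_upwards [h] with z hz
      rw [ext_of_mem _ hz]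
      convert hasSum_ite_eq 0 c using 2
      split_ifs with h0 <;> simp [h0]
      simp

lemma hasSum_of_eq {u v : ℕ → ℂ} {a : ℂ} (h : HasSum v a) (e : ∀ n, u n = v n) : HasSum u a :=
  (funext e : u = v) ▸ h

/-- The order of the pole in a Laurent expansion can be increased. -/
lemma laurent_raise {f : Fn} {N : ℕ} {A : ℕ → ℍ → ℂ}
    (hA : ∀ n, MDiff (A n) ∧ UpperHalfPlane.IsBoundedAtImInfty (A n))
    (h : ∀ τ : ℍ, ∀ᶠ z in 𝓝[≠] (0 : ℂ), HasSum (fun n => A n τ * z ^ n) (z ^ N * ext f τ z))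
    (K : ℕ) : ∃ B : ℕ → ℍ → ℂ,
      (∀ n, MDiff (B n) ∧ UpperHalfPlane.IsBoundedAtImInfty (B n)) ∧
      ∀ τ : ℍ, ∀ᶠ z in 𝓝[≠] (0 : ℂ),
        HasSum (fun n => B n τ * z ^ n) (z ^ (K + N) * ext f τ z) := by
  refine ⟨fun n => if n < K then fun _ => 0 else A (n - K), fun n => ?_, fun τ => ?_⟩
  · dsimp only
    split_ifs
    · exact ⟨mdifferentiable_const, const_boundedAtFilter _ _⟩
    · exact hA _
  · filter_upwards [h τ] with z hz
    rw [← hasSum_nat_add_iff' K]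
    have h0 : ∑ i ∈ Finset.range K, (if i < K then fun _ => (0 : ℂ) else A (i - K)) τ * z ^ i
        = 0 := Finset.sum_eq_zero fun i hi => by simp [Finset.mem_range.1 hi]
    rw [h0, sub_zero, pow_add, mul_assoc]
    refine hasSum_of_eq (hz.mul_left (z ^ K)) fun n => ?_
    simp [pow_add]
    ring

lemma IsSingular.add {f g : Fn} (hf : IsSingular f) (hg : IsSingular g) :
    IsSingular (f + g) where
  holo := (hf.holo.add hg.holo).congr fun p _ => ext_add f g p.1 p.2
  z_add_one τ z := by rw [ext_add, ext_add, hf.z_add_one, hg.z_add_one]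
  tau_add_one τ z := by rw [ext_add, ext_add, hf.tau_add_one, hg.tau_add_one]
  poles := by
    obtain ⟨N, hN⟩ := hf.poles
    obtain ⟨K, hK⟩ := hg.poles
    refine ⟨N + K, fun τ m n => ?_⟩
    have e : ext (f + g) τ = ext f τ + ext g τ := funext fun z => ext_add f g τ z
    obtain ⟨h1, h2⟩ := hN τ m n
    obtain ⟨h3, h4⟩ := hK τ m n
    rw [e]
    refine ⟨h1.add h3, le_trans (le_min (le_trans ?_ h2) (le_trans ?_ h4))
      (meromorphicOrderAt_add h1 h3)⟩
    · exact WithTop.coe_le_coe.2 (by push_cast; omega)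
    · exact WithTop.coe_le_coe.2 (by push_cast; omega)
  laurent := by
    obtain ⟨N, A, hA, hAs⟩ := hf.laurent
    obtain ⟨K, B, hB, hBs⟩ := hg.laurent
    obtain ⟨A', hA', hAs'⟩ := laurent_raise hA hAs K
    obtain ⟨B', hB', hBs'⟩ := laurent_raise hB hBs N
    refine ⟨K + N, fun n => A' n + B' n, fun n => ⟨(hA' n).1.add (hB' n).1,
      (hA' n).2.add (hB' n).2⟩, fun τ => ?_⟩
    filter_upwards [hAs' τ, hBs' τ] with z h1 h2
    rw [add_comm N K] at h2
    have := h1.add h2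
    rw [← mul_add, ← ext_add] at this
    convert this using 2 with n
    simp [add_mul]

lemma IsSingular.mul {f g : Fn} (hf : IsSingular f) (hg : IsSingular g) :
    IsSingular (f * g) where
  holo := (hf.holo.mul hg.holo).congr fun p _ => ext_mul f g p.1 p.2
  z_add_one τ z := by rw [ext_mul, ext_mul, hf.z_add_one, hg.z_add_one]
  tau_add_one τ z := by rw [ext_mul, ext_mul, hf.tau_add_one, hg.tau_add_one]
  poles := by
    obtain ⟨N, hN⟩ := hf.poles
    obtain ⟨K, hK⟩ := hg.poles
    refine ⟨N + K, fun τ m n => ?_⟩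
    have e : ext (f * g) τ = ext f τ * ext g τ := funext fun z => ext_mul f g τ z
    obtain ⟨h1, h2⟩ := hN τ m n
    obtain ⟨h3, h4⟩ := hK τ m n
    rw [e]
    refine ⟨h1.mul h3, ?_⟩
    rw [meromorphicOrderAt_mul h1 h3]
    refine le_trans (le_of_eq ?_) (add_le_add h2 h4)
    rw [← WithTop.coe_add]
    congr 1
    push_cast
    ring
  laurent := by
    obtain ⟨N, A, hA, hAs⟩ := hf.laurent
    obtain ⟨K, B, hB, hBs⟩ := hg.laurent
    refine ⟨N + K, fun n => ∑ x ∈ Finset.HasAntidiagonal.antidiagonal n, A x.1 * B x.2,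
      fun n => ⟨?_, ?_⟩, fun τ => ?_⟩
    · refine Finset.sum_induction _ (fun u : ℍ → ℂ => MDiff u) (fun _ _ h1 h2 => h1.add h2)
        mdifferentiable_const fun x _ => (hA x.1).1.mul (hB x.2).1
    · refine Finset.sum_induction _ UpperHalfPlane.IsBoundedAtImInfty
        (fun _ _ h1 h2 => h1.add h2) (const_boundedAtFilter _ _) fun x _ => (hA x.1).2.mul (hB x.2).2
    · filter_upwards [hAs τ, hBs τ] with z h1 h2
      have s1 := h1.summable.norm
      have s2 := h2.summable.norm
      have s := (summable_norm_sum_mul_antidiagonal_of_summable_norm s1 s2).of_norm.hasSum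
      rw [← tsum_mul_tsum_eq_tsum_sum_antidiagonal_of_summable_norm s1 s2, h1.tsum_eq,
        h2.tsum_eq] at s
      rw [ext_mul, pow_add, mul_mul_mul_comm]
      refine hasSum_of_eq s fun n => ?_
      rw [Finset.sum_apply, Finset.sum_mul]
      refine Finset.sum_congr rfl fun x hx => ?_
      rw [← Finset.HasAntidiagonal.mem_antidiagonal.1 hx, Pi.mul_apply, pow_add]
      ring

/-- Families of functions that are polynomials in `X(A)`, `Y(A)` with singular coefficients. -/
def IsPolyXY (Φ : SL(2, ℤ) → ℤ → ℤ → Fn) : Prop :=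
  ∃ (s₁ s₂ : ℕ) (F : ℕ → ℕ → Fn), (∀ i j, IsSingular (F i j)) ∧
    ∀ (g : SL(2, ℤ)) (l m : ℤ), Φ g l m =
      ∑ i ∈ Finset.range (s₁ + 1), ∑ j ∈ Finset.range (s₂ + 1), F i j * X g ^ i * Y g l m ^ j

lemma isSingular_zero : IsSingular (0 : Fn) := isSingular_const 0

lemma isPolyXY_monomial {f : Fn} (hf : IsSingular f) (i j : ℕ) :
    IsPolyXY fun g l m => f * X g ^ i * Y g l m ^ j := by
  refine ⟨i, j, fun a b => if a = i ∧ b = j then f else 0, fun a b => ?_, fun g l m => ?_⟩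
  · dsimp only
    split_ifs
    · exact hf
    · exact isSingular_zero
  · rw [Finset.sum_eq_single i, Finset.sum_eq_single j]
    · simp
    · intro b _ hb; simp [hb]
    · simp
    · intro a _ ha; simp [ha]
    · simp

lemma IsPolyXY.add {Φ Ψ : SL(2, ℤ) → ℤ → ℤ → Fn} (h : IsPolyXY Φ) (h' : IsPolyXY Ψ) :
    IsPolyXY fun g l m => Φ g l m + Ψ g l m := by
  have raise : ∀ {Φ : SL(2, ℤ) → ℤ → ℤ → Fn} (s₁ s₂ t₁ t₂ : ℕ) (F : ℕ → ℕ → Fn),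
      s₁ ≤ t₁ → s₂ ≤ t₂ → (∀ i j, IsSingular (F i j)) →
      (∀ (g : SL(2, ℤ)) (l m : ℤ), Φ g l m = ∑ i ∈ Finset.range (s₁ + 1),
        ∑ j ∈ Finset.range (s₂ + 1), F i j * X g ^ i * Y g l m ^ j) →
      ∃ G : ℕ → ℕ → Fn, (∀ i j, IsSingular (G i j)) ∧
        ∀ (g : SL(2, ℤ)) (l m : ℤ), Φ g l m = ∑ i ∈ Finset.range (t₁ + 1),
          ∑ j ∈ Finset.range (t₂ + 1), G i j * X g ^ i * Y g l m ^ j := by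
    intro Φ s₁ s₂ t₁ t₂ F h1 h2 hF hs
    refine ⟨fun i j => if i ≤ s₁ ∧ j ≤ s₂ then F i j else 0, fun i j => ?_, fun g l m => ?_⟩
    · dsimp only
      split_ifs
      · exact hF i j
      · exact isSingular_zero
    · rw [hs]
      refine Finset.sum_subset_zero_on_sdiff (Finset.range_mono (by omega)) ?_ fun i hi => ?_
      · intro i hi
        simp only [Finset.mem_sdiff, Finset.mem_range] at hi
        exact Finset.sum_eq_zero fun j _ => by simp [show ¬ i ≤ s₁ by omega]
      · rw [Finset.mem_range] at hi
        refine Finset.sum_subset_zero_on_sdiff (Finset.range_mono (by omega)) ?_ fun j hj => ?_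
        · intro j hj
          simp only [Finset.mem_sdiff, Finset.mem_range] at hj
          simp [show ¬ j ≤ s₂ by omega]
        · rw [Finset.mem_range] at hj
          simp [show i ≤ s₁ by omega, show j ≤ s₂ by omega]
  obtain ⟨s₁, s₂, F, hF, hs⟩ := h
  obtain ⟨t₁, t₂, G, hG, ht⟩ := h'
  obtain ⟨F', hF', hs'⟩ := raise s₁ s₂ (max s₁ t₁) (max s₂ t₂) F (le_max_left _ _)
    (le_max_left _ _) hF hs
  obtain ⟨G', hG', ht'⟩ := raise t₁ t₂ (max s₁ t₁) (max s₂ t₂) G (le_max_right _ _)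
    (le_max_right _ _) hG ht
  refine ⟨max s₁ t₁, max s₂ t₂, fun i j => F' i j + G' i j, fun i j => (hF' i j).add (hG' i j), fun g l m => ?_⟩
  simp only [hs', ht', ← Finset.sum_add_distrib, add_mul]

lemma IsPolyXY.sum {ι : Type*} (s : Finset ι) (Φ : ι → SL(2, ℤ) → ℤ → ℤ → Fn)
    (h : ∀ i ∈ s, IsPolyXY (Φ i)) : IsPolyXY fun g l m => ∑ i ∈ s, Φ i g l m := by
  classical
  induction s using Finset.induction_on with
  | empty => simpa using isPolyXY_monomial isSingular_zero 0 0
  | insert a s ha ih =>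
    simp only [Finset.sum_insert ha]
    exact (h a (by simp)).add (ih fun i hi => h i (by simp [hi]))

lemma IsPolyXY.mul {Φ Ψ : SL(2, ℤ) → ℤ → ℤ → Fn} (h : IsPolyXY Φ) (h' : IsPolyXY Ψ) :
    IsPolyXY fun g l m => Φ g l m * Ψ g l m := by
  obtain ⟨s₁, s₂, F, hF, hs⟩ := h
  obtain ⟨t₁, t₂, G, hG, ht⟩ := h'
  simp only [hs, ht, Finset.sum_mul]
  simp only [Finset.mul_sum]
  refine IsPolyXY.sum _ _ fun i _ => IsPolyXY.sum _ _ fun j _ => IsPolyXY.sum _ _ fun a _ =>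
    IsPolyXY.sum _ _ fun b _ => ?_
  have := isPolyXY_monomial ((hF i j).mul (hG a b)) (i + a) (j + b)
  convert this using 4
  ring

lemma slash_add (k : ℕ) (g : SL(2, ℤ)) (l m : ℤ) (f h : Fn) :
    slash k g l m (f + h) = slash k g l m f + slash k g l m h := by
  ext p
  simp only [slash, ext_add, Pi.add_apply, mul_add]

lemma slash_mul (k n : ℕ) (g : SL(2, ℤ)) (l m : ℤ) (f h : Fn) :
    slash (k + n) g l m (f * h) = slash k g l m f * slash n g l m h := by
  ext p
  simp only [slash, ext_mul, Pi.mul_apply, zpow_neg, zpow_natCast, pow_add, mul_inv]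
  ring

/-- The Jacobi group preserves the domain. -/
lemma act_mem_dom (g : SL(2, ℤ)) (l m : ℤ) (p : dom) :
    (((g 0 0 : ℂ) * p.1.1 + g 0 1) / ((g 1 0 : ℂ) * p.1.1 + g 1 1),
      (p.1.2 + l * p.1.1 + m) / ((g 1 0 : ℂ) * p.1.1 + g 1 1)) ∈ dom := by
  obtain ⟨⟨τ, z⟩, hτ, hz⟩ := p
  lift τ to ℍ using hτ
  have e := UpperHalfPlane.specialLinearGroup_apply g τ
  have hden : (g 1 0 : ℂ) * τ + g 1 1 ≠ 0 := by
    simpa [UpperHalfPlane.denom] using UpperHalfPlane.denom_ne_zero g τ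
  refine ⟨?_, fun a b h => hz (a * g 1 1 + b * g 0 1 - m) (a * g 1 0 + b * g 0 0 - l) ?_⟩
  · have := (g • τ).im_pos
    rw [e] at this
    exact this
  · simp only at h ⊢
    rw [← mul_div_assoc, div_eq_iff hden, add_mul, div_mul_cancel₀ _ hden] at h
    push_cast
    linear_combination h

/-- The space of singular quasi-Jacobi forms of index zero and weight `k`. -/
def QJS (k : ℕ) : Submodule ℂ Fn where
  carrier := {f | IsQuasiJacobi k f}
  add_mem' := by
    rintro f h ⟨hf, hf'⟩ ⟨hh, hh'⟩
    refine ⟨hf.add hh, ?_⟩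
    have := IsPolyXY.add (Φ := fun g l m => slash k g l m f)
      (Ψ := fun g l m => slash k g l m h) hf' hh'
    simpa only [IsPolyXY, ← slash_add] using this
  zero_mem' := by
    refine ⟨isSingular_zero, 0, 0, fun _ _ => 0, fun _ _ => isSingular_zero, fun g l m => ?_⟩
    ext p
    simp [slash, ext]
  smul_mem' := by
    rintro c f ⟨hf, s₁, s₂, F, hF, hs⟩
    have hc : ∀ u : Fn, c • u = (fun _ => c) * u := fun u => rfl
    refine ⟨hc f ▸ (isSingular_const c).mul hf, s₁, s₂, fun i j => c • F i j,
      fun i j => (isSingular_const c).mul (hF i j), fun g l m => ?_⟩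
    have : slash k g l m (c • f) = c • slash k g l m f := by
      ext p
      simp only [slash, Pi.smul_apply, smul_eq_mul]
      rw [hc, ext_mul, ext_of_mem (fun _ => c) (act_mem_dom g l m p)]
      ring
    rw [this, hs]
    simp only [Finset.smul_sum, smul_mul_assoc]

lemma one_mem_QJS : (1 : Fn) ∈ QJS 0 := by
  refine ⟨isSingular_const 1, 0, 0, fun _ _ => 1, fun _ _ => isSingular_const 1,
    fun g l m => ?_⟩
  ext p
  simp only [slash]
  rw [ext_of_mem 1 (act_mem_dom g l m p)]
  simp

lemma mul_mem_QJS {k l : ℕ} {f g : Fn} (hf : f ∈ QJS k) (hg : g ∈ QJS l) :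
    f * g ∈ QJS (k + l) := by
  refine ⟨hf.1.mul hg.1, ?_⟩
  have := IsPolyXY.mul (Φ := fun γ a b => slash k γ a b f)
    (Ψ := fun γ a b => slash l γ a b g) hf.2 hg.2
  simpa only [IsPolyXY, ← slash_mul] using this

lemma mul_mem_iSup {R : Type*} [CommRing R] [Algebra ℂ R] (V : ℕ → Submodule ℂ R)
    (h : ∀ k l, ∀ f ∈ V k, ∀ g ∈ V l, f * g ∈ V (k + l)) (f g : R)
    (hf : f ∈ ⨆ k, V k) (hg : g ∈ ⨆ k, V k) : f * g ∈ ⨆ k, V k := by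
  have := Submodule.mul_mem_mul hf hg
  rw [Submodule.iSup_mul] at this
  refine (iSup_le fun k => ?_ : _ ≤ ⨆ k, V k) this
  rw [Submodule.mul_iSup]
  refine iSup_le fun l => Submodule.mul_le.2 fun a ha b hb => ?_
  exact Submodule.mem_iSup_of_mem (k + l) (h k l a ha b hb)

/-- The algebra `JS^∞` of singular quasi-Jacobi forms, the sum of the spaces `QJS k`. -/
def JSinf : Subalgebra ℂ Fn :=
  (⨆ k, QJS k).toSubalgebra (Submodule.mem_iSup_of_mem 0 one_mem_QJS)
    (mul_mem_iSup QJS fun _ _ _ hf _ hg => mul_mem_QJS hf hg)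

/-! ### Modular forms as functions of `(τ, z)` -/

/-- A function of `τ` regarded as a function of `(τ, z)`. -/
def pull (φ : ℍ → ℂ) : Fn := fun p => φ ⟨p.1.1, p.2.1⟩

/-- The space of modular forms of weight `k` on `SL(2, ℤ)`, as functions of `(τ, z)`. -/
def MF (k : ℕ) : Submodule ℂ Fn where
  carrier := {f | ∃ φ : ModularForm 𝒮ℒ (k : ℤ), f = pull φ}
  add_mem' := by
    rintro _ _ ⟨φ, rfl⟩ ⟨ψ, rfl⟩
    exact ⟨φ + ψ, rfl⟩
  zero_mem' := ⟨0, rfl⟩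
  smul_mem' := by
    rintro c _ ⟨φ, rfl⟩
    exact ⟨c • φ, rfl⟩

lemma one_mem_MF : (1 : Fn) ∈ MF 0 :=
  ⟨ModularForm.mcast (by simp) (1 : ModularForm 𝒮ℒ 0), by ext; simp [pull]⟩

lemma mul_mem_MF {k l : ℕ} {f g : Fn} (hf : f ∈ MF k) (hg : g ∈ MF l) :
    f * g ∈ MF (k + l) := by
  obtain ⟨φ, rfl⟩ := hf
  obtain ⟨ψ, rfl⟩ := hg
  exact ⟨ModularForm.mcast (by simp) (φ.mul ψ), rfl⟩

/-- The algebra `M` of modular forms on `SL(2, ℤ)`, as functions of `(τ, z)`. -/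
def M : Subalgebra ℂ Fn :=
  (⨆ k, MF k).toSubalgebra (Submodule.mem_iSup_of_mem 0 one_mem_MF)
    (mul_mem_iSup MF fun _ _ _ hf _ hg => mul_mem_MF hf hg)

/-! ### Derivations and brackets -/

/-- `E₁(τ, z) = ∑ₙ (∑ₘ 1 / (z + m + nτ))` (Eisenstein summation: both sums over `ℤ` are
limits of the sums over `[-N, N]`). -/
def E1 : Fn := fun p =>
  ∑'[symmetricIcc ℤ] n : ℤ, ∑'[symmetricIcc ℤ] m : ℤ, 1 / (p.1.2 + (m : ℂ) + n * p.1.1)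

/-- `∂_z = ∂/∂z`. -/
def dz (f : Fn) : Fn := fun p => deriv (fun z => ext f p.1.1 z) p.1.2

/-- `∂_τ = (π / 2i) ∂/∂τ`. -/
def dtau (f : Fn) : Fn := fun p =>
  (Real.pi : ℂ) / (2 * Complex.I) * deriv (fun τ => ext f τ p.1.2) p.1.1

/-- `d = ∂_τ + (1/4) E₁ ∂_z`. -/
def d (f : Fn) : Fn := dtau f + (1 / 4 : ℂ) • (E1 * dz f)

/-- `∂_τ = (π / 2i) d/dτ` on functions of `τ` alone. -/
def dtauH (φ : ℍ → ℂ) : ℍ → ℂ := fun τ =>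
  (Real.pi : ℂ) / (2 * Complex.I) * deriv (φ ∘ UpperHalfPlane.ofComplex) τ

/-- The `n`-th Rankin–Cohen bracket of `f` in weight `k` and `g` in weight `l`, with respect to
the operator `δ`. (For `n = 0` the truncated `k + n - 1` does no harm: `choose _ 0 = 1`.) -/
def rcBracket {R : Type*} [CommRing R] (δ : R → R) (k l n : ℕ) (f g : R) : R :=
  ∑ r ∈ Finset.range (n + 1), (-1) ^ r * ((k + n - 1).choose (n - r) : R) *
    ((l + n - 1).choose r : R) * δ^[r] f * δ^[n - r] g

/-- `B n` are the bilinear maps on `JS^∞` that extend the `n`-th Rankin–Cohen bracket with respect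
to `d` of forms of weights `k` and `l`. -/
def ExtendsBracket (B : ℕ → JSinf →ₗ[ℂ] JSinf →ₗ[ℂ] JSinf) : Prop :=
  ∀ (n k l : ℕ) (f g : JSinf), (f : Fn) ∈ QJS k → (g : Fn) ∈ QJS l →
    (B n f g : Fn) = rcBracket d k l n (f : Fn) (g : Fn)

/-! ### Formal deformations -/

/-- The product on `A[[ħ]]` that extends `f ⋆ g = ∑ μ_n(f, g) ħⁿ`. -/
def starProd {A : Type*} [CommRing A] [Algebra ℂ A] (μ : ℕ → A →ₗ[ℂ] A →ₗ[ℂ] A)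
    (F G : PowerSeries A) : PowerSeries A :=
  PowerSeries.mk fun n => ∑ x ∈ Finset.HasAntidiagonal.antidiagonal n,
    ∑ y ∈ Finset.HasAntidiagonal.antidiagonal x.2,
    μ x.1 (PowerSeries.coeff y.1 F) (PowerSeries.coeff y.2 G)

/-- The sequence of bilinear maps `μ` is a formal deformation of the commutative algebra `A`. -/
structure IsFormalDeformation {A : Type*} [CommRing A] [Algebra ℂ A]
    (μ : ℕ → A →ₗ[ℂ] A →ₗ[ℂ] A) : Prop where
  zero : ∀ f g : A, μ 0 f g = f * g
  assoc : ∀ F G H : PowerSeries A, starProd μ (starProd μ F G) H = starProd μ F (starProd μ G H)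

end

end QuasiJacobi

/-! The central point is that `d` is a derivation of the graded algebra `JSinf` raising the weight
by two. The brackets are then Rankin–Cohen brackets of a commutative graded algebra with a
derivation, and associativity is pure algebra.

Stability under `d`. The slash action turns `∂_τ f` into `∂_τ` of the slashed form plus a term in
`X(A)`, proportional to the weight, and a term `(π/2i) Y(A) ∂_z`. On the other hand `E₁` is of
weight one with `E₁|A = E₁ + 2πi Y(A)` (`slash_E1`), so `(1/4) E₁ ∂_z` produces `(πi/2) Y(A) ∂_z`.
The two `Y`-terms cancel (`slash_d`). Since `d X(A)` and `d Y(A)` are again polynomials in `X(A)`,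
`Y(A)` with singular coefficients, `d` preserves quasi-Jacobi forms (`d_mem_QJS`). Analytically this
requires that `∂_τ` and `∂_z` preserve singular functions (`isSingular_dtau`, `isSingular_dz`),
which rests on Osgood's lemma and removable singularities in two variables. It also requires that
`E₁` is singular (`isSingular_E1`), by way of its Lambert series. The law of `E₁` under Möbius
transformations follows from Liouville's theorem and oddness.

Uniqueness. The bracket formula involves the weights, so the sum of the weight spaces must be direct
(`isInternal_weight`). Along matrices with lower row `(1, n)` both `X(A)` and `Y(A)` tend to zero,
so `f|A` tends to `f`, and the factors `(τ + n) ^ k` separate the weights.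

Associativity. Let `f` of weight `k` be the value of a vector `ω` in a module with commuting
operators `X`, `Y`, such that `Yᵇ Xᵃ ω` evaluates to `(-1)ᵇ (k+a)(k+a+1)⋯(k+a+b-1) Dᵃ f`. Then `n!`
times the `n`-th bracket is the value of the `n`-th power of the Moyal bivector `Ω = X ⊗ Y - Y ⊗ X`
(`moyal_pow_eq_rcBracket`). The operators `E` and `T` of a `MoyalLift` show that brackets of lifts
have lifts of the expected weight. On triple tensor products both ways of bracketing are expansions
of divided powers of `Ω₁₂ + Ω₁₃ + Ω₂₃`, all summands of which commute; comparing them is the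
associativity law (`sum_rcBracket_assoc`).

Modular forms. On functions of `τ` alone `d` is `∂_τ = π² D`. For the automorphy factor `j` one has
`D² j = 0`; passing from `D` to `j² D` replaces `X` by `j² X - j (Dj) Y`, which only multiplies `Ω`
by `j²`. So the brackets of modular forms are modular (`rcBracket_sq_mul_deriv`). -/

section


open Topology Filter Set

/-! ### Holomorphic functions of two variables: Osgood's lemma and partial derivatives. -/

/-- The partial derivative in the second variable of a function that is continuous and
holomorphic in the second variable is continuous. -/
theorem ContinuousOn.continuousOn_deriv_snd {f : ℂ × ℂ → ℂ} {U : Set (ℂ × ℂ)} (hU : IsOpen U)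
    (hf : ContinuousOn f U) (h2 : ∀ p ∈ U, DifferentiableAt ℂ (fun z => f (p.1, z)) p.2) :
    ContinuousOn (fun p : ℂ × ℂ => deriv (fun z => f (p.1, z)) p.2) U := by
  rintro ⟨a, b⟩ hab
  refine ContinuousAt.continuousWithinAt ?_
  obtain ⟨s, t, hs, ht, has, hbt, hst⟩ := isOpen_prod_iff.1 hU a b hab
  -- Joint continuity makes the slices `f(τ, ·)` converge locally uniformly as `τ → a`; by
  -- Weierstrass their derivatives converge in the same way.
  have key : TendstoLocallyUniformlyOn (fun τ z => f (τ, z)) (fun z => f (a, z)) (𝓝 a) t := by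
    rw [tendstoLocallyUniformlyOn_iff_forall_tendsto]
    intro x hx
    have hx' : ContinuousAt f (a, x) := hf.continuousAt (hU.mem_nhds (hst ⟨has, hx⟩))
    have e : 𝓝 a ×ˢ 𝓝[t] x = 𝓝 (a, x) := by rw [ht.nhdsWithin_eq hx, nhds_prod_eq]
    rw [e]
    refine Tendsto.mono_right ?_ (nhds_le_uniformity (f (a, x)))
    refine Tendsto.prodMk_nhds ?_ hx'
    have : Tendsto (fun y : ℂ × ℂ => (a, y.2)) (𝓝 (a, x)) (𝓝 (a, x)) :=
      (Continuous.prodMk continuous_const continuous_snd).continuousAt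
    exact hx'.tendsto.comp this
  have hd : ∀ᶠ τ in 𝓝 a, DifferentiableOn ℂ (fun z => f (τ, z)) t := by
    filter_upwards [hs.mem_nhds has] with τ hτ z hz
    exact (h2 (τ, z) (hst ⟨hτ, hz⟩)).differentiableWithinAt
  have hlim := key.deriv hd ht
  rw [tendstoLocallyUniformlyOn_iff_forall_tendsto] at hlim
  have h := hlim b hbt
  rw [ht.nhdsWithin_eq hbt, ← nhds_prod_eq] at h
  have hb : ContinuousAt (deriv fun z => f (a, z)) b := by
    have : DifferentiableOn ℂ (fun z => f (a, z)) t := fun z hz =>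
      (h2 (a, z) (hst ⟨has, hz⟩)).differentiableWithinAt
    exact (this.deriv ht).continuousOn.continuousAt (ht.mem_nhds hbt)
  have hb' : Tendsto (fun y : ℂ × ℂ => deriv (fun z => f (a, z)) y.2) (𝓝 (a, b))
      (𝓝 (deriv (fun z => f (a, z)) b)) := hb.tendsto.comp continuous_snd.continuousAt
  exact hb'.congr_uniformity h

/-- The partial derivative in the first variable of a function that is continuous and
holomorphic in the first variable is continuous. -/
theorem ContinuousOn.continuousOn_deriv_fst {f : ℂ × ℂ → ℂ} {U : Set (ℂ × ℂ)} (hU : IsOpen U)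
    (hf : ContinuousOn f U) (h1 : ∀ p ∈ U, DifferentiableAt ℂ (fun τ => f (τ, p.2)) p.1) :
    ContinuousOn (fun p : ℂ × ℂ => deriv (fun τ => f (τ, p.2)) p.1) U := by
  have hV : IsOpen (Prod.swap ⁻¹' U) := hU.preimage continuous_swap
  have := ContinuousOn.continuousOn_deriv_snd (f := f ∘ Prod.swap) hV
    (hf.comp continuous_swap.continuousOn fun p hp => hp) fun p hp => h1 p.swap hp
  exact this.comp (g := fun p : ℂ × ℂ => deriv (fun z => (f ∘ Prod.swap) (p.1, z)) p.2)
    continuous_swap.continuousOn fun p hp => by simpa using hp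

/-- Strict differentiability of continuous, separately holomorphic functions. -/
theorem ContinuousOn.hasStrictFDerivAt_of_separately {f : ℂ × ℂ → ℂ} {U : Set (ℂ × ℂ)}
    (hU : IsOpen U) (hf : ContinuousOn f U)
    (h1 : ∀ p ∈ U, DifferentiableAt ℂ (fun τ => f (τ, p.2)) p.1)
    (h2 : ∀ p ∈ U, DifferentiableAt ℂ (fun z => f (p.1, z)) p.2) {p : ℂ × ℂ} (hp : p ∈ U) :
    HasStrictFDerivAt f
      ((ContinuousLinearMap.toSpanSingleton ℂ (deriv (fun τ => f (τ, p.2)) p.1)).coprod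
        (ContinuousLinearMap.toSpanSingleton ℂ (deriv (fun z => f (p.1, z)) p.2))) p := by
  have c1 := (hf.continuousOn_deriv_fst hU h1).continuousAt (hU.mem_nhds hp)
  have c2 := (hf.continuousOn_deriv_snd hU h2).continuousAt (hU.mem_nhds hp)
  exact hasStrictFDerivAt_uncurry_coprod (𝕜 := ℂ) (u := p) (f := fun a b => f (a, b))
    (f₁ := fun a b => ContinuousLinearMap.toSpanSingleton ℂ (deriv (fun τ => f (τ, b)) a))
    (f₂ := fun a b => ContinuousLinearMap.toSpanSingleton ℂ (deriv (fun z => f (a, z)) b))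
    (eventually_of_mem (hU.mem_nhds hp) fun v hv => (h1 v hv).hasDerivAt.hasFDerivAt)
    (eventually_of_mem (hU.mem_nhds hp) fun v hv => (h2 v hv).hasDerivAt.hasFDerivAt)
    ((ContinuousLinearMap.toSpanSingletonCLE (𝕜 := ℂ) (E := ℂ)).continuous.continuousAt.comp c1)
    ((ContinuousLinearMap.toSpanSingletonCLE (𝕜 := ℂ) (E := ℂ)).continuous.continuousAt.comp c2)

/-- **Osgood's lemma** in two variables. -/
theorem ContinuousOn.differentiableOn_of_separately {f : ℂ × ℂ → ℂ} {U : Set (ℂ × ℂ)}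
    (hU : IsOpen U) (hf : ContinuousOn f U)
    (h1 : ∀ p ∈ U, DifferentiableAt ℂ (fun τ => f (τ, p.2)) p.1)
    (h2 : ∀ p ∈ U, DifferentiableAt ℂ (fun z => f (p.1, z)) p.2) : DifferentiableOn ℂ f U :=
  fun _ hp =>
    (hf.hasStrictFDerivAt_of_separately hU h1 h2 hp).hasFDerivAt.differentiableAt.differentiableWithinAt

theorem DifferentiableOn.differentiableAt_fst {f : ℂ × ℂ → ℂ} {U : Set (ℂ × ℂ)} (hU : IsOpen U)
    (hf : DifferentiableOn ℂ f U) {p : ℂ × ℂ} (hp : p ∈ U) :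
    DifferentiableAt ℂ (fun τ => f (τ, p.2)) p.1 :=
  DifferentiableAt.comp (f := fun τ : ℂ => (τ, p.2)) p.1
    (hf.differentiableAt (hU.mem_nhds hp)) (by fun_prop)

theorem DifferentiableOn.differentiableAt_snd {f : ℂ × ℂ → ℂ} {U : Set (ℂ × ℂ)} (hU : IsOpen U)
    (hf : DifferentiableOn ℂ f U) {p : ℂ × ℂ} (hp : p ∈ U) :
    DifferentiableAt ℂ (fun z => f (p.1, z)) p.2 :=
  DifferentiableAt.comp (f := fun z : ℂ => (p.1, z)) p.2
    (hf.differentiableAt (hU.mem_nhds hp)) (by fun_prop)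

/-- Partial derivatives of holomorphic functions of two variables are holomorphic. -/
theorem differentiableOn_deriv_snd {f : ℂ × ℂ → ℂ} {U : Set (ℂ × ℂ)}
    (hU : IsOpen U) (hf : DifferentiableOn ℂ f U) :
    DifferentiableOn ℂ (fun p : ℂ × ℂ => deriv (fun z => f (p.1, z)) p.2) U := by
  have h1 := fun p (hp : p ∈ U) => hf.differentiableAt_fst hU hp
  have h2 := fun p (hp : p ∈ U) => hf.differentiableAt_snd hU hp
  refine (hf.continuousOn.continuousOn_deriv_snd hU h2).differentiableOn_of_separately hU ?_ ?_
  · rintro ⟨a, b⟩ hab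
    obtain ⟨s, t, hs, ht, has, hbt, hst⟩ := isOpen_prod_iff.1 hU a b hab
    -- In the direction of `τ` the derivative in `z` is a locally uniform limit of difference
    -- quotients, each of which is holomorphic in `τ`.
    have key : TendstoLocallyUniformlyOn (fun h τ => h⁻¹ * (f (τ, b + h) - f (τ, b)))
        (fun τ => deriv (fun z => f (τ, z)) b) (𝓝[≠] (0 : ℂ)) s := by
      rw [tendstoLocallyUniformlyOn_iff_forall_tendsto]
      intro x hx
      have hxb : (x, b) ∈ U := hst ⟨hx, hbt⟩
      rw [hs.nhdsWithin_eq hx]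
      set l : Filter (ℂ × ℂ) := 𝓝[≠] (0 : ℂ) ×ˢ 𝓝 x
      have t1 : Tendsto (fun y : ℂ × ℂ => y.1) l (𝓝 0) :=
        (tendsto_fst (f := 𝓝[≠] (0 : ℂ)) (g := 𝓝 x)).mono_right nhdsWithin_le_nhds
      have t2 : Tendsto (fun y : ℂ × ℂ => y.2) l (𝓝 x) := tendsto_snd
      have hne : ∀ᶠ y in l, y.1 ≠ 0 :=
        (tendsto_fst (f := 𝓝[≠] (0 : ℂ)) (g := 𝓝 x)).eventually self_mem_nhdsWithin
      refine Tendsto.mono_right ?_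
        (nhds_le_uniformity (deriv (fun z => f (x, z)) b))
      refine Tendsto.prodMk_nhds ?_ ?_
      · have c := (hf.continuousOn.continuousOn_deriv_snd hU h2).continuousAt (hU.mem_nhds hxb)
        exact Tendsto.comp (f := fun y : ℂ × ℂ => (y.2, b)) c
          (t2.prodMk_nhds tendsto_const_nhds)
      -- Strict differentiability compares two moving points, which is what uniformity in the base
      -- point requires.
      · have st := hf.continuousOn.hasStrictFDerivAt_of_separately hU h1 h2 hxb
        rw [hasStrictFDerivAt_iff_isLittleO] at st
        have tt : Tendsto (fun y : ℂ × ℂ => (((y.2, b + y.1) : ℂ × ℂ), ((y.2, b) : ℂ × ℂ))) l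
            (𝓝 ((x, b), (x, b))) := by
          refine (t2.prodMk_nhds ?_).prodMk_nhds (t2.prodMk_nhds tendsto_const_nhds)
          simpa using tendsto_const_nhds.add t1
        have o := st.comp_tendsto tt
        have o' : (fun y : ℂ × ℂ => f (y.2, b + y.1) - f (y.2, b) -
            y.1 * deriv (fun z => f (x, z)) b) =o[l] fun y => y.1 := by
          refine (o.congr_left fun y => ?_).trans_isBigO ?_
          · simp [ContinuousLinearMap.coprod_apply]
          · refine Asymptotics.IsBigO.of_bound 1 (Eventually.of_forall fun y => ?_)
            simp [Prod.norm_def]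
        have o2 := o'.tendsto_div_nhds_zero
        have o3 := o2.add_const (deriv (fun z => f (x, z)) b)
        rw [zero_add] at o3
        refine o3.congr' ?_
        filter_upwards [hne] with y hy
        field_simp
        ring
    have hd : ∀ᶠ h in 𝓝[≠] (0 : ℂ),
        DifferentiableOn ℂ (fun τ => h⁻¹ * (f (τ, b + h) - f (τ, b))) s := by
      have : ∀ᶠ h in 𝓝 (0 : ℂ), b + h ∈ t := by
        refine (Continuous.continuousAt (by fun_prop : Continuous fun h : ℂ => b + h)).eventually ?_
        simpa using ht.mem_nhds hbt
      filter_upwards [nhdsWithin_le_nhds this] with h hh τ hτ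
      refine DifferentiableAt.differentiableWithinAt ?_
      exact ((h1 (τ, b + h) (hst ⟨hτ, hh⟩)).sub (h1 (τ, b) (hst ⟨hτ, hbt⟩))).const_mul _
    exact (key.differentiableOn hd hs).differentiableAt (hs.mem_nhds has)
  · rintro ⟨a, b⟩ hab
    obtain ⟨s, t, hs, ht, has, hbt, hst⟩ := isOpen_prod_iff.1 hU a b hab
    have : DifferentiableOn ℂ (fun z => f (a, z)) t := fun z hz =>
      (h2 (a, z) (hst ⟨has, hz⟩)).differentiableWithinAt
    exact (this.deriv ht).differentiableAt (ht.mem_nhds hbt)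

theorem differentiableOn_deriv_fst {f : ℂ × ℂ → ℂ} {U : Set (ℂ × ℂ)}
    (hU : IsOpen U) (hf : DifferentiableOn ℂ f U) :
    DifferentiableOn ℂ (fun p : ℂ × ℂ => deriv (fun τ => f (τ, p.2)) p.1) U := by
  have hV : IsOpen (Prod.swap ⁻¹' U) := hU.preimage continuous_swap
  have hs : Differentiable ℂ (Prod.swap : ℂ × ℂ → ℂ × ℂ) :=
    differentiable_snd.prodMk differentiable_fst
  have := differentiableOn_deriv_snd (f := f ∘ Prod.swap) hV
    (hf.comp hs.differentiableOn fun p hp => hp)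
  exact this.comp (g := fun p : ℂ × ℂ => deriv (fun z => (f ∘ Prod.swap) (p.1, z)) p.2)
    hs.differentiableOn fun p hp => by simpa using hp

/-- A locally uniform limit of holomorphic functions of two variables is holomorphic. -/
theorem TendstoLocallyUniformlyOn.differentiableOn_prod {ι : Type*} {l : Filter ι} [l.NeBot]
    {F : ι → ℂ × ℂ → ℂ} {f : ℂ × ℂ → ℂ} {U : Set (ℂ × ℂ)} (hU : IsOpen U)
    (h : TendstoLocallyUniformlyOn F f l U) (hF : ∀ i, DifferentiableOn ℂ (F i) U) :
    DifferentiableOn ℂ f U := by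
  have hc : ContinuousOn f U := h.continuousOn (Frequently.of_forall fun i => (hF i).continuousOn)
  refine hc.differentiableOn_of_separately hU ?_ ?_
  · rintro ⟨a, b⟩ hab
    have hV : IsOpen ((fun τ : ℂ => (τ, b)) ⁻¹' U) := hU.preimage (by fun_prop)
    have := (h.comp (fun τ : ℂ => (τ, b)) (t := (fun τ : ℂ => (τ, b)) ⁻¹' U) (fun _ h => h)
      (by fun_prop)).differentiableOn (Eventually.of_forall fun i τ hτ =>
        ((hF i).differentiableAt_fst hU (p := (τ, b)) hτ).differentiableWithinAt) hV
    exact this.differentiableAt (hV.mem_nhds hab)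
  · rintro ⟨a, b⟩ hab
    have hV : IsOpen ((fun z : ℂ => (a, z)) ⁻¹' U) := hU.preimage (by fun_prop)
    have := (h.comp (fun z : ℂ => (a, z)) (t := (fun z : ℂ => (a, z)) ⁻¹' U) (fun _ h => h)
      (by fun_prop)).differentiableOn (Eventually.of_forall fun i z hz =>
        ((hF i).differentiableAt_snd hU (p := (a, z)) hz).differentiableWithinAt) hV
    exact this.differentiableAt (hV.mem_nhds hab)

/-! ### Removable singularities along a hypersurface. -/

/-- The value at a removable singularity, filled in by an analytic germ. -/
theorem differentiableOn_update_of_eventuallyEq {f h : ℂ → ℂ} {s : Set ℂ} {c : ℂ}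
    (hs : IsOpen s) (hf : DifferentiableOn ℂ f (s \ {c})) (hh : AnalyticAt ℂ h c)
    (e : ∀ᶠ w in 𝓝[≠] c, f w = h w) : DifferentiableOn ℂ (Function.update f c (h c)) s := by
  intro w hw
  refine DifferentiableAt.differentiableWithinAt ?_
  by_cases hwc : w = c
  · subst hwc
    have : Function.update f w (h w) =ᶠ[𝓝 w] h := by
      rw [eventually_nhdsWithin_iff] at e
      filter_upwards [e] with x hx
      by_cases hxw : x = w
      · simp [hxw]
      · simp [hxw, hx hxw]
    exact hh.differentiableAt.congr_of_eventuallyEq this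
  · have : Function.update f c (h c) =ᶠ[𝓝 w] f := by
      filter_upwards [isOpen_ne.mem_nhds hwc] with x hx
      simp [show x ≠ c from hx]
    refine DifferentiableAt.congr_of_eventuallyEq ?_ this
    exact hf.differentiableAt ((hs.sdiff isClosed_singleton).mem_nhds ⟨hw, hwc⟩)

/-- Riemann's extension theorem along the hypersurface `w = 0`, for a function whose
singularity on each line `τ = const` is known to be removable. -/
theorem exists_differentiableOn_extension {s : Set ℂ} (hs : IsOpen s) {r : ℝ}
    {Φ : ℂ × ℂ → ℂ} (hΦ : DifferentiableOn ℂ Φ (s ×ˢ (Metric.ball 0 r \ {0})))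
    (hex : ∀ τ ∈ s, ∃ h : ℂ → ℂ, AnalyticAt ℂ h 0 ∧ ∀ᶠ w in 𝓝[≠] (0 : ℂ), Φ (τ, w) = h w) :
    ∃ Ψ : ℂ × ℂ → ℂ, DifferentiableOn ℂ Ψ (s ×ˢ Metric.ball 0 r) ∧
      ∀ τ, ∀ w ≠ 0, Ψ (τ, w) = Φ (τ, w) := by
  have hUo : IsOpen (s ×ˢ (Metric.ball (0 : ℂ) r \ {0})) :=
    hs.prod (Metric.isOpen_ball.sdiff isClosed_singleton)
  choose! h hh he using hex
  let Ψ : ℂ × ℂ → ℂ := fun p => Function.update (fun w => Φ (p.1, w)) 0 (h p.1 0) p.2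
  have hΨ : ∀ τ, ∀ w ≠ 0, Ψ (τ, w) = Φ (τ, w) := fun τ w hw => by simp [Ψ, hw]
  have hd2 : ∀ τ ∈ s, DifferentiableOn ℂ (fun w => Ψ (τ, w)) (Metric.ball 0 r) := fun τ hτ =>
    differentiableOn_update_of_eventuallyEq Metric.isOpen_ball
      (fun w hw => (hΦ.differentiableAt_snd hUo (p := (τ, w)) ⟨hτ, hw⟩).differentiableWithinAt)
      (hh τ hτ) (he τ hτ)
  refine ⟨Ψ, ?_, hΨ⟩
  rcases le_or_gt r 0 with hr | hr
  · rw [Metric.ball_eq_empty.2 hr, prod_empty]; exact differentiableOn_empty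
  -- The maximum principle bounds `Ψ` on the half-radius disc by its maximum on the circle,
  -- uniformly for `τ` near `τ₀`; the Schwarz lemma turns this into a Lipschitz estimate at `w = 0`.
  -- The `+ 1` is slack.
  have lip : ∀ τ₀ ∈ s, ∃ ε > 0, ∃ C : ℝ, Metric.closedBall τ₀ ε ⊆ s ∧
      ∀ τ ∈ Metric.closedBall τ₀ ε, ∀ w ∈ Metric.ball (0 : ℂ) (r / 2),
        dist (Ψ (τ, w)) (Ψ (τ, 0)) ≤ C * ‖w‖ := by
    intro τ₀ hτ₀
    obtain ⟨ε, hε, hεs⟩ := Metric.nhds_basis_closedBall.mem_iff.1 (hs.mem_nhds hτ₀)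
    have hK : IsCompact (Metric.closedBall τ₀ ε ×ˢ Metric.sphere (0 : ℂ) (r / 2)) :=
      (isCompact_closedBall _ _).prod (isCompact_sphere _ _)
    have hsub : Metric.closedBall τ₀ ε ×ˢ Metric.sphere (0 : ℂ) (r / 2) ⊆
        s ×ˢ (Metric.ball 0 r \ {0}) := by
      refine prod_mono hεs fun w hw => ?_
      rw [mem_sphere_zero_iff_norm] at hw
      refine ⟨by rw [mem_ball_zero_iff]; linarith, fun h0 => ?_⟩
      rw [mem_singleton_iff.1 h0, norm_zero] at hw
      linarith
    obtain ⟨M, hM⟩ := hK.exists_bound_of_continuousOn (hΦ.continuousOn.mono hsub)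
    refine ⟨ε, hε, (2 * |M| + 1) / (r / 2), hεs, fun τ hτ w hw => ?_⟩
    have hbd : ∀ w ∈ Metric.closedBall (0 : ℂ) (r / 2), ‖Ψ (τ, w)‖ ≤ |M| := by
      have hdc : DiffContOnCl ℂ (fun w => Ψ (τ, w)) (Metric.ball 0 (r / 2)) := by
        refine DifferentiableOn.diffContOnCl ?_
        rw [closure_ball _ (by positivity)]
        exact (hd2 τ (hεs hτ)).mono (Metric.closedBall_subset_ball (by linarith))
      intro w hw
      refine Complex.norm_le_of_forall_mem_frontier_norm_le Metric.isBounded_ball hdc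
        (C := |M|) (fun v hv => ?_) (by rwa [closure_ball _ (by positivity)])
      rw [frontier_ball _ (by positivity)] at hv
      have hv0 : v ≠ 0 := fun h0 => by
        rw [h0, mem_sphere_zero_iff_norm, norm_zero] at hv
        linarith
      rw [hΨ τ v hv0]
      exact (hM (τ, v) ⟨hτ, hv⟩).trans (le_abs_self M)
    have := Complex.dist_le_div_mul_dist_of_mapsTo_ball (f := fun w => Ψ (τ, w)) (c := 0)
      (R₁ := r / 2) (R₂ := 2 * |M| + 1)
      ((hd2 τ (hεs hτ)).mono (Metric.ball_subset_ball (by linarith))) (fun v hv => ?_) hw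
    · simpa using this
    · have h1 := hbd v (Metric.ball_subset_closedBall hv)
      have h2 := hbd 0 (Metric.mem_closedBall_self (by positivity))
      rw [mem_closedBall_iff_norm]
      exact (norm_sub_le _ _).trans (by linarith)
  -- The values filled in at `w = 0` are the locally uniform limit of the functions `Φ(·, w)` as `w
  -- → 0`.
  have hd0 : DifferentiableOn ℂ (fun τ => Ψ (τ, 0)) s := by
    have key : TendstoLocallyUniformlyOn (fun w τ => Φ (τ, w)) (fun τ => Ψ (τ, 0))
        (𝓝[≠] (0 : ℂ)) s := by
      rw [Metric.tendstoLocallyUniformlyOn_iff]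
      intro δ hδ τ₀ hτ₀
      obtain ⟨ε, hε, C, hεs, hC⟩ := lip τ₀ hτ₀
      refine ⟨Metric.closedBall τ₀ ε, mem_nhdsWithin_of_mem_nhds (Metric.closedBall_mem_nhds _ hε),
        ?_⟩
      have t : Tendsto (fun w : ℂ => C * ‖w‖) (𝓝[≠] 0) (𝓝 0) := by
        have : Continuous fun w : ℂ => C * ‖w‖ := by fun_prop
        simpa using (this.tendsto 0).mono_left nhdsWithin_le_nhds
      filter_upwards [t.eventually (gt_mem_nhds hδ), self_mem_nhdsWithin,
        mem_nhdsWithin_of_mem_nhds (Metric.ball_mem_nhds (0 : ℂ) (half_pos hr))]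
        with w h1 h2 h3 τ hτ
      have := hC τ hτ w h3
      rw [hΨ τ w h2, dist_comm] at this
      exact this.trans_lt h1
    refine key.differentiableOn ?_ hs
    filter_upwards [self_mem_nhdsWithin,
      mem_nhdsWithin_of_mem_nhds (Metric.ball_mem_nhds (0 : ℂ) hr)] with w h1 h2 τ hτ
    exact (hΦ.differentiableAt_fst hUo (p := (τ, w)) ⟨hτ, h2, h1⟩).differentiableWithinAt
  have hne : ∀ p ∈ s ×ˢ Metric.ball (0 : ℂ) r, p.2 ≠ 0 → DifferentiableAt ℂ Ψ p := by
    rintro ⟨τ, w⟩ hp hw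
    have hm : s ×ˢ (Metric.ball (0 : ℂ) r \ {0}) ∈ 𝓝 (τ, w) := hUo.mem_nhds ⟨hp.1, hp.2, hw⟩
    refine (hΦ.differentiableAt hm).congr_of_eventuallyEq ?_
    filter_upwards [hm] with q hq
    exact hΨ q.1 q.2 hq.2.2
  refine ContinuousOn.differentiableOn_of_separately (hs.prod Metric.isOpen_ball) ?_ ?_ ?_
  · rintro ⟨τ₀, w⟩ hp
    refine ContinuousAt.continuousWithinAt ?_
    by_cases hw : w = 0
    · subst hw
      obtain ⟨ε, hε, C, hεs, hC⟩ := lip τ₀ hp.1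
      have c0 : ContinuousAt (fun τ => Ψ (τ, 0)) τ₀ :=
        hd0.continuousOn.continuousAt (hs.mem_nhds hp.1)
      have t : Tendsto (fun q : ℂ × ℂ => C * ‖q.2‖ + dist (Ψ (q.1, 0)) (Ψ (τ₀, 0)))
          (𝓝 (τ₀, 0)) (𝓝 0) := by
        have t1 : Tendsto (fun q : ℂ × ℂ => C * ‖q.2‖) (𝓝 (τ₀, 0)) (𝓝 0) := by
          have : Continuous fun q : ℂ × ℂ => C * ‖q.2‖ := by fun_prop
          simpa using this.tendsto (τ₀, (0 : ℂ))
        have t2 : Tendsto (fun q : ℂ × ℂ => dist (Ψ (q.1, 0)) (Ψ (τ₀, 0))) (𝓝 (τ₀, 0)) (𝓝 0) := by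
          have := (c0.tendsto.comp (continuous_fst.tendsto (τ₀, (0 : ℂ)))).dist
            (tendsto_const_nhds (x := Ψ (τ₀, 0)))
          simpa using this
        simpa using t1.add t2
      rw [ContinuousAt, tendsto_iff_dist_tendsto_zero]
      refine squeeze_zero' (Eventually.of_forall fun _ => dist_nonneg) ?_ t
      filter_upwards [prod_mem_nhds (Metric.closedBall_mem_nhds τ₀ hε)
        (Metric.ball_mem_nhds (0 : ℂ) (half_pos hr))] with q hq
      exact (dist_triangle _ (Ψ (q.1, 0)) _).trans (by gcongr; exact hC q.1 hq.1 q.2 hq.2)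
    · exact (hne _ hp hw).continuousAt
  · rintro ⟨τ, w⟩ hp
    by_cases hw : w = 0
    · subst hw
      exact hd0.differentiableAt (hs.mem_nhds hp.1)
    · exact DifferentiableAt.comp (f := fun τ : ℂ => (τ, w)) τ (hne _ hp hw) (by fun_prop)
  · rintro ⟨τ, w⟩ hp
    exact (hd2 τ hp.1).differentiableAt (Metric.isOpen_ball.mem_nhds hp.2)

/-! ### Poles and Taylor coefficients in one variable. -/

/-- A function has a pole of order at most `N` if it becomes analytic after multiplication by
`(z - x) ^ N`. -/
theorem meromorphicAt_and_neg_le_order_iff {g : ℂ → ℂ} {x : ℂ} {N : ℕ} :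
    (MeromorphicAt g x ∧ ((-(N : ℤ) : ℤ) : WithTop ℤ) ≤ meromorphicOrderAt g x) ↔
      ∃ h : ℂ → ℂ, AnalyticAt ℂ h x ∧ ∀ᶠ z in 𝓝[≠] x, (z - x) ^ N * g z = h z := by
  have ha : AnalyticAt ℂ (fun z : ℂ => z - x) x := by fun_prop
  have ho : meromorphicOrderAt ((fun z : ℂ => z - x) ^ N) x = ((N : ℤ) : WithTop ℤ) := by
    rw [meromorphicOrderAt_eq_int_iff (ha.pow N).meromorphicAt]
    exact ⟨1, analyticAt_const, one_ne_zero, Eventually.of_forall fun z => by simp⟩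
  constructor
  · rintro ⟨hg, hN⟩
    have hm : MeromorphicAt ((fun z : ℂ => z - x) ^ N * g) x := (ha.pow N).meromorphicAt.mul hg
    have h0 : 0 ≤ meromorphicOrderAt ((fun z : ℂ => z - x) ^ N * g) x := by
      rw [meromorphicOrderAt_mul (ha.pow N).meromorphicAt hg, ho]
      have := add_le_add_right hN ((N : ℤ) : WithTop ℤ)
      refine le_trans (le_of_eq ?_) this
      rw [← WithTop.coe_add]
      simp
    -- A meromorphic germ of nonnegative order becomes analytic once its value at the point is
    -- corrected, which is what the normal form does.
    refine ⟨toMeromorphicNFAt ((fun z : ℂ => z - x) ^ N * g) x, ?_, ?_⟩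
    · rw [← meromorphicNFAt_toMeromorphicNFAt.meromorphicOrderAt_nonneg_iff_analyticAt,
        hm.meromorphicOrderAt_toMeromorphicNFAt]
      exact h0
    · exact hm.eq_nhdsNE_toMeromorphicNFAt
  · rintro ⟨h, hh, e⟩
    have e' : ((fun z : ℂ => z - x) ^ N)⁻¹ * h =ᶠ[𝓝[≠] x] g := by
      filter_upwards [e, self_mem_nhdsWithin] with z hz hzx
      have : (z - x) ^ N ≠ 0 := pow_ne_zero _ (sub_ne_zero.2 hzx)
      simp only [Pi.mul_apply, Pi.inv_apply, Pi.pow_apply, ← hz]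
      rw [inv_mul_cancel_left₀ this]
    have hm := (ha.pow N).meromorphicAt.inv.mul hh.meromorphicAt
    refine ⟨hm.congr e', ?_⟩
    rw [← meromorphicOrderAt_congr e', meromorphicOrderAt_mul (ha.pow N).meromorphicAt.inv
      hh.meromorphicAt, meromorphicOrderAt_inv, ho]
    exact le_add_of_nonneg_right hh.meromorphicOrderAt_nonneg

open Function in
/-- A pointwise convergent expansion in a punctured neighbourhood is a power series expansion. -/
theorem hasFPowerSeriesAt_of_hasSum {a : ℕ → ℂ} {g : ℂ → ℂ}
    (h : ∀ᶠ z in 𝓝[≠] (0 : ℂ), HasSum (fun n => a n * z ^ n) (g z)) :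
    HasFPowerSeriesAt (update g 0 (a 0)) (FormalMultilinearSeries.ofScalars ℂ a) 0 := by
  rw [hasFPowerSeriesAt_iff]
  rw [eventually_nhdsWithin_iff] at h
  filter_upwards [h] with z hz
  by_cases h0 : z = 0
  · subst h0
    simp only [zero_add, update_self]
    have := hasSum_single (f := fun n => (0 : ℂ) ^ n • (FormalMultilinearSeries.ofScalars ℂ a).coeff n)
      0 fun n hn => by simp [hn]
    simpa using this
  · simpa [h0, mul_comm] using hz h0

theorem analyticAt_of_hasSum {a : ℕ → ℂ} {g : ℂ → ℂ}
    (h : ∀ᶠ z in 𝓝[≠] (0 : ℂ), HasSum (fun n => a n * z ^ n) (g z)) :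
    ∃ k : ℂ → ℂ, AnalyticAt ℂ k 0 ∧ ∀ᶠ z in 𝓝[≠] (0 : ℂ), g z = k z :=
  ⟨_, (hasFPowerSeriesAt_of_hasSum h).analyticAt, by
    filter_upwards [self_mem_nhdsWithin] with z hz
    simp [show z ≠ 0 from hz]⟩

/-- The Taylor coefficients are determined by the values in a punctured neighbourhood. -/
theorem eq_taylorCoeff_of_hasSum {a : ℕ → ℂ} {g k : ℂ → ℂ} {r : ℝ} (hr : 0 < r)
    (h : ∀ᶠ z in 𝓝[≠] (0 : ℂ), HasSum (fun n => a n * z ^ n) (g z))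
    (hk : DifferentiableOn ℂ k (Metric.ball 0 r)) (e : ∀ᶠ z in 𝓝[≠] (0 : ℂ), g z = k z) (n : ℕ) :
    a n = (n.factorial : ℂ)⁻¹ * iteratedDeriv n k 0 := by
  have hf := hasFPowerSeriesAt_of_hasSum h
  have hka : AnalyticAt ℂ k 0 := hk.analyticAt (Metric.ball_mem_nhds _ hr)
  have e' : Function.update g 0 (a 0) =ᶠ[𝓝[≠] 0] k := by
    filter_upwards [e, self_mem_nhdsWithin] with z hz hz0
    simp [show z ≠ 0 from hz0, hz]
  have e2 := (hf.analyticAt.frequently_eq_iff_eventually_eq hka).1 e'.frequently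
  have hf' := hf.congr e2
  have := hf'.eq_formalMultilinearSeries
    ((hk.analyticAt (Metric.ball_mem_nhds _ hr)).hasFPowerSeriesAt)
  have := congrArg (fun p => FormalMultilinearSeries.coeff p n) this
  simp only [FormalMultilinearSeries.coeff_ofScalars] at this
  rw [this, div_eq_inv_mul]

end


namespace QuasiJacobi

noncomputable section

open Topology Filter SummationFilter

/-! ### The domain -/

/-- The pairs `(τ, z)` such that `z` is not one of the lattice points indexed by `S`. -/
def latticeCompl (S : Set (ℤ × ℤ)) : Set (ℂ × ℂ) :=
  {p | 0 < p.1.im ∧ ∀ x ∈ S, p.2 ≠ (x.1 : ℂ) + x.2 * p.1}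

/-- The lattice is locally finite, uniformly in `τ`: with `‖τ‖`, `‖z‖` bounded and the imaginary
part of `τ` bounded below, only finitely many `(m, n)` can satisfy `z = m + nτ`. Each of the
remaining conditions is open. -/
lemma isOpen_latticeCompl (S : Set (ℤ × ℤ)) : IsOpen (latticeCompl S) := by
  rw [isOpen_iff_eventually]
  rintro ⟨τ₀, z₀⟩ ⟨hτ, hz⟩
  simp only at hτ
  set ε := τ₀.im / 2
  set R := ‖τ₀‖ + ‖z₀‖ + 1
  have hε : 0 < ε := half_pos hτ
  have hR : 0 < R := by positivity
  -- If `z = m + nτ`, then the imaginary part gives `|n| < R/ε`, and then `|m| ≤ ‖z‖ + |n| ‖τ‖`.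
  obtain ⟨K, hK⟩ := exists_int_gt (max (R / ε) (R + R / ε * R))
  have hK1 := (le_max_left _ _).trans_lt hK
  have hK2 := (le_max_right _ _).trans_lt hK
  have hfin : (S ∩ (Set.Icc (-K) K ×ˢ Set.Icc (-K) K)).Finite :=
    ((Set.finite_Icc _ _).prod (Set.finite_Icc _ _)).inter_of_right _
  have e1 : ∀ᶠ p : ℂ × ℂ in 𝓝 (τ₀, z₀), ε < p.1.im :=
    (Continuous.tendsto (by fun_prop : Continuous fun p : ℂ × ℂ => p.1.im) _).eventually
      (lt_mem_nhds (half_lt_self hτ))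
  have e2 : ∀ᶠ p : ℂ × ℂ in 𝓝 (τ₀, z₀), ‖p.1‖ < R :=
    (Continuous.tendsto (by fun_prop : Continuous fun p : ℂ × ℂ => ‖p.1‖) _).eventually
      (gt_mem_nhds (by simp only [R]; linarith [norm_nonneg z₀]))
  have e3 : ∀ᶠ p : ℂ × ℂ in 𝓝 (τ₀, z₀), ‖p.2‖ < R :=
    (Continuous.tendsto (by fun_prop : Continuous fun p : ℂ × ℂ => ‖p.2‖) _).eventually
      (gt_mem_nhds (by simp only [R]; linarith [norm_nonneg τ₀]))
  have e4 : ∀ᶠ p : ℂ × ℂ in 𝓝 (τ₀, z₀), ∀ x ∈ S ∩ (Set.Icc (-K) K ×ˢ Set.Icc (-K) K),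
      p.2 ≠ (x.1 : ℂ) + x.2 * p.1 := by
    rw [eventually_all_finite hfin]
    intro x hx
    exact (isOpen_ne_fun (by fun_prop) (by fun_prop)).mem_nhds (hz x hx.1)
  filter_upwards [e1, e2, e3, e4] with p h1 h2 h3 h4
  refine ⟨hε.trans h1, fun x hx e => h4 x ⟨hx, ?_⟩ e⟩
  have him : p.2.im = x.2 * p.1.im := by rw [e]; simp
  have hn : |(x.2 : ℝ)| < R / ε := by
    rw [lt_div_iff₀ hε]
    have := (Complex.abs_im_le_norm p.2).trans_lt h3
    rw [him, abs_mul, abs_of_pos (hε.trans h1)] at this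
    exact (mul_le_mul_of_nonneg_left h1.le (abs_nonneg _)).trans_lt this
  have hm : |(x.1 : ℝ)| < R + R / ε * R := by
    have e' : (x.1 : ℂ) = p.2 - x.2 * p.1 := by rw [e]; ring
    have : ‖(x.1 : ℂ)‖ ≤ ‖p.2‖ + |(x.2 : ℝ)| * ‖p.1‖ := by
      rw [e']
      refine (norm_sub_le _ _).trans (le_of_eq ?_)
      rw [norm_mul, Complex.norm_intCast]
    rw [Complex.norm_intCast] at this
    refine this.trans_lt (add_lt_add_of_lt_of_le h3 ?_)
    exact mul_le_mul hn.le h2.le (norm_nonneg _) (by positivity)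
  have b1 : |x.1| ≤ K := by exact_mod_cast (hm.trans hK2).le
  have b2 : |x.2| ≤ K := by exact_mod_cast (hn.trans hK1).le
  exact ⟨abs_le.1 b1, abs_le.1 b2⟩

lemma dom_eq_latticeCompl : dom = latticeCompl Set.univ := by
  ext p
  simp [dom, latticeCompl]

lemma isOpen_dom : IsOpen dom := dom_eq_latticeCompl ▸ isOpen_latticeCompl _

lemma ext_of_notMem (f : Fn) {τ z : ℂ} (h : (τ, z) ∉ dom) : ext f τ z = 0 := by
  simp [ext, h]

lemma ext_dz (f : Fn) {τ z : ℂ} (h : (τ, z) ∈ dom) : ext (dz f) τ z = deriv (ext f τ) z := by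
  rw [ext_of_mem _ h]
  rfl

lemma ext_dtau (f : Fn) {τ z : ℂ} (h : (τ, z) ∈ dom) :
    ext (dtau f) τ z = (Real.pi : ℂ) / (2 * Complex.I) * deriv (fun t => ext f t z) τ := by
  rw [ext_of_mem _ h]
  rfl

lemma eventually_mem_dom_z {τ z : ℂ} (h : (τ, z) ∈ dom) : ∀ᶠ w in 𝓝 z, (τ, w) ∈ dom :=
  (Continuous.tendsto (by fun_prop : Continuous fun w : ℂ => (τ, w)) z).eventually
    (isOpen_dom.mem_nhds h)

lemma eventually_mem_dom_tau {τ z : ℂ} (h : (τ, z) ∈ dom) : ∀ᶠ t in 𝓝 τ, (t, z) ∈ dom :=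
  (Continuous.tendsto (by fun_prop : Continuous fun t : ℂ => (t, z)) τ).eventually
    (isOpen_dom.mem_nhds h)

/-! ### Calculus of holomorphic functions on the domain. -/

section Holo

variable {f : Fn}

lemma hasDerivAt_ext_z (hf : DifferentiableOn ℂ (fun p : ℂ × ℂ => ext f p.1 p.2) dom)
    {τ z : ℂ} (h : (τ, z) ∈ dom) : HasDerivAt (ext f τ) (ext (dz f) τ z) z := by
  rw [ext_dz f h]
  exact (hf.differentiableAt_snd isOpen_dom h).hasDerivAt

lemma hasDerivAt_ext_tau (hf : DifferentiableOn ℂ (fun p : ℂ × ℂ => ext f p.1 p.2) dom)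
    {τ z : ℂ} (h : (τ, z) ∈ dom) :
    HasDerivAt (fun t => ext f t z) (2 * Complex.I / Real.pi * ext (dtau f) τ z) τ := by
  have : 2 * Complex.I / Real.pi * ext (dtau f) τ z = deriv (fun t => ext f t z) τ := by
    rw [ext_dtau f h]
    have h1 : (Real.pi : ℂ) ≠ 0 := by exact_mod_cast Real.pi_ne_zero
    have h2 := Complex.I_ne_zero
    field_simp
  rw [this]
  exact (hf.differentiableAt_fst isOpen_dom h).hasDerivAt

/-- The derivative of a holomorphic function along a curve `t ↦ (u t, v t)`. -/
lemma hasDerivAt_ext_comp (hf : DifferentiableOn ℂ (fun p : ℂ × ℂ => ext f p.1 p.2) dom)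
    {u v : ℂ → ℂ} {u' v' t : ℂ} (hu : HasDerivAt u u' t) (hv : HasDerivAt v v' t)
    (h : (u t, v t) ∈ dom) :
    HasDerivAt (fun t => ext f (u t) (v t))
      (u' * (2 * Complex.I / Real.pi * ext (dtau f) (u t) (v t)) + v' * ext (dz f) (u t) (v t))
      t := by
  have hF := (hf.differentiableAt (isOpen_dom.mem_nhds h)).hasFDerivAt
  set L := fderiv ℂ (fun p : ℂ × ℂ => ext f p.1 p.2) (u t, v t)
  have h1 : HasDerivAt (fun s => ext f s (v t)) (L (1, 0)) (u t) :=
    hF.comp_hasDerivAt (f := fun s : ℂ => (s, v t)) (u t)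
      ((hasDerivAt_id _).prodMk (hasDerivAt_const _ _))
  have h2 : HasDerivAt (fun s => ext f (u t) s) (L (0, 1)) (v t) :=
    hF.comp_hasDerivAt (f := fun s : ℂ => (u t, s)) (v t)
      ((hasDerivAt_const _ _).prodMk (hasDerivAt_id _))
  rw [← h1.unique (hasDerivAt_ext_tau hf h), ← h2.unique (hasDerivAt_ext_z hf h)]
  have h3 := hF.comp_hasDerivAt (f := fun s : ℂ => (u s, v s)) t (hu.prodMk hv)
  have e : L (u', v') = u' * L (1, 0) + v' * L (0, 1) := by
    have : ((u', v') : ℂ × ℂ) = u' • ((1, 0) : ℂ × ℂ) + v' • ((0, 1) : ℂ × ℂ) := by simp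
    rw [this, map_add, map_smul, map_smul, smul_eq_mul, smul_eq_mul]
  rw [← e]
  exact h3

lemma differentiableOn_ext_dz (hf : DifferentiableOn ℂ (fun p : ℂ × ℂ => ext f p.1 p.2) dom) :
    DifferentiableOn ℂ (fun p : ℂ × ℂ => ext (dz f) p.1 p.2) dom :=
  (differentiableOn_deriv_snd isOpen_dom hf).congr fun _ hp => ext_dz f hp

lemma differentiableOn_ext_dtau (hf : DifferentiableOn ℂ (fun p : ℂ × ℂ => ext f p.1 p.2) dom) :
    DifferentiableOn ℂ (fun p : ℂ × ℂ => ext (dtau f) p.1 p.2) dom :=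
  ((differentiableOn_deriv_fst isOpen_dom hf).const_mul _).congr fun _ hp => ext_dtau f hp

/-- Near a lattice point, a holomorphic function with poles of order at most `N` becomes
holomorphic in both variables after multiplication by a power of the distance. -/
lemma exists_local_extension (hf : DifferentiableOn ℂ (fun p : ℂ × ℂ => ext f p.1 p.2) dom)
    (m n : ℤ) (N : ℕ)
    (hex : ∀ τ : ℍ, ∃ h : ℂ → ℂ, AnalyticAt ℂ h 0 ∧
      ∀ᶠ w in 𝓝[≠] (0 : ℂ), w ^ N * ext f τ (w + (m + n * (τ : ℂ))) = h w) (τ₀ : ℍ) :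
    ∃ (s : Set ℂ) (r : ℝ) (Ψ : ℂ × ℂ → ℂ), IsOpen s ∧ (τ₀ : ℂ) ∈ s ∧ 0 < r ∧
      DifferentiableOn ℂ Ψ (s ×ˢ Metric.ball 0 r) ∧
      ∀ τ ∈ s, ∀ w ∈ Metric.ball (0 : ℂ) r, w ≠ 0 → (τ, w + (m + n * τ)) ∈ dom ∧
        Ψ (τ, w) = w ^ N * ext f τ (w + (m + n * τ)) := by
  -- Only the other lattice points are removed here, so in the coordinate `w = z - (m + nτ)` this
  -- set contains a full neighbourhood of `(τ₀, 0)`.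
  have hU := isOpen_latticeCompl ({(m, n)}ᶜ)
  have h0 : ((τ₀ : ℂ), (0 : ℂ) + (m + n * τ₀)) ∈ latticeCompl ({(m, n)}ᶜ) := by
    refine ⟨τ₀.im_pos, fun x hx e => hx ?_⟩
    simp only [zero_add] at e
    have hn : (n : ℝ) = x.2 := by
      have := congrArg Complex.im e
      simp only [Complex.add_im, Complex.intCast_im, Complex.mul_im, Complex.intCast_re,
        zero_mul, add_zero, zero_add] at this
      exact mul_right_cancel₀ τ₀.im_pos.ne' this
    have hn' : n = x.2 := by exact_mod_cast hn
    rw [hn', add_left_inj] at e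
    exact Prod.ext (by exact_mod_cast e.symm) hn'.symm
  have hc : Continuous fun p : ℂ × ℂ => (p.1, p.2 + (m + n * p.1)) := by fun_prop
  obtain ⟨s, t, hs, ht, hτs, h0t, hst⟩ := isOpen_prod_iff.1 (hU.preimage hc) (τ₀ : ℂ) 0 h0
  obtain ⟨r, hr, hrt⟩ := Metric.isOpen_iff.1 ht 0 h0t
  have hdom : ∀ τ ∈ s, ∀ w ∈ Metric.ball (0 : ℂ) r, w ≠ 0 → (τ, w + (m + n * τ)) ∈ dom := by
    intro τ hτ w hw hw0
    obtain ⟨h1, h2⟩ := hst (Set.mk_mem_prod hτ (hrt hw))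
    refine ⟨h1, fun m' n' e => ?_⟩
    by_cases hx : (m', n') = (m, n)
    · rw [Prod.mk.injEq] at hx
      rw [hx.1, hx.2] at e
      exact hw0 (by simpa using e)
    · exact h2 (m', n') hx e
  have hΦ : DifferentiableOn ℂ (fun p : ℂ × ℂ => p.2 ^ N * ext f p.1 (p.2 + (m + n * p.1)))
      (s ×ˢ (Metric.ball 0 r \ {0})) := by
    refine DifferentiableOn.mul (by fun_prop) ?_
    exact hf.comp (g := fun p : ℂ × ℂ => ext f p.1 p.2)
      (f := fun p : ℂ × ℂ => (p.1, p.2 + (m + n * p.1))) (by fun_prop)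
      fun p hp => hdom p.1 hp.1 p.2 hp.2.1 hp.2.2
  obtain ⟨Ψ, hΨ, e⟩ := exists_differentiableOn_extension hs hΦ fun τ hτ =>
    hex ⟨τ, (hst (Set.mk_mem_prod hτ h0t)).1⟩
  exact ⟨s, r, Ψ, hs, hτs, hr, hΨ, fun τ hτ w hw hw0 => ⟨hdom τ hτ w hw hw0, e τ w hw0⟩⟩

end Holo

/-- Poles of order at most `N` at all lattice points. -/
lemma poles_iff (f : Fn) (N : ℕ) :
    (∀ (τ : ℍ) (m n : ℤ), MeromorphicAt (ext f τ) (m + n * (τ : ℂ)) ∧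
      ((-(N : ℤ) : ℤ) : WithTop ℤ) ≤ meromorphicOrderAt (ext f τ) (m + n * (τ : ℂ))) ↔
    ∀ (τ : ℍ) (m n : ℤ), ∃ h : ℂ → ℂ, AnalyticAt ℂ h 0 ∧
      ∀ᶠ w in 𝓝[≠] (0 : ℂ), w ^ N * ext f τ (w + (m + n * (τ : ℂ))) = h w := by
  refine forall_congr' fun τ => forall_congr' fun m => forall_congr' fun n => ?_
  rw [meromorphicAt_and_neg_le_order_iff]
  set x : ℂ := m + n * (τ : ℂ)
  have t1 : Tendsto (fun w : ℂ => w + x) (𝓝[≠] 0) (𝓝[≠] x) := by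
    refine tendsto_nhdsWithin_iff.2 ⟨?_, ?_⟩
    · have : Continuous fun w : ℂ => w + x := by fun_prop
      simpa using (this.tendsto 0).mono_left nhdsWithin_le_nhds
    · filter_upwards [self_mem_nhdsWithin] with w hw
      simpa using hw
  have t2 : Tendsto (fun w : ℂ => w - x) (𝓝[≠] x) (𝓝[≠] 0) := by
    refine tendsto_nhdsWithin_iff.2 ⟨?_, ?_⟩
    · have : Continuous fun w : ℂ => w - x := by fun_prop
      simpa using (this.tendsto x).mono_left nhdsWithin_le_nhds
    · filter_upwards [self_mem_nhdsWithin] with w hw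
      simpa [sub_eq_zero] using hw
  constructor
  · rintro ⟨h, hh, e⟩
    refine ⟨fun w => h (w + x), ?_, ?_⟩
    · exact AnalyticAt.comp (f := fun w : ℂ => w + x) (x := 0) (by simpa using hh) (by fun_prop)
    · filter_upwards [t1.eventually e] with w hw
      simpa using hw
  · rintro ⟨h, hh, e⟩
    refine ⟨fun z => h (z - x), ?_, ?_⟩
    · exact AnalyticAt.comp (f := fun w : ℂ => w - x) (x := x) (by simpa using hh) (by fun_prop)
    · filter_upwards [t2.eventually e] with w hw
      simpa using hw

/-! ### Derivatives of functions of `τ` -/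

lemma mdiff_deriv {φ : ℍ → ℂ} (h : MDiff φ) :
    MDiff fun τ : ℍ => deriv (φ ∘ UpperHalfPlane.ofComplex) τ := by
  rw [UpperHalfPlane.mdifferentiable_iff] at h ⊢
  refine (h.deriv UpperHalfPlane.isOpen_upperHalfPlaneSet).congr fun z hz => ?_
  simp [Function.comp_apply, UpperHalfPlane.ofComplex_apply_of_im_pos hz]

/-- Cauchy's estimate on discs of radius one. -/
lemma isBoundedAtImInfty_deriv {φ : ℍ → ℂ} (h : MDiff φ)
    (hb : UpperHalfPlane.IsBoundedAtImInfty φ) :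
    UpperHalfPlane.IsBoundedAtImInfty fun τ : ℍ => deriv (φ ∘ UpperHalfPlane.ofComplex) τ := by
  rw [UpperHalfPlane.mdifferentiable_iff] at h
  rw [UpperHalfPlane.isBoundedAtImInfty_iff] at hb ⊢
  obtain ⟨M, A, hM⟩ := hb
  -- This height keeps the closed unit disc around `τ` above both the real axis and the bound `A`.
  refine ⟨M / 1, max A 0 + 2, fun τ hτ => ?_⟩
  have him : ∀ z ∈ Metric.closedBall (τ : ℂ) 1, max A 0 < z.im := by
    intro z hz
    rw [mem_closedBall_iff_norm] at hz
    have := (Complex.abs_im_le_norm _).trans hz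
    rw [Complex.sub_im, abs_le] at this
    have h2 : (τ : ℂ).im = τ.im := rfl
    linarith [this.1]
  refine Complex.norm_deriv_le_of_forall_mem_sphere_norm_le one_pos ?_ fun z hz => ?_
  · refine DifferentiableOn.diffContOnCl ?_
    rw [closure_ball _ one_ne_zero]
    exact h.mono fun z hz => (le_max_right _ _).trans_lt (him z hz)
  · have hz' := him z (Metric.sphere_subset_closedBall hz)
    have hz0 := (le_max_right _ _).trans_lt hz'
    rw [Function.comp_apply, UpperHalfPlane.ofComplex_apply_of_im_pos hz0]
    exact hM _ ((le_max_left _ _).trans hz'.le)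

/-! ### Derivatives of singular functions -/

/-- If `Ψ = w ^ N f` is the regular function at a lattice point, then `w ^ (N + 1) ∂_z f = w Ψ' - N
Ψ`: the pole order grows by at most one, and the Laurent coefficients are multiplied by `n - N`. -/
lemma isSingular_dz {f : Fn} (hf : IsSingular f) : IsSingular (dz f) where
  holo := differentiableOn_ext_dz hf.holo
  z_add_one τ z := by
    by_cases h : (τ, z) ∈ dom
    · rw [ext_dz f h, ext_dz f ((mem_dom_z τ z).2 h), ← deriv_comp_add_const]
      simp_rw [hf.z_add_one]
    · rw [ext_of_notMem _ h, ext_of_notMem _ (mt (mem_dom_z τ z).1 h)]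
  tau_add_one τ z := by
    by_cases h : (τ, z) ∈ dom
    · rw [ext_dz f h, ext_dz f ((mem_dom_tau τ z).2 h)]
      congr 1
      ext w
      exact hf.tau_add_one τ w
    · rw [ext_of_notMem _ h, ext_of_notMem _ (mt (mem_dom_tau τ z).1 h)]
  poles := by
    obtain ⟨N, hN⟩ := hf.poles
    rw [poles_iff] at hN
    refine ⟨N + 1, (poles_iff _ _).2 fun τ m n => ?_⟩
    obtain ⟨s, r, Ψ, hs, hτ, hr, hΨ, e⟩ := exists_local_extension hf.holo m n N
      (fun τ => hN τ m n) τ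
    have hd : DifferentiableOn ℂ (fun w => Ψ ((τ : ℂ), w)) (Metric.ball 0 r) := fun w hw =>
      (hΨ.differentiableAt_snd (hs.prod Metric.isOpen_ball)
        (p := ((τ : ℂ), w)) ⟨hτ, hw⟩).differentiableWithinAt
    have ha := hd.analyticAt (Metric.ball_mem_nhds _ hr)
    refine ⟨fun w => w * deriv (fun w => Ψ ((τ : ℂ), w)) w - N * Ψ ((τ : ℂ), w),
      (analyticAt_id.mul ha.deriv).sub (analyticAt_const.mul ha), ?_⟩
    filter_upwards [self_mem_nhdsWithin, mem_nhdsWithin_of_mem_nhds (Metric.ball_mem_nhds _ hr)]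
      with w hw0 hw
    obtain ⟨h1, h2⟩ := e τ hτ w hw hw0
    have h3 : HasDerivAt (fun w => Ψ ((τ : ℂ), w))
        (N * w ^ (N - 1) * ext f τ (w + (m + n * τ)) +
          w ^ N * (ext (dz f) τ (w + (m + n * τ)))) w := by
      have := (hasDerivAt_pow N w).mul ((hasDerivAt_ext_z hf.holo h1).comp_add_const w _)
      refine this.congr_of_eventuallyEq ?_
      filter_upwards [Metric.isOpen_ball.mem_nhds hw, isOpen_ne.mem_nhds hw0] with v hv hv0
      exact (e τ hτ v hv hv0).2
    rw [h3.deriv, h2]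
    -- The exponent `N - 1` in the power rule is truncated, hence the separate case `N = 0`.
    rcases N with _ | N
    · simp
    · simp only [Nat.add_sub_cancel]
      ring
  laurent := by
    obtain ⟨N, A, hA, hAs⟩ := hf.laurent
    refine ⟨N + 1, fun n => fun τ => ((n : ℂ) - N) * A n τ, fun n => ⟨?_, ?_⟩, fun τ => ?_⟩
    · exact mdifferentiable_const.mul (hA n).1
    · exact (const_boundedAtFilter _ _).mul (hA n).2
    · have hP := hasFPowerSeriesAt_of_hasSum (hAs τ)
      set k := Function.update (fun z => z ^ N * ext f τ z) 0 (A 0 τ)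
      obtain ⟨r, hr, hk⟩ := hP.analyticAt.exists_ball_analyticOnNhd
      have hkd : DifferentiableOn ℂ k (Metric.ball 0 r) := hk.differentiableOn
      have hkA : ∀ n, A n τ = (n.factorial : ℂ)⁻¹ * iteratedDeriv n k 0 := by
        refine eq_taylorCoeff_of_hasSum hr (hAs τ) hkd ?_
        filter_upwards [self_mem_nhdsWithin] with z hz
        simp [k, show z ≠ 0 from hz]
      have hdom := lattice_isolated τ 0 0
      simp only [Int.cast_zero, zero_mul, add_zero] at hdom
      filter_upwards [self_mem_nhdsWithin, hdom,
        mem_nhdsWithin_of_mem_nhds (Metric.ball_mem_nhds _ hr)] with z hz0 hzd hz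
      have s1 := Complex.hasSum_taylorSeries_on_ball hkd hz
      have s2 := Complex.hasSum_taylorSeries_on_ball (hkd.deriv Metric.isOpen_ball) hz
      have e1 : k z = z ^ N * ext f τ z := by simp [k, show z ≠ 0 from hz0]
      have e2 : HasDerivAt k (N * z ^ (N - 1) * ext f τ z + z ^ N * ext (dz f) τ z) z := by
        have := (hasDerivAt_pow N z).mul (hasDerivAt_ext_z hf.holo hzd)
        refine this.congr_of_eventuallyEq ?_
        filter_upwards [isOpen_ne.mem_nhds hz0] with v hv0
        simp [k, show v ≠ 0 from hv0]
      have s3 : HasSum (fun n : ℕ => (n : ℂ) * A n τ * z ^ n) (z * deriv k z) := by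
        rw [← hasSum_nat_add_iff' 1]
        simp only [Finset.range_one, Finset.sum_singleton, Nat.cast_zero, zero_mul, sub_zero]
        refine hasSum_of_eq (s2.mul_left z) fun n => ?_
        rw [hkA, iteratedDeriv_succ', Nat.factorial_succ]
        simp only [smul_eq_mul, sub_zero]
        have : ((n : ℂ) + 1) ≠ 0 := by exact_mod_cast n.succ_ne_zero
        push_cast
        field_simp
        ring
      have s4 := s3.sub (s1.mul_left (N : ℂ))
      rw [e2.deriv, e1] at s4
      convert hasSum_of_eq s4 fun n => ?_ using 1
      · rcases N with _ | N
        · simp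
        · simp only [Nat.add_sub_cancel]
          ring
      · rw [hkA n]
        simp only [smul_eq_mul, sub_zero]
        ring

/-- The lattice point `m + nτ` moves with `τ`, so in the coordinate `w` the chain rule gives `∂Ψ/∂τ
= w ^ N (∂f/∂τ + n ∂f/∂z)`. The correction `n ∂f/∂z` costs one more pole order. At `z = 0` there is
no such correction, and the Laurent series may be differentiated term by term. -/
lemma isSingular_dtau {f : Fn} (hf : IsSingular f) : IsSingular (dtau f) where
  holo := differentiableOn_ext_dtau hf.holo
  z_add_one τ z := by
    by_cases h : (τ, z) ∈ dom
    · rw [ext_dtau f h, ext_dtau f ((mem_dom_z τ z).2 h)]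
      simp_rw [hf.z_add_one]
    · rw [ext_of_notMem _ h, ext_of_notMem _ (mt (mem_dom_z τ z).1 h)]
  tau_add_one τ z := by
    by_cases h : (τ, z) ∈ dom
    · rw [ext_dtau f h, ext_dtau f ((mem_dom_tau τ z).2 h),
        ← deriv_comp_add_const (fun t => ext f t z)]
      simp_rw [hf.tau_add_one]
    · rw [ext_of_notMem _ h, ext_of_notMem _ (mt (mem_dom_tau τ z).1 h)]
  poles := by
    obtain ⟨N, hN⟩ := hf.poles
    rw [poles_iff] at hN
    refine ⟨N + 1, (poles_iff _ _).2 fun τ m n => ?_⟩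
    obtain ⟨s, r, Ψ, hs, hτ, hr, hΨ, e⟩ := exists_local_extension hf.holo m n N
      (fun τ => hN τ m n) τ
    have hU : IsOpen (s ×ˢ Metric.ball (0 : ℂ) r) := hs.prod Metric.isOpen_ball
    have hd : DifferentiableOn ℂ (fun w => Ψ ((τ : ℂ), w)) (Metric.ball 0 r) := fun w hw =>
      (hΨ.differentiableAt_snd hU (p := ((τ : ℂ), w)) ⟨hτ, hw⟩).differentiableWithinAt
    have ha := hd.analyticAt (Metric.ball_mem_nhds _ hr)
    have hd' : DifferentiableOn ℂ (fun w => deriv (fun t => Ψ (t, w)) (τ : ℂ))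
        (Metric.ball 0 r) := fun w hw =>
      ((differentiableOn_deriv_fst hU hΨ).differentiableAt_snd hU
        (p := ((τ : ℂ), w)) ⟨hτ, hw⟩).differentiableWithinAt
    have ha' := hd'.analyticAt (Metric.ball_mem_nhds _ hr)
    -- Solve `∂Ψ/∂τ = w ^ N (∂f/∂τ + n ∂f/∂z)` for `∂f/∂τ` and use `w ^ (N + 1) ∂f/∂z = w ∂Ψ/∂w - N
    -- Ψ`.
    refine ⟨fun w => (Real.pi : ℂ) / (2 * Complex.I) * (w * deriv (fun t => Ψ (t, w)) (τ : ℂ) -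
        n * (w * deriv (fun w => Ψ ((τ : ℂ), w)) w - N * Ψ ((τ : ℂ), w))),
      analyticAt_const.mul ((analyticAt_id.mul ha').sub (analyticAt_const.mul
        ((analyticAt_id.mul ha.deriv).sub (analyticAt_const.mul ha)))), ?_⟩
    filter_upwards [self_mem_nhdsWithin, mem_nhdsWithin_of_mem_nhds (Metric.ball_mem_nhds _ hr)]
      with w hw0 hw
    obtain ⟨h1, h2⟩ := e τ hτ w hw hw0
    have h3 : HasDerivAt (fun w => Ψ ((τ : ℂ), w))
        (N * w ^ (N - 1) * ext f τ (w + (m + n * τ)) +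
          w ^ N * (ext (dz f) τ (w + (m + n * τ)))) w := by
      have := (hasDerivAt_pow N w).mul ((hasDerivAt_ext_z hf.holo h1).comp_add_const w _)
      refine this.congr_of_eventuallyEq ?_
      filter_upwards [Metric.isOpen_ball.mem_nhds hw, isOpen_ne.mem_nhds hw0] with v hv hv0
      exact (e τ hτ v hv hv0).2
    have h4 : HasDerivAt (fun t => Ψ (t, w))
        (w ^ N * (1 * (2 * Complex.I / Real.pi * ext (dtau f) τ (w + (m + n * τ))) +
          n * ext (dz f) τ (w + (m + n * τ)))) (τ : ℂ) := by
      have hv : HasDerivAt (fun t : ℂ => w + (m + n * t)) n (τ : ℂ) := by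
        simpa using (((hasDerivAt_id (τ : ℂ)).const_mul (n : ℂ)).const_add (m : ℂ)).const_add w
      have := (hasDerivAt_ext_comp hf.holo (hasDerivAt_id (τ : ℂ)) hv h1).const_mul (w ^ N)
      refine this.congr_of_eventuallyEq ?_
      filter_upwards [hs.mem_nhds hτ] with t ht
      exact (e t ht w hw hw0).2
    rw [h3.deriv, h4.deriv, h2]
    have hpi : (Real.pi : ℂ) ≠ 0 := by exact_mod_cast Real.pi_ne_zero
    have hI := Complex.I_ne_zero
    rcases N with _ | N
    · simp only [pow_zero, Nat.cast_zero]
      field_simp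
      ring
    · simp only [Nat.add_sub_cancel]
      field_simp
      ring
  laurent := by
    obtain ⟨N, A, hA, hAs⟩ := hf.laurent
    refine ⟨N, fun n => fun τ => (Real.pi : ℂ) / (2 * Complex.I) *
      deriv (A n ∘ UpperHalfPlane.ofComplex) τ, fun n => ⟨?_, ?_⟩, fun τ => ?_⟩
    · exact mdifferentiable_const.mul (mdiff_deriv (hA n).1)
    · exact (const_boundedAtFilter _ _).mul (isBoundedAtImInfty_deriv (hA n).1 (hA n).2)
    · obtain ⟨s, r, Ψ, hs, hτ, hr, hΨ, e⟩ := exists_local_extension hf.holo 0 0 N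
        (fun τ => by simpa using analyticAt_of_hasSum (hAs τ)) τ
      simp only [Int.cast_zero, zero_mul, add_zero] at e
      have hU : IsOpen (s ×ˢ Metric.ball (0 : ℂ) r) := hs.prod Metric.isOpen_ball
      obtain ⟨ε, hε, hεs⟩ := Metric.nhds_basis_closedBall.mem_iff.1 (hs.mem_nhds hτ)
      have him : ∀ t ∈ s, 0 < t.im := fun t ht => by
        have hm : ((r / 2 : ℝ) : ℂ) ∈ Metric.ball (0 : ℂ) r := by
          rw [mem_ball_zero_iff, Complex.norm_real, Real.norm_of_nonneg (by positivity)]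
          linarith
        exact (e t ht _ hm (by exact_mod_cast (half_pos hr).ne')).1.1
      have hd : ∀ t ∈ s, DifferentiableOn ℂ (fun w => Ψ (t, w)) (Metric.ball 0 r) :=
        fun t ht w hw => (hΨ.differentiableAt_snd hU (p := (t, w)) ⟨ht, hw⟩).differentiableWithinAt
      have hcoeff : ∀ t ∈ s, ∀ n, (A n ∘ UpperHalfPlane.ofComplex) t =
          (n.factorial : ℂ)⁻¹ * iteratedDeriv n (fun w => Ψ (t, w)) 0 := by
        intro t ht n
        rw [Function.comp_apply, UpperHalfPlane.ofComplex_apply_of_im_pos (him t ht)]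
        refine eq_taylorCoeff_of_hasSum (a := fun n => A n ⟨t, him t ht⟩) hr
          (hAs ⟨t, him t ht⟩) (hd t ht) ?_ n
        filter_upwards [self_mem_nhdsWithin,
          mem_nhdsWithin_of_mem_nhds (Metric.ball_mem_nhds _ hr)] with w hw0 hw
        exact (e t ht w hw hw0).2.symm
      have hK : IsCompact (Metric.closedBall (τ : ℂ) ε ×ˢ Metric.sphere (0 : ℂ) (r / 2)) :=
        (isCompact_closedBall _ _).prod (isCompact_sphere _ _)
      obtain ⟨M, hM⟩ := hK.exists_bound_of_continuousOn (hΨ.continuousOn.mono (Set.prod_mono hεs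
        (Metric.sphere_subset_closedBall.trans (Metric.closedBall_subset_ball (by linarith)))))
      -- Cauchy's estimates on the circle of radius `r/2`, uniform for `τ` in a small disc, give the
      -- majorant for termwise differentiation when `‖w‖ < r/2`.
      have hbound : ∀ n, ∀ t ∈ Metric.ball (τ : ℂ) ε,
          ‖(A n ∘ UpperHalfPlane.ofComplex) t‖ ≤ M / (r / 2) ^ n := by
        intro n t ht
        have hts := hεs (Metric.ball_subset_closedBall ht)
        have hdc : DiffContOnCl ℂ (fun w => Ψ (t, w)) (Metric.ball 0 (r / 2)) := by
          refine DifferentiableOn.diffContOnCl ?_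
          rw [closure_ball _ (by positivity)]
          exact (hd t hts).mono (Metric.closedBall_subset_ball (by linarith))
        have := Complex.norm_iteratedDeriv_le_of_forall_mem_sphere_norm_le n (half_pos hr) hdc
          fun w hw => hM (t, w) ⟨Metric.ball_subset_closedBall ht, hw⟩
        rw [hcoeff t hts, norm_mul, norm_inv, Complex.norm_natCast,
          inv_mul_le_iff₀ (by exact_mod_cast n.factorial_pos)]
        refine this.trans (le_of_eq ?_)
        ring
      filter_upwards [self_mem_nhdsWithin,
        mem_nhdsWithin_of_mem_nhds (Metric.ball_mem_nhds _ (half_pos hr))] with w hw0 hw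
      have hwr := Metric.ball_subset_ball (by linarith : r / 2 ≤ r) hw
      have hsum : Summable fun n : ℕ => M / (r / 2) ^ n * ‖w‖ ^ n := by
        have : Summable fun n : ℕ => (‖w‖ / (r / 2)) ^ n :=
          summable_geometric_of_lt_one (by positivity)
            ((div_lt_one (half_pos hr)).2 (by simpa using hw))
        refine (this.mul_left M).congr fun n => ?_
        rw [div_pow]
        ring
      have key := Complex.hasSum_deriv_of_summable_norm hsum
        (F := fun n t => (A n ∘ UpperHalfPlane.ofComplex) t * w ^ n) (fun n => ?_)
        (Metric.isOpen_ball (x := (τ : ℂ)) (ε := ε)) (fun n t ht => ?_) (Metric.mem_ball_self hε)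
      · have e1 : (fun t => ∑' n, (A n ∘ UpperHalfPlane.ofComplex) t * w ^ n) =ᶠ[𝓝 (τ : ℂ)]
            fun t => w ^ N * ext f t w := by
          filter_upwards [Metric.ball_mem_nhds (τ : ℂ) hε] with t ht
          have hts := hεs (Metric.ball_subset_closedBall ht)
          rw [← (e t hts w hwr hw0).2]
          refine HasSum.tsum_eq (hasSum_of_eq
            (Complex.hasSum_taylorSeries_on_ball (hd t hts) hwr) fun n => ?_)
          rw [hcoeff t hts]
          simp only [smul_eq_mul, sub_zero]
          ring
        rw [e1.deriv_eq, deriv_const_mul_field] at key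
        rw [ext_dtau f (e τ hτ w hwr hw0).1]
        convert hasSum_of_eq (key.mul_left ((Real.pi : ℂ) / (2 * Complex.I))) fun n => ?_ using 1
        · ring
        · rw [deriv_mul_const_field]
          ring
      · refine DifferentiableOn.mul_const ?_ _
        exact (UpperHalfPlane.mdifferentiable_iff.1 (hA n).1).mono fun t ht =>
          him t (hεs (Metric.ball_subset_closedBall ht))
      · rw [norm_mul, norm_pow]
        gcongr
        exact hbound n t ht

open Complex (I)

/-! ### The Eisenstein series `E₁` -/

/-- `e(w) = exp(2πiw)`. -/
def nome (w : ℂ) : ℂ := Complex.exp (2 * Real.pi * I * w)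

/-- The sum `e(w) / (1 - e(w))` of the geometric series `e(w) + e(2w) + ⋯`. -/
def geomNome (w : ℂ) : ℂ := nome w / (1 - nome w)

lemma nome_add_intCast (w : ℂ) (k : ℤ) : nome (w + k) = nome w := by
  unfold nome
  rw [mul_add, Complex.exp_add, mul_comm (2 * (Real.pi : ℂ) * I) (k : ℂ),
    Complex.exp_int_mul_two_pi_mul_I, mul_one]

lemma nome_neg (w : ℂ) : nome (-w) = (nome w)⁻¹ := by
  unfold nome
  rw [mul_neg, Complex.exp_neg]

lemma nome_ne_zero (w : ℂ) : nome w ≠ 0 := Complex.exp_ne_zero _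

lemma norm_nome (w : ℂ) : ‖nome w‖ = Real.exp (-(2 * Real.pi * w.im)) := by
  rw [nome, Complex.norm_exp]
  congr 1
  simp

lemma nome_eq_one_iff {w : ℂ} : nome w = 1 ↔ ∃ k : ℤ, w = k := by
  rw [nome, Complex.exp_eq_one_iff]
  refine exists_congr fun k => ?_
  rw [mul_comm]
  exact mul_left_inj' Complex.two_pi_I_ne_zero

lemma differentiable_nome : Differentiable ℂ nome := by
  unfold nome
  fun_prop

lemma hasDerivAt_nome (w : ℂ) : HasDerivAt nome (2 * Real.pi * I * nome w) w := by
  have := ((hasDerivAt_id w).const_mul (2 * (Real.pi : ℂ) * I)).cexp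
  rw [mul_one, mul_comm (Complex.exp _)] at this
  exact this

lemma geomNome_add_intCast (w : ℂ) (k : ℤ) : geomNome (w + k) = geomNome w := by
  rw [geomNome, nome_add_intCast, geomNome]

lemma geomNome_neg {w : ℂ} (h : nome w ≠ 1) : geomNome (-w) = -1 - geomNome w := by
  have h1 := nome_ne_zero w
  have h2 : 1 - nome w ≠ 0 := sub_ne_zero.2 h.symm
  have h3 : nome w - 1 ≠ 0 := sub_ne_zero.2 h
  have h4 : 1 - (nome w)⁻¹ ≠ 0 := by
    rw [sub_ne_zero, ne_eq, eq_comm, inv_eq_one]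
    exact h
  rw [geomNome, geomNome, nome_neg]
  field_simp
  ring

lemma differentiableAt_geomNome {w : ℂ} (h : nome w ≠ 1) : DifferentiableAt ℂ geomNome w :=
  (differentiable_nome w).div ((differentiableAt_const _).sub (differentiable_nome w))
    (sub_ne_zero.2 h.symm)

lemma pi_mul_cot_pi {w : ℂ} (h : nome w ≠ 1) :
    Real.pi * Complex.cot (Real.pi * w) = -(Real.pi * I) - 2 * Real.pi * I * geomNome w := by
  rw [Complex.cot_pi_eq_exp_ratio, geomNome]
  change Real.pi * ((nome w + 1) / (I * (1 - nome w))) = _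
  have h2 : 1 - nome w ≠ 0 := sub_ne_zero.2 h.symm
  have hI := Complex.I_ne_zero
  field_simp
  linear_combination (nome w + 1) * Complex.I_sq

/-- The height `a` keeps the denominator away from zero, and the remaining height `nε` gives
geometric decay in `n`. -/
lemma norm_geomNome_le {a ε : ℝ} (ha : 0 < a) {w : ℂ} {n : ℕ} (hε : 0 < ε)
    (h : a + n * ε ≤ w.im) :
    ‖geomNome w‖ ≤ Real.exp (-(2 * Real.pi * a)) / (1 - Real.exp (-(2 * Real.pi * a))) *
      Real.exp (-(2 * Real.pi * ε)) ^ n := by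
  have hpi := Real.pi_pos
  have h0 : Real.exp (-(2 * Real.pi * a)) < 1 := Real.exp_lt_one_iff.2 (by
    have : 0 < 2 * Real.pi * a := by positivity
    linarith)
  have h1 : ‖nome w‖ ≤ Real.exp (-(2 * Real.pi * a)) * Real.exp (-(2 * Real.pi * ε)) ^ n := by
    rw [norm_nome, ← Real.exp_nat_mul, ← Real.exp_add]
    refine Real.exp_le_exp.2 ?_
    have : 2 * Real.pi * (a + n * ε) ≤ 2 * Real.pi * w.im :=
      mul_le_mul_of_nonneg_left h (by positivity)
    linarith
  have h2 : Real.exp (-(2 * Real.pi * ε)) ^ n ≤ 1 :=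
    pow_le_one₀ (Real.exp_pos _).le (Real.exp_le_one_iff.2 (by
      have : 0 < 2 * Real.pi * ε := by positivity
      linarith))
  have h3 : ‖nome w‖ ≤ Real.exp (-(2 * Real.pi * a)) :=
    h1.trans (mul_le_of_le_one_right (Real.exp_pos _).le h2)
  have h4 : 1 - Real.exp (-(2 * Real.pi * a)) ≤ ‖1 - nome w‖ := by
    have := norm_sub_norm_le (1 : ℂ) (nome w)
    rw [norm_one] at this
    linarith
  rw [geomNome, norm_div, div_mul_eq_mul_div]
  exact div_le_div₀ (by positivity) h1 (by linarith) h4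

lemma summable_geom_bound (c : ℝ) {ε : ℝ} (hε : 0 < ε) :
    Summable fun n : ℕ => c * Real.exp (-(2 * Real.pi * ε)) ^ n := by
  refine (summable_geometric_of_lt_one (Real.exp_pos _).le (Real.exp_lt_one_iff.2 ?_)).mul_left c
  have hpi := Real.pi_pos
  have : 0 < 2 * Real.pi * ε := by positivity
  linarith

/-- `S(τ, z) = ∑_{n ≥ 1} e(nτ + z) / (1 - e(nτ + z))`. -/
def lambertSum (τ z : ℂ) : ℂ := ∑' n : ℕ, geomNome (((n : ℂ) + 1) * τ + z)

/-- Near a given point all but finitely many terms of the Lambert series are free of poles and have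
a common summable majorant; only the first `n₀` terms have to be treated one by one. -/
lemma exists_tail_bound {τ₀ z₀ : ℂ} (h : 0 < τ₀.im) :
    ∃ (V : Set (ℂ × ℂ)) (n₀ : ℕ) (u : ℕ → ℝ), V ∈ 𝓝 (τ₀, z₀) ∧ IsOpen V ∧ Summable u ∧
      ∀ n, ∀ p ∈ V, ‖geomNome ((((n + n₀ : ℕ) : ℂ) + 1) * p.1 + p.2)‖ ≤ u n ∧
        nome ((((n + n₀ : ℕ) : ℂ) + 1) * p.1 + p.2) ≠ 1 := by
  set ε := τ₀.im / 2
  set R := |z₀.im| + 1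
  have hε : 0 < ε := half_pos h
  -- With `n₀ ε > R + 1`, the point `(n + n₀ + 1) τ + z` has imaginary part at least `1 + nε`.
  obtain ⟨n₀, hn₀⟩ := exists_nat_gt ((R + 1) / ε)
  rw [div_lt_iff₀ hε] at hn₀
  have hVo : IsOpen {p : ℂ × ℂ | ε < p.1.im ∧ -R < p.2.im} :=
    IsOpen.and (isOpen_lt (by fun_prop) (by fun_prop)) (isOpen_lt (by fun_prop) (by fun_prop))
  refine ⟨{p | ε < p.1.im ∧ -R < p.2.im}, n₀, _, hVo.mem_nhds ⟨half_lt_self h, ?_⟩, hVo,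
    summable_geom_bound (Real.exp (-(2 * Real.pi * 1)) / (1 - Real.exp (-(2 * Real.pi * 1)))) hε,
    fun n p hp => ?_⟩
  · have := neg_abs_le z₀.im
    simp only [R]
    linarith
  · have him : 1 + n * ε ≤ ((((n + n₀ : ℕ) : ℂ) + 1) * p.1 + p.2).im := by
      have e : ((((n + n₀ : ℕ) : ℂ) + 1) * p.1 + p.2).im = ((n + n₀ : ℕ) + 1) * p.1.im + p.2.im := by
        have : (((n + n₀ : ℕ) : ℂ) + 1) = (((n + n₀ : ℕ) + 1 : ℝ) : ℂ) := by push_cast; ring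
        rw [this, Complex.add_im, Complex.im_ofReal_mul]
      rw [e]
      have h1 := hp.1
      have h2 := hp.2
      have h3 : ((n + n₀ : ℕ) + 1 : ℝ) * ε ≤ ((n + n₀ : ℕ) + 1 : ℝ) * p.1.im :=
        mul_le_mul_of_nonneg_left h1.le (by positivity)
      push_cast at h3 ⊢
      nlinarith
    refine ⟨norm_geomNome_le one_pos hε him, fun h1 => ?_⟩
    obtain ⟨k, hk⟩ := nome_eq_one_iff.1 h1
    rw [hk, Complex.intCast_im] at him
    have : 0 ≤ n * ε := by positivity
    linarith

lemma summable_geomNome {τ : ℂ} (h : 0 < τ.im) (z : ℂ) :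
    Summable fun n : ℕ => geomNome (((n : ℂ) + 1) * τ + z) := by
  obtain ⟨V, n₀, u, hV, -, hu, hb⟩ := exists_tail_bound (z₀ := z) h
  rw [← summable_nat_add_iff n₀]
  exact Summable.of_norm_bounded hu fun n => (hb n (τ, z) (mem_of_mem_nhds hV)).1

lemma differentiableAt_lambertSum {τ z : ℂ} (h : 0 < τ.im)
    (hz : ∀ n : ℕ, nome (((n : ℂ) + 1) * τ + z) ≠ 1) :
    DifferentiableAt ℂ (fun p : ℂ × ℂ => lambertSum p.1 p.2) (τ, z) := by
  obtain ⟨V, n₀, u, hV, hVo, hu, hb⟩ := exists_tail_bound (z₀ := z) h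
  have hVim : ∀ᶠ p : ℂ × ℂ in 𝓝 (τ, z), 0 < p.1.im :=
    (Continuous.tendsto (by fun_prop : Continuous fun p : ℂ × ℂ => p.1.im) _).eventually
      (lt_mem_nhds h)
  have hd : ∀ (n : ℕ) (p : ℂ × ℂ), nome (((n : ℂ) + 1) * p.1 + p.2) ≠ 1 →
      DifferentiableAt ℂ (fun p : ℂ × ℂ => geomNome (((n : ℂ) + 1) * p.1 + p.2)) p :=
    fun n p hp => DifferentiableAt.comp p (differentiableAt_geomNome hp) (by fun_prop)
  have htail : DifferentiableOn ℂ
      (fun p : ℂ × ℂ => ∑' n : ℕ, geomNome ((((n + n₀ : ℕ) : ℂ) + 1) * p.1 + p.2)) V := by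
    refine TendstoLocallyUniformlyOn.differentiableOn_prod hVo
      (tendstoUniformlyOn_tsum hu fun n p hp => (hb n p hp).1).tendstoLocallyUniformlyOn fun t => ?_
    exact DifferentiableOn.fun_sum fun n _ p hp => (hd _ p (hb n p hp).2).differentiableWithinAt
  have e : (fun p : ℂ × ℂ => lambertSum p.1 p.2) =ᶠ[𝓝 (τ, z)] fun p =>
      ∑ n ∈ Finset.range n₀, geomNome (((n : ℂ) + 1) * p.1 + p.2) +
        ∑' n : ℕ, geomNome ((((n + n₀ : ℕ) : ℂ) + 1) * p.1 + p.2) := by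
    filter_upwards [hVim] with p hp
    exact ((summable_geomNome hp p.2).sum_add_tsum_nat_add n₀).symm
  refine DifferentiableAt.congr_of_eventuallyEq ?_ e
  exact (DifferentiableAt.fun_sum fun n _ => hd n (τ, z) (hz n)).add (htail.differentiableAt hV)

/-- `E₁(τ, z) - π cot πz`. -/
def regPart (τ z : ℂ) : ℂ := 2 * Real.pi * I * (lambertSum τ (-z) - lambertSum τ z)

lemma sum_Icc_neg_eq (f : ℤ → ℂ) (N : ℕ) :
    ∑ n ∈ Finset.Icc (-(N : ℤ)) N, f n =
      f 0 + ∑ j ∈ Finset.range N, (f (j + 1) + f (-(j + 1))) := by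
  induction N with
  | zero => simp
  | succ N ih =>
    have : Finset.Icc (-((N + 1 : ℕ) : ℤ)) ((N + 1 : ℕ) : ℤ) =
        insert (((N : ℤ) + 1)) (insert (-((N : ℤ) + 1)) (Finset.Icc (-(N : ℤ)) N)) := by
      ext x
      simp only [Finset.mem_Icc, Finset.mem_insert]
      push_cast
      omega
    rw [this, Finset.sum_insert, Finset.sum_insert, ih, Finset.sum_range_succ]
    · ring
    · simp only [Finset.mem_Icc]; omega
    · simp only [Finset.mem_Icc, Finset.mem_insert]; omega

lemma hasSum_cot {w : ℂ} (h : nome w ≠ 1) :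
    HasSum (fun m : ℤ => 1 / (w + m)) (Real.pi * Complex.cot (Real.pi * w)) (symmetricIcc ℤ) := by
  have hw : w ∈ Complex.integerComplement := by
    rintro ⟨k, hk⟩
    exact h (nome_eq_one_iff.2 ⟨k, hk.symm⟩)
  rw [hasSum_symmetricIcc_iff]
  have := (tendsto_logDeriv_euler_cot_sub hw).const_add (1 / w)
  rw [add_sub_cancel] at this
  refine this.congr fun N => ?_
  rw [sum_Icc_neg_eq]
  simp only [Int.cast_zero, add_zero, cotTerm]
  congr 1
  refine Finset.sum_congr rfl fun j _ => ?_
  push_cast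
  rw [add_comm, ← sub_eq_add_neg]

lemma nome_ne_one_of_mem_dom {τ z : ℂ} (h : (τ, z) ∈ dom) (n : ℤ) : nome (z + n * τ) ≠ 1 := by
  intro h1
  obtain ⟨k, hk⟩ := nome_eq_one_iff.1 h1
  refine h.2 k (-n) ?_
  push_cast
  linear_combination hk

/-- Euler's expansion evaluates the inner sum as `π cot π(z + nτ)`. In the symmetric outer sum the
terms `n` and `-n` are paired: their constants `-πi` cancel against the `-1` in `geomNome (-w) = -1
- geomNome w`, and what is left converges geometrically. -/
lemma ext_E1 {τ z : ℂ} (h : (τ, z) ∈ dom) :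
    ext E1 τ z = -(Real.pi * I) - 2 * Real.pi * I * geomNome z + regPart τ z := by
  have h0 := nome_ne_one_of_mem_dom h
  have hz : nome z ≠ 1 := by simpa using h0 0
  rw [ext_of_mem _ h, ← pi_mul_cot_pi hz]
  have e1 : ∀ n : ℤ, ∑'[symmetricIcc ℤ] m : ℤ, 1 / (z + (m : ℂ) + n * τ) =
      Real.pi * Complex.cot (Real.pi * (z + n * τ)) := by
    intro n
    rw [← (hasSum_cot (h0 n)).tsum_eq]
    exact tsum_congr fun m => by rw [add_right_comm]
  simp only [E1, e1]
  refine HasSum.tsum_eq ?_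
  rw [hasSum_symmetricIcc_iff]
  have s1 := (summable_geomNome h.1 (-z)).hasSum.tendsto_sum_nat
  have s2 := (summable_geomNome h.1 z).hasSum.tendsto_sum_nat
  have s3 := ((s1.sub s2).const_mul (2 * Real.pi * I)).const_add
    (Real.pi * Complex.cot (Real.pi * z))
  refine s3.congr fun N => ?_
  rw [sum_Icc_neg_eq, ← Finset.sum_sub_distrib, Finset.mul_sum]
  simp only [Int.cast_zero, zero_mul, add_zero]
  congr 1
  refine Finset.sum_congr rfl fun j _ => ?_
  have c1 := pi_mul_cot_pi (h0 (j + 1))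
  have c2 := pi_mul_cot_pi (h0 (-(j + 1)))
  rw [c1, c2]
  have hn := h0 (-(j + 1))
  have e2 := geomNome_neg hn
  have a1 : -(z + ((-((j : ℤ) + 1) : ℤ) : ℂ) * τ) = ((j : ℂ) + 1) * τ + -z := by push_cast; ring
  have a2 : z + (((j : ℤ) + 1 : ℤ) : ℂ) * τ = ((j : ℂ) + 1) * τ + z := by push_cast; ring
  rw [a1] at e2
  rw [a2, e2]
  ring

/-! ### `E₁` is singular -/

/-- The terms with `n = 0` are absent from `regPart`, so it stays holomorphic at the integers and in
particular at `z = 0`. -/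
lemma differentiableOn_regPart :
    DifferentiableOn ℂ (fun p : ℂ × ℂ => regPart p.1 p.2) (latticeCompl {x | x.2 ≠ 0}) := by
  rintro ⟨τ, z⟩ ⟨hτ, hz⟩
  simp only at hτ hz
  refine DifferentiableAt.differentiableWithinAt ?_
  have h1 : DifferentiableAt ℂ (fun p : ℂ × ℂ => lambertSum p.1 p.2) (τ, z) := by
    refine differentiableAt_lambertSum hτ fun n h => ?_
    obtain ⟨k, hk⟩ := nome_eq_one_iff.1 h
    refine hz (k, -((n : ℤ) + 1)) ?_ ?_
    · simp only [ne_eq, Set.mem_ofPred_eq]; omega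
    · push_cast; linear_combination hk
  have h2 : DifferentiableAt ℂ (fun p : ℂ × ℂ => lambertSum p.1 p.2) (τ, -z) := by
    refine differentiableAt_lambertSum hτ fun n h => ?_
    obtain ⟨k, hk⟩ := nome_eq_one_iff.1 h
    refine hz (-k, (n : ℤ) + 1) ?_ ?_
    · simp only [ne_eq, Set.mem_ofPred_eq]; omega
    · push_cast; linear_combination -hk
  have h3 : DifferentiableAt ℂ (fun p : ℂ × ℂ => lambertSum p.1 (-p.2)) (τ, z) :=
    DifferentiableAt.comp (f := fun p : ℂ × ℂ => (p.1, -p.2)) (τ, z) h2 (by fun_prop)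
  exact (h3.sub h1).const_mul _

/-- `w (E₁ - (E₁ - π cot πw))`, with its value at `w = 0`. -/
def polePart (w : ℂ) : ℂ :=
  -- The divided slope `dslope nome 0 w` is `(nome w - 1) / w` with value `2πi` at the origin, so
  -- this expression makes sense at `w = 0`.
  -(Real.pi * I * w) + 2 * Real.pi * I * (nome w / dslope nome 0 w)

lemma nome_zero : nome 0 = 1 := by simp [nome]

lemma dslope_nome_zero : dslope nome 0 0 = 2 * Real.pi * I := by
  rw [dslope_same, (hasDerivAt_nome 0).deriv, nome_zero, mul_one]

lemma two_pi_I_ne_zero' : (2 * Real.pi * I : ℂ) ≠ 0 := Complex.two_pi_I_ne_zero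

lemma analyticAt_polePart : AnalyticAt ℂ polePart 0 := by
  have h1 : AnalyticAt ℂ nome 0 := differentiable_nome.analyticAt 0
  have h2 : AnalyticAt ℂ (dslope nome 0) 0 := by
    have := (Complex.differentiableOn_dslope (f := nome) (c := 0) univ_mem).2
      differentiable_nome.differentiableOn
    exact this.analyticAt univ_mem
  have h3 : dslope nome 0 0 ≠ 0 := dslope_nome_zero ▸ two_pi_I_ne_zero'
  exact (analyticAt_const.mul analyticAt_id).neg.add (analyticAt_const.mul (h1.div h2 h3))

lemma mul_eq_polePart {w : ℂ} (hw : w ≠ 0) :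
    w * (-(Real.pi * I) - 2 * Real.pi * I * geomNome w) = polePart w := by
  rw [polePart, dslope_of_ne _ hw, slope_def_field, nome_zero, sub_zero, geomNome,
    ← neg_sub (nome w) 1, div_neg, div_div_eq_mul_div]
  ring

lemma mul_ext_E1 {τ w : ℂ} (h : (τ, w) ∈ dom) :
    w * ext E1 τ w = polePart w + w * regPart τ w := by
  have hw : w ≠ 0 := by simpa using h.2 0 0
  rw [ext_E1 h, ← mul_eq_polePart hw]
  ring

lemma mem_dom_lattice (τ z : ℂ) (m n : ℤ) : (τ, z + (m + n * τ)) ∈ dom ↔ (τ, z) ∈ dom := by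
  refine and_congr_right fun _ => ⟨fun h a b e => h (a + m) (b + n) ?_,
    fun h a b e => h (a - m) (b - n) ?_⟩
  · push_cast; linear_combination e
  · push_cast; linear_combination e

/-- Adding `τ` to `z` shifts the index of both Lambert series by one, in opposite directions; the
two boundary terms and the cotangent part combine to `-2πi`. -/
lemma ext_E1_add_tau {τ z : ℂ} (h : (τ, z) ∈ dom) :
    ext E1 τ (z + τ) = ext E1 τ z - 2 * Real.pi * I := by
  have h' : (τ, z + τ) ∈ dom := by simpa using (mem_dom_lattice τ z 0 1).2 h
  have hz : nome z ≠ 1 := by simpa using nome_ne_one_of_mem_dom h 0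
  have e1 : lambertSum τ z = geomNome (z + τ) + lambertSum τ (z + τ) := by
    unfold lambertSum
    rw [(summable_geomNome h.1 z).tsum_eq_zero_add]
    congr 1
    · congr 1; push_cast; ring
    · refine tsum_congr fun n => ?_
      congr 1; push_cast; ring
  have e2 : lambertSum τ (-(z + τ)) = geomNome (-z) + lambertSum τ (-z) := by
    unfold lambertSum
    rw [(summable_geomNome h.1 (-(z + τ))).tsum_eq_zero_add]
    congr 1
    · congr 1; push_cast; ring
    · refine tsum_congr fun n => ?_
      congr 1; push_cast; ring
  rw [ext_E1 h', ext_E1 h, regPart, regPart, e2, e1, geomNome_neg hz]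
  ring

lemma lambertSum_add_intCast (τ z : ℂ) (k : ℤ) : lambertSum τ (z + k) = lambertSum τ z :=
  tsum_congr fun n => by rw [← add_assoc, geomNome_add_intCast]

lemma ext_E1_add_one (τ z : ℂ) : ext E1 τ (z + 1) = ext E1 τ z := by
  by_cases h : (τ, z) ∈ dom
  · have e1 := geomNome_add_intCast z 1
    have e2 := lambertSum_add_intCast τ z 1
    have e3 := lambertSum_add_intCast τ (-z) (-1)
    rw [Int.cast_one] at e1 e2
    rw [Int.cast_neg, Int.cast_one, ← neg_add] at e3
    rw [ext_E1 h, ext_E1 ((mem_dom_z τ z).2 h), regPart, regPart, e1, e2, e3]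
  · rw [ext_of_notMem _ h, ext_of_notMem _ (mt (mem_dom_z τ z).1 h)]

lemma ext_E1_tau_add_one (τ z : ℂ) : ext E1 (τ + 1) z = ext E1 τ z := by
  by_cases h : (τ, z) ∈ dom
  · have e : ∀ z, lambertSum (τ + 1) z = lambertSum τ z := fun z => tsum_congr fun n => by
      rw [← geomNome_add_intCast (((n : ℂ) + 1) * τ + z) (n + 1)]
      congr 1; push_cast; ring
    rw [ext_E1 h, ext_E1 ((mem_dom_tau τ z).2 h), regPart, regPart, e, e]
  · rw [ext_of_notMem _ h, ext_of_notMem _ (mt (mem_dom_tau τ z).1 h)]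

lemma ext_E1_add_lattice {τ z : ℂ} (h : (τ, z) ∈ dom) (m n : ℤ) :
    ext E1 τ (z + (m + n * τ)) = ext E1 τ z - 2 * Real.pi * I * n := by
  have h1 : ∀ (z : ℂ) (m : ℤ), ext E1 τ (z + m) = ext E1 τ z := by
    intro z m
    induction m using Int.induction_on with
    | zero => simp
    | succ k ih => rw [← ih, ← ext_E1_add_one τ (z + (k : ℤ))]; congr 1; push_cast; ring
    | pred k ih => rw [← ih, ← ext_E1_add_one τ (z + (-(k : ℤ) - 1 : ℤ))]; congr 1; push_cast; ring
  rw [show z + (m + n * τ) = z + n * τ + m by ring, h1]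
  induction n using Int.induction_on with
  | zero => simp
  | succ k ih =>
    have hk : (τ, z + ((k : ℤ) : ℂ) * τ) ∈ dom := by
      simpa using (mem_dom_lattice τ z 0 k).2 h
    have := ext_E1_add_tau hk
    rw [show z + (((k : ℤ) + 1 : ℤ) : ℂ) * τ = z + ((k : ℤ) : ℂ) * τ + τ by push_cast; ring, this,
      ih]
    push_cast; ring
  | pred k ih =>
    have hk : (τ, z + ((-(k : ℤ) - 1 : ℤ) : ℂ) * τ) ∈ dom := by
      simpa using (mem_dom_lattice τ z 0 (-(k : ℤ) - 1)).2 h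
    have := ext_E1_add_tau hk
    rw [show z + ((-(k : ℤ) - 1 : ℤ) : ℂ) * τ + τ = z + ((-(k : ℤ) : ℤ) : ℂ) * τ by push_cast; ring,
      ih] at this
    rw [eq_sub_iff_add_eq] at this
    rw [← this]
    push_cast; ring

lemma mem_latticeCompl_of_norm_lt {τ w : ℂ} {a : ℝ} (ha : a ≤ τ.im) (ha0 : 0 < a) (hw : ‖w‖ < a) :
    (τ, w) ∈ latticeCompl {x | x.2 ≠ 0} := by
  refine ⟨ha0.trans_le ha, fun x hx e => ?_⟩
  have him : w.im = x.2 * τ.im := by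
    simp only at e
    rw [e]; simp
  have h1 : (1 : ℝ) ≤ |(x.2 : ℝ)| := by exact_mod_cast Int.one_le_abs hx
  have h2 := (Complex.abs_im_le_norm w).trans_lt hw
  rw [him, abs_mul, abs_of_pos (ha0.trans_le ha)] at h2
  nlinarith

lemma differentiableOn_regPart_ball (τ : ℍ) :
    DifferentiableOn ℂ (regPart τ) (Metric.ball 0 τ.im) := fun w hw =>
  (differentiableOn_regPart.differentiableAt_snd (isOpen_latticeCompl _)
    (p := ((τ : ℂ), w)) (mem_latticeCompl_of_norm_lt (a := τ.im) le_rfl τ.im_pos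
      (by simpa using hw))).differentiableWithinAt

/-- In this range `(n + 1) τ ± w` has imaginary part at least `n + 1/2`, so one geometric series
bounds everything. With Cauchy's estimates this gives the boundedness at `i∞` of the Laurent
coefficients. -/
lemma exists_bound_regPart :
    ∃ M : ℝ, ∀ τ w : ℂ, 1 ≤ τ.im → ‖w‖ ≤ 1 / 2 → ‖regPart τ w‖ ≤ M := by
  set c := Real.exp (-(2 * Real.pi * (1 / 2))) / (1 - Real.exp (-(2 * Real.pi * (1 / 2))))
  obtain ⟨K, hK⟩ := summable_geom_bound c one_pos
  have hb : ∀ τ w : ℂ, 1 ≤ τ.im → ‖w‖ ≤ 1 / 2 → ‖lambertSum τ w‖ ≤ K := by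
    intro τ w hτ hw
    refine tsum_of_norm_bounded hK fun n => norm_geomNome_le (by norm_num) one_pos ?_
    have e : (((n : ℂ) + 1) * τ + w).im = ((n : ℝ) + 1) * τ.im + w.im := by
      rw [Complex.add_im, show ((n : ℂ) + 1) = ((n + 1 : ℝ) : ℂ) by push_cast; ring,
        Complex.im_ofReal_mul]
    have h1 := (abs_le.1 ((Complex.abs_im_le_norm w).trans hw)).1
    have h2 : ((n : ℝ) + 1) * 1 ≤ ((n : ℝ) + 1) * τ.im :=
      mul_le_mul_of_nonneg_left hτ (by positivity)
    rw [e]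
    linarith
  refine ⟨‖(2 * Real.pi * I : ℂ)‖ * (K + K), fun τ w hτ hw => ?_⟩
  rw [regPart, norm_mul]
  gcongr
  exact (norm_sub_le _ _).trans (add_le_add (hb τ _ hτ (by rwa [norm_neg])) (hb τ w hτ hw))

lemma differentiableOn_iteratedDeriv_snd {G : ℂ × ℂ → ℂ} {U : Set (ℂ × ℂ)} (hU : IsOpen U)
    (hG : DifferentiableOn ℂ G U) (n : ℕ) :
    DifferentiableOn ℂ (fun p : ℂ × ℂ => iteratedDeriv n (fun z => G (p.1, z)) p.2) U := by
  induction n with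
  | zero => simpa using hG
  | succ n ih =>
    simp only [iteratedDeriv_succ]
    exact differentiableOn_deriv_snd hU ih

/-- The Taylor coefficients of `E₁ - π cot πz` at `z = 0`. -/
def regCoeff (n : ℕ) (τ : ℍ) : ℂ := (n.factorial : ℂ)⁻¹ * iteratedDeriv n (regPart τ) 0

lemma mdiff_regCoeff (n : ℕ) : MDiff (regCoeff n) := by
  refine mdifferentiable_const.mul (?_ : MDiff fun τ : ℍ => iteratedDeriv n (regPart τ) 0)
  rw [UpperHalfPlane.mdifferentiable_iff]
  have : DifferentiableOn ℂ (fun t : ℂ => iteratedDeriv n (regPart t) 0) {z | 0 < z.im} :=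
    fun t ht => ((differentiableOn_iteratedDeriv_snd (isOpen_latticeCompl _)
      differentiableOn_regPart n).differentiableAt_fst (isOpen_latticeCompl _) (p := (t, 0))
        (mem_latticeCompl_of_norm_lt le_rfl ht (by simpa using ht))).differentiableWithinAt
  refine this.congr fun t ht => ?_
  rw [Function.comp_apply, UpperHalfPlane.ofComplex_apply_of_im_pos ht]

lemma isBoundedAtImInfty_regCoeff (n : ℕ) : UpperHalfPlane.IsBoundedAtImInfty (regCoeff n) := by
  obtain ⟨M, hM⟩ := exists_bound_regPart
  rw [UpperHalfPlane.isBoundedAtImInfty_iff]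
  refine ⟨M / (1 / 2) ^ n, 1, fun τ hτ => ?_⟩
  have hdc : DiffContOnCl ℂ (regPart τ) (Metric.ball 0 (1 / 2)) := by
    refine DifferentiableOn.diffContOnCl ?_
    rw [closure_ball _ (by norm_num)]
    exact (differentiableOn_regPart_ball τ).mono (Metric.closedBall_subset_ball (by linarith))
  have := Complex.norm_iteratedDeriv_le_of_forall_mem_sphere_norm_le n (by norm_num) hdc
    fun w hw => hM τ w hτ (by simpa using (mem_sphere_zero_iff_norm.1 hw).le)
  rw [regCoeff, norm_mul, norm_inv, Complex.norm_natCast,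
    inv_mul_le_iff₀ (by exact_mod_cast n.factorial_pos)]
  exact this.trans (le_of_eq (by ring))

/-- Quasi-periodicity moves every lattice point to the origin, where `w E₁` is `polePart` plus `w`
times `regPart`. The first summand does not depend on `τ`, and the second one is controlled up to
`i∞`. -/
lemma isSingular_E1 : IsSingular E1 where
  holo := by
    have h : DifferentiableOn ℂ (fun p : ℂ × ℂ => -(Real.pi * I) - 2 * Real.pi * I * geomNome p.2 +
        regPart p.1 p.2) dom := by
      refine DifferentiableOn.add (DifferentiableOn.const_sub (DifferentiableOn.const_mul ?_ _) _) ?_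
      · rintro ⟨τ, z⟩ hp
        have := differentiableAt_geomNome (w := z) (by simpa using nome_ne_one_of_mem_dom hp 0)
        exact (this.comp (𝕜 := ℂ) (f := fun p : ℂ × ℂ => p.2) (τ, z)
          (by fun_prop)).differentiableWithinAt
      · exact differentiableOn_regPart.mono fun p hp => ⟨hp.1, fun x _ => hp.2 x.1 x.2⟩
    exact h.congr fun p hp => ext_E1 hp
  z_add_one := ext_E1_add_one
  tau_add_one := ext_E1_tau_add_one
  poles := by
    refine ⟨1, (poles_iff _ _).2 fun τ m n => ?_⟩
    have ha : AnalyticAt ℂ (regPart τ) 0 :=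
      (differentiableOn_regPart_ball τ).analyticAt (Metric.ball_mem_nhds _ τ.im_pos)
    refine ⟨fun w => polePart w + w * regPart τ w - 2 * Real.pi * I * n * w,
      (analyticAt_polePart.add (analyticAt_id.mul ha)).sub (analyticAt_const.mul analyticAt_id), ?_⟩
    have h := lattice_isolated τ 0 0
    simp only [Int.cast_zero, zero_mul, add_zero] at h
    filter_upwards [h] with w hw
    rw [ext_E1_add_lattice hw, ← mul_ext_E1 hw]
    ring
  laurent := by
    -- Multiplication by `z ^ 1` shifts the coefficients of `regPart` by one, hence the index `n -
    -- 1` and the separate value at `n = 0`.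
    refine ⟨1, fun n => (fun _ => (n.factorial : ℂ)⁻¹ * iteratedDeriv n polePart 0) +
      if n = 0 then fun _ => 0 else regCoeff (n - 1), fun n => ⟨?_, ?_⟩, fun τ => ?_⟩
    · refine mdifferentiable_const.add ?_
      split_ifs
      exacts [mdifferentiable_const, mdiff_regCoeff _]
    · refine (const_boundedAtFilter _ _).add ?_
      split_ifs
      exacts [const_boundedAtFilter _ _, isBoundedAtImInfty_regCoeff _]
    · have h := lattice_isolated τ 0 0
      simp only [Int.cast_zero, zero_mul, add_zero] at h
      obtain ⟨r, hr, hp⟩ := analyticAt_polePart.exists_ball_analyticOnNhd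
      filter_upwards [h, mem_nhdsWithin_of_mem_nhds (Metric.ball_mem_nhds _ hr),
        mem_nhdsWithin_of_mem_nhds (Metric.ball_mem_nhds _ τ.im_pos)] with z hz hzr hzτ
      have s1 := Complex.hasSum_taylorSeries_on_ball hp.differentiableOn hzr
      have s2 := (Complex.hasSum_taylorSeries_on_ball (differentiableOn_regPart_ball τ) hzτ).mul_left
        z
      have s3 : HasSum (fun n => (if n = 0 then (fun _ => 0 : ℍ → ℂ) else regCoeff (n - 1)) τ * z ^ n)
          (z * regPart τ z) := by
        rw [← hasSum_nat_add_iff' 1]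
        simp only [Finset.range_one, Finset.sum_singleton, ↓reduceIte, zero_mul, sub_zero]
        refine hasSum_of_eq s2 fun n => ?_
        simp only [Nat.add_eq_zero_iff, one_ne_zero, and_false, ↓reduceIte, Nat.add_sub_cancel,
          regCoeff, smul_eq_mul, sub_zero]
        ring
      rw [pow_one, mul_ext_E1 hz]
      refine hasSum_of_eq (s1.add s3) fun n => ?_
      simp only [Pi.add_apply, smul_eq_mul, sub_zero]
      ring

/-! ### The transformation law of `E₁` -/

/-- An entire function with periods `1` and `τ` is constant. -/
lemma eq_of_differentiable_of_periodic {τ : ℂ} (hτ : 0 < τ.im) {D : ℂ → ℂ}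
    (hD : Differentiable ℂ D) (h1 : Function.Periodic D 1) (h2 : Function.Periodic D τ) (z w : ℂ) :
    D z = D w := by
  refine hD.apply_eq_apply_of_bounded ?_ z w
  have hK : IsCompact ((fun q : ℝ × ℝ => D (q.1 + q.2 * τ)) '' (Set.Icc 0 1 ×ˢ Set.Icc 0 1)) :=
    (isCompact_Icc.prod isCompact_Icc).image (hD.continuous.comp (by fun_prop))
  refine hK.isBounded.subset ?_
  rintro _ ⟨z, rfl⟩
  set y := z.im / τ.im
  set x := z.re - y * τ.re
  have e : z = x + y * τ := by
    apply Complex.ext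
    · simp [x]
    · simp [y, hτ.ne']
  refine ⟨(Int.fract x, Int.fract y), ⟨⟨Int.fract_nonneg _, (Int.fract_lt_one _).le⟩,
    ⟨Int.fract_nonneg _, (Int.fract_lt_one _).le⟩⟩, ?_⟩
  have p1 := (h1.int_mul ⌊x⌋)
  have p2 := (h2.int_mul ⌊y⌋)
  have := ((p1.add_period p2) ((Int.fract x : ℝ) + (Int.fract y : ℝ) * τ)).symm
  simp only
  rw [this]
  congr 1
  rw [e, Int.fract, Int.fract]
  push_cast
  ring

lemma ext_E1_neg {τ z : ℂ} (h : (τ, z) ∈ dom) : ext E1 τ (-z) = -ext E1 τ z := by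
  have h' : (τ, -z) ∈ dom := ⟨h.1, fun m n e => h.2 (-m) (-n) (by
    simp only at e ⊢
    push_cast
    linear_combination -e)⟩
  have hz : nome z ≠ 1 := by simpa using nome_ne_one_of_mem_dom h 0
  rw [ext_E1 h', ext_E1 h, geomNome_neg hz, regPart, regPart, neg_neg]
  ring

lemma det_eq_one (g : SL(2, ℤ)) : (g 0 0 : ℂ) * g 1 1 - g 0 1 * g 1 0 = 1 := by
  have := g.det_coe
  rw [Matrix.det_fin_two] at this
  exact_mod_cast this

lemma denom_ne_zero (g : SL(2, ℤ)) {τ : ℂ} (h : 0 < τ.im) : (g 1 0 : ℂ) * τ + g 1 1 ≠ 0 := by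
  lift τ to ℍ using h
  simpa [UpperHalfPlane.denom] using UpperHalfPlane.denom_ne_zero g τ

/-- The difference of the two sides is elliptic in `z`, because the quasi-periods match, and the
poles at the lattice points cancel. Hence it is constant by Liouville, and zero because it is odd.
-/
theorem ext_E1_moebius (g : SL(2, ℤ)) {τ z : ℂ} (h : (τ, z) ∈ dom) :
    ext E1 (((g 0 0 : ℂ) * τ + g 0 1) / ((g 1 0 : ℂ) * τ + g 1 1))
      (z / ((g 1 0 : ℂ) * τ + g 1 1)) =
      ((g 1 0 : ℂ) * τ + g 1 1) * ext E1 τ z + 2 * Real.pi * I * g 1 0 * z := by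
  classical
  have hτ := h.1
  simp only at hτ
  have hj := denom_ne_zero g hτ
  have hdet := det_eq_one g
  set a : ℂ := ((g 0 0 : ℤ) : ℂ)
  set b : ℂ := ((g 0 1 : ℤ) : ℂ)
  set c : ℂ := ((g 1 0 : ℤ) : ℂ)
  set d : ℂ := ((g 1 1 : ℤ) : ℂ)
  set j := c * τ + d with hjdef
  set τ' := (a * τ + b) / j with hτ'def
  have hdom : ∀ {z}, (τ, z) ∈ dom → (τ', z / j) ∈ dom := fun {z} hz => by
    simpa using act_mem_dom g 0 0 ⟨(τ, z), hz⟩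
  have hτ' : 0 < τ'.im := (hdom h).1
  -- This is `z` times the difference of the two sides, written so that it is analytic at `0`. It
  -- vanishes there because both simple poles contribute `j` times the value of `polePart` at `0`.
  let κ : ℂ → ℂ := fun z => j * (polePart (z / j) + z / j * regPart τ' (z / j)) -
    j * (polePart z + z * regPart τ z) - 2 * Real.pi * I * c * z ^ 2
  have hκ : AnalyticAt ℂ κ 0 := by
    have a1 : ∀ t : ℂ, 0 < t.im → AnalyticAt ℂ (fun w => polePart w + w * regPart t w) 0 := by
      intro t ht
      exact analyticAt_polePart.add (analyticAt_id.mul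
        ((differentiableOn_regPart_ball ⟨t, ht⟩).analyticAt (Metric.ball_mem_nhds _ ht)))
    have a2 : AnalyticAt ℂ (fun z => polePart (z / j) + z / j * regPart τ' (z / j)) 0 :=
      AnalyticAt.comp (g := fun w => polePart w + w * regPart τ' w) (f := fun z => z / j) (x := 0)
        (by simpa using a1 τ' hτ') (analyticAt_id.div analyticAt_const hj)
    exact ((analyticAt_const.mul a2).sub (analyticAt_const.mul (a1 τ hτ))).sub
      (analyticAt_const.mul (analyticAt_id.pow 2))
  have hκ0 : κ 0 = 0 := by simp [κ]
  -- At all lattice points `D` takes the value that removes the singularity at `0`; periodicity then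
  -- makes it the right value at every one of them.
  let D : ℂ → ℂ := fun z => if (τ, z) ∈ dom then
    ext E1 τ' (z / j) - j * ext E1 τ z - 2 * Real.pi * I * c * z else dslope κ 0 0
  have hDdom : ∀ {z}, (τ, z) ∈ dom →
      D z = ext E1 τ' (z / j) - j * ext E1 τ z - 2 * Real.pi * I * c * z := fun hz => if_pos hz
  have hper : ∀ (m n : ℤ) (z : ℂ), D (z + (m + n * τ)) = D z := by
    intro m n z
    by_cases hz : (τ, z) ∈ dom
    · rw [hDdom hz, hDdom ((mem_dom_lattice τ z m n).2 hz), ext_E1_add_lattice hz]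
      -- Since the determinant is one, `1 = j (a - c τ')` and `τ = j (d τ' - b)`.
      have e : (z + (m + n * τ)) / j =
          z / j + (((m * g 0 0 - n * g 0 1 : ℤ) : ℂ) + ((n * g 1 1 - m * g 1 0 : ℤ) : ℂ) * τ') := by
        push_cast
        change _ = z / j + ((m * a - n * b) + (n * d - m * c) * τ')
        rw [hτ'def]
        field_simp
        rw [hjdef]
        linear_combination (-(m : ℂ) - n * τ) * hdet
      rw [e, ext_E1_add_lattice (hdom hz)]
      push_cast
      change _ - 2 * Real.pi * I * (n * d - m * c) - _ - _ = _
      rw [hjdef]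
      ring
    · have hz' := mt (mem_dom_lattice τ z m n).1 hz
      simp only [D, if_neg hz, if_neg hz']
  have hD0 : DifferentiableAt ℂ D 0 := by
    obtain ⟨r, hr, hp⟩ := hκ.exists_ball_analyticOnNhd
    have hd := ((Complex.differentiableOn_dslope (Metric.ball_mem_nhds (0 : ℂ) hr)).2
      hp.differentiableOn).differentiableAt (Metric.ball_mem_nhds (0 : ℂ) hr)
    refine hd.congr_of_eventuallyEq ?_
    have hl := lattice_isolated ⟨τ, hτ⟩ 0 0
    simp only [Int.cast_zero, zero_mul, add_zero] at hl
    rw [eventually_nhdsWithin_iff] at hl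
    filter_upwards [hl] with z hz
    by_cases hz0 : z = 0
    · subst hz0
      exact if_neg fun hmem => hmem.2 0 0 (by simp)
    · have hzd : (τ, z) ∈ dom := hz hz0
      rw [hDdom hzd, dslope_of_ne _ hz0, slope_def_field, hκ0, sub_zero, sub_zero,
        eq_div_iff hz0]
      simp only [κ]
      rw [← mul_ext_E1 (hdom hzd), ← mul_ext_E1 hzd]
      field_simp
  have hD : Differentiable ℂ D := by
    intro z
    by_cases hz : (τ, z) ∈ dom
    · have h1 : DifferentiableAt ℂ (fun z => ext E1 τ' (z / j)) z :=
        DifferentiableAt.comp (g := ext E1 τ') z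
          (hasDerivAt_ext_z isSingular_E1.holo (hdom hz)).differentiableAt (by fun_prop)
      have h2 := (hasDerivAt_ext_z isSingular_E1.holo hz).differentiableAt
      have h3 : DifferentiableAt ℂ (fun z => ext E1 τ' (z / j) - j * ext E1 τ z -
          2 * Real.pi * I * c * z) z :=
        (h1.sub (h2.const_mul j)).sub (by fun_prop)
      refine h3.congr_of_eventuallyEq ?_
      filter_upwards [eventually_mem_dom_z hz] with w hw
      exact hDdom hw
    · have : ∃ m n : ℤ, z = m + n * τ := by
        by_contra! hc
        exact hz ⟨hτ, hc⟩
      obtain ⟨m, n, rfl⟩ := this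
      have e : D = D ∘ fun w => w - (m + n * τ) := by
        ext w
        rw [Function.comp_apply, ← hper m n (w - _), sub_add_cancel]
      rw [e]
      exact DifferentiableAt.comp _ (by simpa using hD0) (by fun_prop)
  have hz' : (τ, -z) ∈ dom := ⟨hτ, fun m n e => h.2 (-m) (-n) (by
    simp only at e ⊢
    push_cast
    linear_combination -e)⟩
  have hconst := eq_of_differentiable_of_periodic hτ hD (fun w => by simpa using hper 1 0 w)
    (fun w => by simpa using hper 0 1 w) (-z) z
  -- Constancy gives `D(-z) = D(z)` and oddness gives `D(-z) = -D(z)`.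
  rw [hDdom h, hDdom hz', neg_div, ext_E1_neg h, ext_E1_neg (hdom h)] at hconst
  linear_combination -(1 / 2 : ℂ) * hconst

/-- `E₁` is quasi-Jacobi of weight one. -/
lemma slash_E1 (g : SL(2, ℤ)) (l m : ℤ) :
    slash 1 g l m E1 = E1 + (2 * Real.pi * I : ℂ) • Y g l m := by
  ext ⟨⟨τ, z⟩, h⟩
  have hj := denom_ne_zero g h.1
  have h' : (τ, z + (m + l * τ)) ∈ dom := (mem_dom_lattice τ z m l).2 h
  simp only [slash, Pi.add_apply, Pi.smul_apply, Y, smul_eq_mul] at hj ⊢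
  rw [show z + l * τ + m = z + (m + l * τ) by ring, ext_E1_moebius g h', ext_E1_add_lattice h,
    ext_of_mem E1 h]
  simp only [Nat.cast_one, zpow_neg, zpow_one]
  field_simp
  ring

/-! ### The derivations on holomorphic functions -/

/-- Holomorphic functions on the domain. -/
def IsHolo (f : Fn) : Prop := DifferentiableOn ℂ (fun p : ℂ × ℂ => ext f p.1 p.2) dom

lemma IsHolo.add {f g : Fn} (hf : IsHolo f) (hg : IsHolo g) : IsHolo (f + g) :=
  (DifferentiableOn.add hf hg).congr fun p _ => ext_add f g p.1 p.2

lemma IsHolo.mul {f g : Fn} (hf : IsHolo f) (hg : IsHolo g) : IsHolo (f * g) :=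
  (DifferentiableOn.mul hf hg).congr fun p _ => ext_mul f g p.1 p.2

lemma isHolo_const (c : ℂ) : IsHolo fun _ => c := (isSingular_const c).holo

lemma IsHolo.pow {f : Fn} (hf : IsHolo f) (n : ℕ) : IsHolo (f ^ n) := by
  induction n with
  | zero => rw [pow_zero]; exact isHolo_const 1
  | succ n ih => exact pow_succ f n ▸ ih.mul hf

lemma IsHolo.sum {ι : Type*} (s : Finset ι) {f : ι → Fn} (h : ∀ i ∈ s, IsHolo (f i)) :
    IsHolo (∑ i ∈ s, f i) :=
  Finset.sum_induction f IsHolo (fun _ _ => IsHolo.add) (isHolo_const 0) h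

/-- `π / 2i`. -/
def tauConst : ℂ := Real.pi / (2 * I)

lemma tauConst_mul : tauConst * (2 * I / Real.pi) = 1 := by
  have h1 : (Real.pi : ℂ) ≠ 0 := by exact_mod_cast Real.pi_ne_zero
  have hI := Complex.I_ne_zero
  rw [tauConst]
  field_simp

lemma dz_apply_of_formula {f : Fn} {u : ℂ → ℂ → ℂ} (hu : ∀ p : dom, f p = u p.1.1 p.1.2)
    (p : dom) {u' : ℂ} (h : HasDerivAt (u p.1.1) u' p.1.2) : dz f p = u' := by
  refine HasDerivAt.deriv (h.congr_of_eventuallyEq ?_)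
  filter_upwards [eventually_mem_dom_z p.2] with w hw
  rw [ext_of_mem f hw, hu]

lemma dtau_apply_of_formula {f : Fn} {u : ℂ → ℂ → ℂ} (hu : ∀ p : dom, f p = u p.1.1 p.1.2)
    (p : dom) {u' : ℂ} (h : HasDerivAt (fun t => u t p.1.2) u' p.1.1) :
    dtau f p = tauConst * u' := by
  refine congrArg (tauConst * ·) (HasDerivAt.deriv (h.congr_of_eventuallyEq ?_))
  filter_upwards [eventually_mem_dom_tau p.2] with w hw
  rw [ext_of_mem f hw, hu]

lemma isHolo_of_formula {f : Fn} {u : ℂ → ℂ → ℂ} (hu : ∀ p : dom, f p = u p.1.1 p.1.2)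
    (h : DifferentiableOn ℂ (fun p : ℂ × ℂ => u p.1 p.2) dom) : IsHolo f :=
  h.congr fun p hp => by
    rw [ext_of_mem f hp]
    exact hu ⟨p, hp⟩

lemma IsHolo.hasDerivAt_z {f : Fn} (hf : IsHolo f) (p : dom) :
    HasDerivAt (fun z => ext f p.1.1 z) (dz f p) p.1.2 :=
  (hf.differentiableAt_snd isOpen_dom p.2).hasDerivAt

lemma IsHolo.hasDerivAt_tau {f : Fn} (hf : IsHolo f) (p : dom) :
    HasDerivAt (fun t => ext f t p.1.2) (2 * I / Real.pi * dtau f p) p.1.1 := by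
  have := hasDerivAt_ext_tau hf p.2
  rwa [ext_of_mem _ p.2] at this

lemma ext_apply (f : Fn) (p : dom) : ext f p.1.1 p.1.2 = f p := ext_of_mem f p.2

lemma dz_add {f g : Fn} (hf : IsHolo f) (hg : IsHolo g) : dz (f + g) = dz f + dz g := by
  ext p
  refine dz_apply_of_formula (u := fun t z => ext f t z + ext g t z)
    (fun p => by simp [ext_apply]) p ?_
  exact (hf.hasDerivAt_z p).add (hg.hasDerivAt_z p)

lemma dz_mul {f g : Fn} (hf : IsHolo f) (hg : IsHolo g) : dz (f * g) = f * dz g + g * dz f := by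
  ext p
  refine dz_apply_of_formula (u := fun t z => ext f t z * ext g t z)
    (fun p => by simp [ext_apply]) p ?_
  refine ((hf.hasDerivAt_z p).mul (hg.hasDerivAt_z p)).congr_deriv ?_
  simp only [ext_apply, Pi.add_apply, Pi.mul_apply]
  ring

lemma dtau_add {f g : Fn} (hf : IsHolo f) (hg : IsHolo g) :
    dtau (f + g) = dtau f + dtau g := by
  ext p
  refine (dtau_apply_of_formula (u := fun t z => ext f t z + ext g t z)
    (fun p => by simp [ext_apply]) p
    ((hf.hasDerivAt_tau p).add (hg.hasDerivAt_tau p))).trans ?_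
  rw [Pi.add_apply]
  linear_combination (dtau f p + dtau g p) * tauConst_mul

lemma dtau_mul {f g : Fn} (hf : IsHolo f) (hg : IsHolo g) :
    dtau (f * g) = f * dtau g + g * dtau f := by
  ext p
  refine (dtau_apply_of_formula (u := fun t z => ext f t z * ext g t z)
    (fun p => by simp [ext_apply]) p
    ((hf.hasDerivAt_tau p).mul (hg.hasDerivAt_tau p))).trans ?_
  simp only [ext_apply, Pi.add_apply, Pi.mul_apply]
  linear_combination (f p * dtau g p + g p * dtau f p) * tauConst_mul

lemma d_add {f g : Fn} (hf : IsHolo f) (hg : IsHolo g) : d (f + g) = d f + d g := by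
  simp only [d, dz_add hf hg, dtau_add hf hg, mul_add, smul_add]
  abel

lemma d_mul {f g : Fn} (hf : IsHolo f) (hg : IsHolo g) : d (f * g) = f * d g + g * d f := by
  simp only [d, dz_mul hf hg, dtau_mul hf hg, mul_add, smul_add, ← mul_smul_comm]
  ring

lemma d_const (c : ℂ) : d (fun _ => c) = 0 := by
  ext p
  have h1 : dz (fun _ => c) p = 0 :=
    dz_apply_of_formula (u := fun _ _ => c) (fun _ => rfl) p (hasDerivAt_const _ _)
  have h2 : dtau (fun _ => c) p = tauConst * 0 :=
    dtau_apply_of_formula (u := fun _ _ => c) (fun _ => rfl) p (hasDerivAt_const _ _)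
  simp [d, h1, h2]

lemma d_smul (c : ℂ) {f : Fn} (hf : IsHolo f) : d (c • f) = c • d f := by
  have : ∀ g : Fn, c • g = (fun _ => c) * g := fun g => rfl
  rw [this, d_mul (isHolo_const c) hf, d_const, mul_zero, add_zero, this]

lemma d_pow {f : Fn} (hf : IsHolo f) (n : ℕ) : d (f ^ n) = n * f ^ (n - 1) * d f := by
  induction n with
  | zero => rw [pow_zero, Nat.cast_zero, zero_mul, zero_mul]; exact d_const 1
  | succ n ih =>
    rw [pow_succ, d_mul (hf.pow n) hf, ih]
    rcases n with _ | n
    · simp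
    · simp only [Nat.add_sub_cancel]
      push_cast
      ring

lemma d_sum {ι : Type*} (s : Finset ι) {f : ι → Fn} (h : ∀ i ∈ s, IsHolo (f i)) :
    d (∑ i ∈ s, f i) = ∑ i ∈ s, d (f i) := by
  classical
  induction s using Finset.induction_on with
  | empty => rw [Finset.sum_empty, Finset.sum_empty]; exact d_const 0
  | insert a s ha ih =>
    rw [Finset.sum_insert ha, Finset.sum_insert ha, d_add (h a (by simp))
      (IsHolo.sum s fun i hi => h i (by simp [hi])), ih fun i hi => h i (by simp [hi])]

/-! ### The functions `X` and `Y` -/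

lemma differentiableOn_div_denom (g : SL(2, ℤ)) {u : ℂ × ℂ → ℂ} (hu : Differentiable ℂ u) :
    DifferentiableOn ℂ (fun p : ℂ × ℂ => u p / ((g 1 0 : ℂ) * p.1 + g 1 1)) dom :=
  fun p hp => by
    have h : DifferentiableAt ℂ (fun p : ℂ × ℂ => (g 1 0 : ℂ) * p.1 + g 1 1) p := by fun_prop
    have h0 := denom_ne_zero g hp.1
    simp only [div_eq_mul_inv]
    exact ((hu p).fun_mul (h.fun_inv h0)).differentiableWithinAt

lemma isHolo_X (g : SL(2, ℤ)) : IsHolo (X g) := by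
  refine isHolo_of_formula (u := fun t z => (g 1 0 : ℂ) / ((g 1 0 : ℂ) * t + g 1 1))
    (fun p => rfl) ?_
  exact differentiableOn_div_denom g (by fun_prop)

lemma isHolo_Y (g : SL(2, ℤ)) (l m : ℤ) : IsHolo (Y g l m) := by
  refine isHolo_of_formula (u := fun t z => ((g 1 0 : ℂ) * z + g 1 0 * m - g 1 1 * l) /
    ((g 1 0 : ℂ) * t + g 1 1)) (fun p => rfl) ?_
  exact differentiableOn_div_denom g (by fun_prop)

lemma hasDerivAt_denom (g : SL(2, ℤ)) (t : ℂ) :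
    HasDerivAt (fun t => (g 1 0 : ℂ) * t + g 1 1) (g 1 0 : ℂ) t := by
  simpa using ((hasDerivAt_id t).const_mul (g 1 0 : ℂ)).add_const (g 1 1 : ℂ)

lemma d_X (g : SL(2, ℤ)) : d (X g) = -(tauConst • X g ^ 2) := by
  ext p
  have hj := denom_ne_zero g p.2.1
  have h1 : dz (X g) p = 0 :=
    dz_apply_of_formula (u := fun t z => (g 1 0 : ℂ) / ((g 1 0 : ℂ) * t + g 1 1))
      (fun _ => rfl) p (hasDerivAt_const _ _)
  have h2 := dtau_apply_of_formula (f := X g)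
    (u := fun t z => (g 1 0 : ℂ) / ((g 1 0 : ℂ) * t + g 1 1)) (fun _ => rfl) p
    ((hasDerivAt_const _ _).div (hasDerivAt_denom g _) hj)
  simp only [d, Pi.add_apply, Pi.smul_apply, Pi.mul_apply, Pi.neg_apply, Pi.pow_apply, h1, h2,
    smul_eq_mul, X]
  field_simp
  ring

lemma d_Y (g : SL(2, ℤ)) (l m : ℤ) :
    d (Y g l m) = (1 / 4 : ℂ) • (E1 * X g) - tauConst • (X g * Y g l m) := by
  ext p
  have hj := denom_ne_zero g p.2.1
  have h1 : dz (Y g l m) p = X g p := by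
    refine dz_apply_of_formula (u := fun t z => ((g 1 0 : ℂ) * z + g 1 0 * m - g 1 1 * l) /
      ((g 1 0 : ℂ) * t + g 1 1)) (fun _ => rfl) p ?_
    refine HasDerivAt.div_const ?_ _
    simpa using (((hasDerivAt_id p.1.2).const_mul (g 1 0 : ℂ)).add_const
      ((g 1 0 : ℂ) * m)).sub_const ((g 1 1 : ℂ) * l)
  have h2 := dtau_apply_of_formula (f := Y g l m)
    (u := fun t z => ((g 1 0 : ℂ) * z + g 1 0 * m - g 1 1 * l) /
      ((g 1 0 : ℂ) * t + g 1 1)) (fun _ => rfl) p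
    ((hasDerivAt_const _ _).div (hasDerivAt_denom g _) hj)
  simp only [d, Pi.add_apply, Pi.smul_apply, Pi.mul_apply, Pi.sub_apply, h1, h2,
    smul_eq_mul, X, Y]
  field_simp
  ring

/-! ### The derivation of quasi-Jacobi forms -/

lemma isSingular_smul (c : ℂ) {f : Fn} (hf : IsSingular f) : IsSingular (c • f) :=
  (isSingular_const c).mul hf

lemma isSingular_d {f : Fn} (hf : IsSingular f) : IsSingular (d f) :=
  (isSingular_dtau hf).add (isSingular_smul _ (isSingular_E1.mul (isSingular_dz hf)))

/-- By the Leibniz rule it is enough that `d X(A)` and `d Y(A)` are polynomials in `X(A)`, `Y(A)`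
with singular coefficients. The second one involves `E₁`, whose singularity is used here. -/
lemma isPolyXY_d {Φ : SL(2, ℤ) → ℤ → ℤ → Fn} (h : IsPolyXY Φ) :
    IsPolyXY fun g l m => d (Φ g l m) := by
  obtain ⟨s₁, s₂, F, hF, hs⟩ := h
  have hm : ∀ i j g l m, IsHolo (F i j * X g ^ i * Y g l m ^ j) := fun i j g l m =>
    (IsHolo.mul (hF i j).holo ((isHolo_X g).pow i)).mul ((isHolo_Y g l m).pow j)
  have e : (fun g l m => d (Φ g l m)) = fun g l m => ∑ i ∈ Finset.range (s₁ + 1),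
      ∑ j ∈ Finset.range (s₂ + 1), d (F i j * X g ^ i * Y g l m ^ j) := by
    funext g l m
    rw [hs, d_sum _ fun i _ => IsHolo.sum _ fun j _ => hm i j g l m]
    exact Finset.sum_congr rfl fun i _ => d_sum _ fun j _ => hm i j g l m
  rw [e]
  refine IsPolyXY.sum _ _ fun i _ => IsPolyXY.sum _ _ fun j _ => ?_
  -- The three monomials in `d (F Xⁱ Yʲ)`: from `dF`, from the quadratic terms of `dX` and `dY`, and
  -- from `E₁ X` in `dY`. The truncated exponent `j - 1` is harmless since its coefficient contains
  -- `j`.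
  have key := ((isPolyXY_monomial (isSingular_d (hF i j)) i j).add
    (isPolyXY_monomial (isSingular_smul (-(tauConst * (i + j))) (hF i j)) (i + 1) j)).add
    (isPolyXY_monomial (isSingular_smul (1 / 4 * j) (isSingular_E1.mul (hF i j))) (i + 1) (j - 1))
  convert key using 4 with g l m
  rw [d_mul (IsHolo.mul (hF i j).holo ((isHolo_X g).pow i)) ((isHolo_Y g l m).pow j),
    d_mul (hF i j).holo ((isHolo_X g).pow i), d_pow (isHolo_X g), d_pow (isHolo_Y g l m), d_X, d_Y]
  ext p
  simp only [Pi.add_apply, Pi.mul_apply, Pi.pow_apply, Pi.neg_apply, Pi.smul_apply, Pi.sub_apply,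
    smul_eq_mul, Pi.natCast_apply]
  rcases i with _ | i <;> rcases j with _ | j <;>
    simp only [Nat.add_sub_cancel, Nat.cast_zero, Nat.cast_add, Nat.cast_one, Nat.zero_sub] <;> ring

lemma slash_dz {f : Fn} (hf : IsHolo f) (k : ℕ) (g : SL(2, ℤ)) (l m : ℤ) :
    slash (k + 1) g l m (dz f) = dz (slash k g l m f) := by
  ext p
  have hj := denom_ne_zero g p.2.1
  symm
  have hv : HasDerivAt (fun z : ℂ => (z + l * p.1.1 + m) / ((g 1 0 : ℂ) * p.1.1 + g 1 1))
      (1 / ((g 1 0 : ℂ) * p.1.1 + g 1 1)) p.1.2 :=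
    (((hasDerivAt_id p.1.2).add_const _).add_const _).div_const _
  refine (dz_apply_of_formula (u := fun t z => ((g 1 0 : ℂ) * t + g 1 1) ^ (-(k : ℤ)) *
    ext f (((g 0 0 : ℂ) * t + g 0 1) / ((g 1 0 : ℂ) * t + g 1 1))
      ((z + l * t + m) / ((g 1 0 : ℂ) * t + g 1 1))) (fun _ => rfl) p
    ((hasDerivAt_ext_comp hf (hasDerivAt_const _ _) hv (act_mem_dom g l m p)).const_mul _)).trans ?_
  simp only [slash, zpow_neg, zpow_natCast]
  field_simp
  ring

/-- The chain rule: the Möbius map has derivative `j⁻²`, the elliptic variable `(z + λτ + μ)/j` has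
`τ`-derivative `-Y/j`, and the automorphy factor contributes `-kX`. -/
lemma slash_dtau {f : Fn} (hf : IsHolo f) (k : ℕ) (g : SL(2, ℤ)) (l m : ℤ) :
    slash (k + 2) g l m (dtau f) = dtau (slash k g l m f) +
      tauConst • ((k : ℂ) • (X g * slash k g l m f) + Y g l m * dz (slash k g l m f)) := by
  rw [← slash_dz hf]
  ext p
  have hj := denom_ne_zero g p.2.1
  have hdet := det_eq_one g
  have h0 := hasDerivAt_denom g p.1.1
  have hu : HasDerivAt (fun t : ℂ => ((g 0 0 : ℂ) * t + g 0 1) / ((g 1 0 : ℂ) * t + g 1 1))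
      (1 / ((g 1 0 : ℂ) * p.1.1 + g 1 1) ^ 2) p.1.1 := by
    have h1 : HasDerivAt (fun t => (g 0 0 : ℂ) * t + g 0 1) (g 0 0 : ℂ) p.1.1 := by
      simpa using ((hasDerivAt_id p.1.1).const_mul (g 0 0 : ℂ)).add_const (g 0 1 : ℂ)
    refine (h1.div h0 hj).congr_deriv ?_
    congr 1
    linear_combination hdet
  have hv : HasDerivAt (fun t : ℂ => (p.1.2 + l * t + m) / ((g 1 0 : ℂ) * t + g 1 1))
      (-(Y g l m p) / ((g 1 0 : ℂ) * p.1.1 + g 1 1)) p.1.1 := by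
    have h1 : HasDerivAt (fun t => p.1.2 + l * t + m) (l : ℂ) p.1.1 := by
      simpa using (((hasDerivAt_id p.1.1).const_mul (l : ℂ)).const_add p.1.2).add_const (m : ℂ)
    refine (h1.div h0 hj).congr_deriv ?_
    rw [Y]
    field_simp
    ring
  have hz : HasDerivAt (fun t : ℂ => ((g 1 0 : ℂ) * t + g 1 1) ^ (-(k : ℤ)))
      (-(k * g 1 0 / (((g 1 0 : ℂ) * p.1.1 + g 1 1) ^ k * ((g 1 0 : ℂ) * p.1.1 + g 1 1))))
      p.1.1 := by
    refine ((hasDerivAt_zpow (-(k : ℤ)) _ (Or.inl hj)).comp p.1.1 h0).congr_deriv ?_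
    rw [zpow_sub_one₀ hj, zpow_neg, zpow_natCast]
    push_cast
    field_simp
  have key := dtau_apply_of_formula (f := slash k g l m f)
    (u := fun t z => ((g 1 0 : ℂ) * t + g 1 1) ^ (-(k : ℤ)) *
      ext f (((g 0 0 : ℂ) * t + g 0 1) / ((g 1 0 : ℂ) * t + g 1 1))
        ((z + l * t + m) / ((g 1 0 : ℂ) * t + g 1 1))) (fun _ => rfl) p
    (hz.mul (hasDerivAt_ext_comp hf hu hv (act_mem_dom g l m p)))
  simp only [Pi.add_apply, Pi.smul_apply, Pi.mul_apply, smul_eq_mul, key]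
  have htc := tauConst_mul
  simp only [slash, X, zpow_neg, zpow_natCast]
  generalize ext f _ _ = A
  generalize ext (dz f) _ _ = B
  generalize ext (dtau f) _ _ = C
  generalize Y g l m p = y
  generalize (g 1 0 : ℂ) * p.1.1 + g 1 1 = j at *
  have hc : tauConst * (1 / j ^ 2 * (2 * I / Real.pi * C)) = 1 / j ^ 2 * C := by
    linear_combination (C / j ^ 2) * htc
  calc (j ^ (k + 2))⁻¹ * C = (j ^ k)⁻¹ * (1 / j ^ 2 * C) := by rw [pow_add]; field_simp
    _ = _ := by
      rw [← hc, pow_succ]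
      field_simp
      ring

/-- The terms with `Y` in the transformation laws of `∂_τ` and `E₁ ∂_z` cancel. -/
lemma slash_d {f : Fn} (hf : IsHolo f) (k : ℕ) (g : SL(2, ℤ)) (l m : ℤ) :
    slash (k + 2) g l m (d f) =
      d (slash k g l m f) + (tauConst * k) • (X g * slash k g l m f) := by
  have h1 : slash (k + 2) g l m ((1 / 4 : ℂ) • (E1 * dz f)) =
      (1 / 4 : ℂ) • (slash 1 g l m E1 * slash (k + 1) g l m (dz f)) := by
    rw [← slash_mul, show 1 + (k + 1) = k + 2 by ring]
    ext p
    have : (1 / 4 : ℂ) • (E1 * dz f) = (fun _ => (1 / 4 : ℂ)) * (E1 * dz f) := rfl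
    rw [this]
    simp only [slash, ext_mul (fun _ => (1 / 4 : ℂ)), Pi.smul_apply, smul_eq_mul]
    rw [ext_of_mem (fun _ => (1 / 4 : ℂ)) (act_mem_dom g l m p)]
    ring
  rw [d, slash_add, h1, slash_dtau hf, slash_E1, slash_dz hf, d]
  ext p
  simp only [Pi.add_apply, Pi.smul_apply, Pi.mul_apply, smul_eq_mul, tauConst]
  have hI := Complex.I_ne_zero
  field_simp
  -- The cancellation `π/2i + 2πi/4 = 0` that fixes the constants in `d`.
  linear_combination (4 * Real.pi * Y g l m p * dz (slash k g l m f) p) * Complex.I_sq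

lemma d_mem_QJS {k : ℕ} {f : Fn} (hf : f ∈ QJS k) : d f ∈ QJS (k + 2) := by
  obtain ⟨hs, hp⟩ := hf
  refine ⟨isSingular_d hs, ?_⟩
  have hp' : IsPolyXY fun g l m => slash k g l m f := hp
  have h1 := isPolyXY_d hp'
  have h2 := (isPolyXY_monomial (isSingular_const (tauConst * k)) 1 0).mul hp'
  have := h1.add h2
  change IsPolyXY fun g l m => slash (k + 2) g l m (d f)
  convert this using 4 with g l m
  rw [slash_d hs.holo, pow_zero, mul_one, pow_one, mul_assoc]
  rfl

/-! ### The sum of the spaces of quasi-Jacobi forms is direct -/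

/-- The matrix with rows `(0, -1)` and `(1, n)`. -/
def lowerShift (n : ℕ) : SL(2, ℤ) := ⟨!![0, -1; 1, n], by simp [Matrix.det_fin_two]⟩

lemma slash_one_zero_zero (k : ℕ) (f : Fn) : slash k 1 0 0 f = f := by
  ext p
  simp [slash, ext_apply]

lemma tendsto_add_natCast_cobounded (τ : ℂ) :
    Tendsto (fun n : ℕ => τ + n) atTop (Bornology.cobounded ℂ) :=
  (tendsto_const_add_cobounded τ).comp tendsto_natCast_atTop_cobounded

/-- Along these matrices `X = 1/(τ + n)` and `Y = z/(τ + n)` tend to zero, so only the constant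
coefficient of the polynomial survives. The identity element shows that it is `f`. -/
lemma tendsto_slash_lowerShift {k : ℕ} {f : Fn} (hf : f ∈ QJS k) (p : dom) :
    Tendsto (fun n : ℕ => slash k (lowerShift n) 0 0 f p) atTop (𝓝 (f p)) := by
  obtain ⟨-, s₁, s₂, F, -, hs⟩ := hf
  let q : ℂ × ℂ → ℂ := fun x => ∑ i ∈ Finset.range (s₁ + 1), ∑ j ∈ Finset.range (s₂ + 1),
    F i j p * x.1 ^ i * x.2 ^ j
  have hq : Continuous q := by fun_prop
  have e : ∀ g l m, slash k g l m f p = q (X g p, Y g l m p) := fun g l m => by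
    rw [hs]
    simp [q, Finset.sum_apply]
  have e0 : f p = q (0, 0) := by
    rw [← slash_one_zero_zero k f, e]
    simp [X, Y]
  have hinv : Tendsto (fun n : ℕ => (p.1.1 + n)⁻¹) atTop (𝓝 0) :=
    tendsto_inv₀_cobounded.comp (tendsto_add_natCast_cobounded _)
  simp only [e, e0]
  refine (hq.tendsto (0, 0)).comp (Tendsto.prodMk_nhds ?_ ?_)
  · simpa [X, lowerShift] using hinv
  · simpa [Y, lowerShift, div_eq_mul_inv] using hinv.const_mul p.1.2

/-- Evaluate the relation at the transformed points and divide by `(τ + n) ^ K` with `K` the largest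
weight: as `n → ∞` the lower weights disappear and the form of weight `K` must vanish. Then induct.
-/
lemma eq_zero_of_sum_QJS_eq_zero (s : Finset ℕ) (f : ℕ → Fn) (hf : ∀ k ∈ s, f k ∈ QJS k)
    (h : ∑ k ∈ s, f k = 0) : ∀ k ∈ s, f k = 0 := by
  induction s using Finset.induction_on_max with
  | empty => simp
  | insert K s hK ih =>
    have hKs : K ∉ s := fun h => (hK K h).false
    have hfK : f K = 0 := by
      ext p
      have hj : Tendsto (fun n : ℕ => p.1.1 + n) atTop (Bornology.cobounded ℂ) :=
        tendsto_add_natCast_cobounded _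
      have hne : ∀ᶠ n : ℕ in atTop, p.1.1 + n ≠ 0 := hj.eventually_ne_cobounded 0
      have t : Tendsto (fun n : ℕ => ∑ k ∈ insert K s,
          ((p.1.1 + n)⁻¹) ^ (K - k) * slash k (lowerShift n) 0 0 (f k) p) atTop
          (𝓝 (∑ k ∈ insert K s, 0 ^ (K - k) * f k p)) :=
        tendsto_finsetSum _ fun k hk => ((tendsto_inv₀_cobounded.comp hj).pow _).mul
          (tendsto_slash_lowerShift (hf k hk) p)
      have e : ∀ᶠ n : ℕ in atTop, ∑ k ∈ insert K s,
          ((p.1.1 + n)⁻¹) ^ (K - k) * slash k (lowerShift n) 0 0 (f k) p = 0 := by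
        filter_upwards [hne] with n hn
        have h0 := congrFun h ⟨_, act_mem_dom (lowerShift n) 0 0 p⟩
        rw [Finset.sum_apply] at h0
        have : ∀ k ∈ insert K s, ((p.1.1 + n)⁻¹) ^ (K - k) * slash k (lowerShift n) 0 0 (f k) p =
            ((p.1.1 + n)⁻¹) ^ K * f k ⟨_, act_mem_dom (lowerShift n) 0 0 p⟩ := by
          intro k hk
          have hkK : k ≤ K := by
            rcases Finset.mem_insert.1 hk with rfl | hk
            · exact le_rfl
            · exact (hK k hk).le
          rw [slash, ext_of_mem _ (act_mem_dom (lowerShift n) 0 0 p), zpow_neg, zpow_natCast,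
            ← inv_pow, ← mul_assoc]
          congr 1
          have : ((lowerShift n) 1 0 : ℂ) * p.1.1 + (lowerShift n) 1 1 = p.1.1 + n := by
            simp [lowerShift]
          rw [this, ← pow_add, Nat.sub_add_cancel hkK]
        rw [Finset.sum_congr rfl this, ← Finset.mul_sum, h0]
        simp
      have := tendsto_nhds_unique (t.congr' e) tendsto_const_nhds
      rw [Finset.sum_insert hKs, Finset.sum_eq_zero fun k hk => by
        rw [zero_pow (Nat.sub_pos_of_lt (hK k hk)).ne', zero_mul]] at this
      simpa using this
    rw [Finset.sum_insert hKs, hfK, zero_add] at h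
    intro k hk
    rcases Finset.mem_insert.1 hk with rfl | hk
    · exact hfK
    · exact ih (fun k hk => hf k (Finset.mem_insert_of_mem hk)) h k hk

/-- The space of quasi-Jacobi forms of weight `k` as a subspace of the algebra of all forms. -/
def JSinf.weight (k : ℕ) : Submodule ℂ JSinf :=
  (QJS k).comap JSinf.val.toLinearMap

lemma QJS_le_JSinf {k : ℕ} {f : Fn} (hf : f ∈ QJS k) : f ∈ JSinf :=
  Submodule.mem_iSup_of_mem k hf

/-- The weight of a nonzero form is well defined, so formulas that depend on the weights of the
arguments have exactly one bilinear extension. -/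
lemma isInternal_weight : DirectSum.IsInternal JSinf.weight := by
  have hmap : ∀ k, (JSinf.weight k).map JSinf.val.toLinearMap = QJS k := fun k => by
    rw [JSinf.weight, Submodule.map_comap_eq, inf_eq_right]
    intro f hf
    exact ⟨⟨f, QJS_le_JSinf hf⟩, rfl⟩
  refine DirectSum.isInternal_submodule_of_iSupIndep_of_iSup_eq_top ?_ ?_
  · rw [iSupIndep_iff_finsetSum_eq_zero_imp_eq_zero]
    intro s f hf h k hk
    have := eq_zero_of_sum_QJS_eq_zero s (fun k => (f k : Fn)) hf
      (by simpa using congrArg JSinf.val h) k hk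
    exact Subtype.ext this
  · refine Submodule.map_injective_of_injective (f := JSinf.val.toLinearMap)
      Subtype.val_injective ?_
    rw [Submodule.map_iSup]
    simp only [hmap]
    ext f
    simp only [Submodule.map_top, LinearMap.mem_range]
    exact ⟨fun hf => ⟨⟨f, hf⟩, rfl⟩, fun ⟨x, hx⟩ => hx ▸ x.2⟩

/-! ### Moyal products and the associativity of the Rankin–Cohen deformation -/

open TensorProduct

/-- The Rankin–Cohen bracket as a value of a power of a Moyal bivector. -/
lemma moyal_pow_eq_rcBracket {R A S₁ S₂ : Type*} [CommRing R] [CommRing A] [Algebra R A]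
    [AddCommGroup S₁] [Module R S₁] [AddCommGroup S₂] [Module R S₂] {D : A → A}
    {X₁ Y₁ : Module.End R S₁} {X₂ Y₂ : Module.End R S₂} (hc₁ : X₁ * Y₁ = Y₁ * X₁)
    (hc₂ : X₂ * Y₂ = Y₂ * X₂) {ev₁ : S₁ →ₗ[R] A} {ev₂ : S₂ →ₗ[R] A} {v w : ℕ} {ω₁ : S₁} {ω₂ : S₂}
    {f g : A}
    (h₁ : ∀ a b, ev₁ ((Y₁ ^ b) ((X₁ ^ a) ω₁)) = (-1) ^ b * (v + a).ascFactorial b * D^[a] f)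
    (h₂ : ∀ a b, ev₂ ((Y₂ ^ b) ((X₂ ^ a) ω₂)) = (-1) ^ b * (w + a).ascFactorial b * D^[a] g)
    (n : ℕ) :
    (LinearMap.mul' R A ∘ₗ TensorProduct.map ev₁ ev₂)
      (((TensorProduct.map X₁ Y₂ + (-1 : R) • TensorProduct.map Y₁ X₂) ^ n) (ω₁ ⊗ₜ ω₂)) =
      n.factorial * rcBracket D v w n f g := by
  have hc : Commute (S := Module.End R (S₁ ⊗[R] S₂)) (TensorProduct.map X₁ Y₂)
      ((-1 : R) • TensorProduct.map Y₁ X₂) := by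
    have : Commute (S := Module.End R (S₁ ⊗[R] S₂)) (TensorProduct.map X₁ Y₂)
        (TensorProduct.map Y₁ X₂) := by
      rw [commute_iff_eq, ← TensorProduct.map_mul, ← TensorProduct.map_mul, hc₁, hc₂]
    exact this.smul_right _
  -- The binomial theorem for the commuting operators `X₁ ⊗ Y₂` and `-Y₁ ⊗ X₂`; the index `r` is the
  -- exponent of the first.
  rw [hc.add_pow, LinearMap.sum_apply, map_sum, rcBracket, Finset.mul_sum]
  refine Finset.sum_congr rfl fun r hr => ?_
  have hr : r ≤ n := by simpa [Nat.lt_succ_iff] using hr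
  have e₁ : X₁ ^ r * Y₁ ^ (n - r) = Y₁ ^ (n - r) * X₁ ^ r :=
    ((show Commute X₁ Y₁ from hc₁).pow_pow _ _)
  rw [← nsmul_eq_mul', LinearMap.smul_apply, smul_pow, mul_smul_comm, TensorProduct.map_pow,
    TensorProduct.map_pow, ← TensorProduct.map_mul, e₁, LinearMap.smul_apply, map_nsmul, map_smul]
  -- The rising factorials are `(n-r)! (v+n-1 choose n-r)` and `r! (w+n-1 choose r)`, so with `n
  -- choose r` the factorials multiply to `n!`. Of the signs, `(-1) ^ (n-r)` occurs twice and `(-1)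
  -- ^ r` remains.
  simp only [TensorProduct.map_tmul, LinearMap.comp_apply, LinearMap.mul'_apply,
    Module.End.mul_apply, h₁, h₂, Nat.ascFactorial_eq_factorial_mul_choose',
    show v + r + (n - r) - 1 = v + n - 1 by omega, show w + (n - r) + r - 1 = w + n - 1 by omega,
    Algebra.smul_def, map_pow, map_neg, map_one]
  have e₃ : ((-1 : A) ^ (n - r)) * (-1) ^ (n - r) = 1 := by rw [← mul_pow]; simp
  rw [← Nat.choose_mul_factorial_mul_factorial hr]
  push_cast
  linear_combination ((n.choose r : A) * (n - r).factorial * (v + n - 1).choose (n - r)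
    * D^[r] f * (-1) ^ r * r.factorial * (w + n - 1).choose r * D^[n - r] g) * e₃

/-- A representation, on a module `S`, of commuting operators `X`, `Y` together with an
`X ∂/∂Y`-like operator `E` and a weight operator `T`, and a linear map `ev` from `S` to an algebra
with an operator `D`, which turns `X` into `D` (on the kernel of `E`) and `Y` into `-T`. -/
structure MoyalLift {𝕜 : Type*} [Field 𝕜] {A : Type*} [CommRing A] [Algebra 𝕜 A] (D : A →ₗ[𝕜] A) (S : Type*)
    [AddCommGroup S] [Module 𝕜 S] where
  /-- the operator lifting `D` -/
  X : Module.End 𝕜 S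
  /-- the operator lifting minus the weight -/
  Y : Module.End 𝕜 S
  /-- the operator `X ∂/∂Y` -/
  E : Module.End 𝕜 S
  /-- the weight operator -/
  T : Module.End 𝕜 S
  /-- the evaluation -/
  ev : S →ₗ[𝕜] A
  comm_XY : X * Y = Y * X
  comm_EX : E * X = X * E
  comm_EY : E * Y = Y * E + X
  comm_TX : T * X = X * T + X
  comm_TY : T * Y = Y * T + Y
  ev_X : ∀ p, ev (X p) = D (ev p) - ev (E p)
  ev_Y : ∀ p, ev (Y p) = -ev (T p)

namespace MoyalLift

section

variable {𝕜 : Type*} [Field 𝕜] {A : Type*} [CommRing A] [Algebra 𝕜 A] {D : A →ₗ[𝕜] A}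
  {S S₁ S₂ S₃ : Type*} [AddCommGroup S] [Module 𝕜 S] [AddCommGroup S₁] [Module 𝕜 S₁]
  [AddCommGroup S₂] [Module 𝕜 S₂] [AddCommGroup S₃] [Module 𝕜 S₃]

/-- `ω` lifts its value `ev ω`, of weight `w`. -/
structure IsLift (L : MoyalLift D S) (w : ℕ) (ω : S) : Prop where
  E_eq : L.E ω = 0
  T_eq : L.T ω = (w : 𝕜) • ω

/-- The operator `X` maps lifts to lifts, increasing the eigenvalue of `T` by one. -/
lemma T_X_pow (L : MoyalLift D S) {w : ℕ} {ω : S} (h : L.IsLift w ω) (a : ℕ) :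
    L.E ((L.X ^ a) ω) = 0 ∧ L.T ((L.X ^ a) ω) = ((w + a : ℕ) : 𝕜) • (L.X ^ a) ω := by
  induction a with
  | zero => simpa using ⟨h.E_eq, h.T_eq⟩
  | succ a ih =>
    have h1 := LinearMap.congr_fun L.comm_EX ((L.X ^ a) ω)
    have h2 := LinearMap.congr_fun L.comm_TX ((L.X ^ a) ω)
    simp only [Module.End.mul_apply, LinearMap.add_apply, ih, map_zero, map_smul] at h1 h2
    rw [pow_succ', Module.End.mul_apply, h1, h2]
    refine ⟨rfl, ?_⟩
    push_cast
    module

lemma T_Y_pow (L : MoyalLift D S) {v : 𝕜} {ω : S} (h : L.T ω = v • ω) (b : ℕ) :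
    L.T ((L.Y ^ b) ω) = (v + b) • (L.Y ^ b) ω := by
  induction b with
  | zero => simpa using h
  | succ b ih =>
    have h2 := LinearMap.congr_fun L.comm_TY ((L.Y ^ b) ω)
    simp only [Module.End.mul_apply, LinearMap.add_apply, ih, map_smul] at h2
    rw [pow_succ', Module.End.mul_apply, h2]
    push_cast
    module

/-- On the kernel of `E`, `X` evaluates to `D`. After that each `Y` contributes minus the current
eigenvalue of `T`, which runs through `w + a`, `w + a + 1`, and so on. -/
lemma ev_Y_pow_X_pow (L : MoyalLift D S) {w : ℕ} {ω : S} (h : L.IsLift w ω) (a b : ℕ) :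
    L.ev ((L.Y ^ b) ((L.X ^ a) ω)) =
      ((-1) ^ b * ((w + a).ascFactorial b : 𝕜)) • (D ^ a) (L.ev ω) := by
  induction b with
  | zero =>
    simp only [pow_zero, Module.End.one_apply, Nat.ascFactorial_zero, Nat.cast_one, mul_one,
      one_smul]
    induction a with
    | zero => simp
    | succ a ih =>
      rw [pow_succ', Module.End.mul_apply, L.ev_X, (L.T_X_pow h a).1, ih, map_zero, sub_zero,
        pow_succ', Module.End.mul_apply]
  | succ b ih =>
    rw [pow_succ', Module.End.mul_apply, L.ev_Y, L.T_Y_pow (L.T_X_pow h a).2, map_smul, ih,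
      Nat.ascFactorial_succ]
    push_cast
    module

lemma ev_Y_pow_X_pow_eq_mul (L : MoyalLift D S) {w : ℕ} {ω : S} (h : L.IsLift w ω) (a b : ℕ) :
    L.ev ((L.Y ^ b) ((L.X ^ a) ω)) = (-1) ^ b * (w + a).ascFactorial b * D^[a] (L.ev ω) := by
  rw [L.ev_Y_pow_X_pow h, Algebra.smul_def, ← Module.End.pow_apply]
  simp

variable (hD : ∀ a b, D (a * b) = a * D b + D a * b)

/-- The tensor product of two lifts. -/
def tensor (L₁ : MoyalLift D S₁) (L₂ : MoyalLift D S₂) : MoyalLift D (S₁ ⊗[𝕜] S₂) where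
  X := L₁.X.rTensor S₂ + L₂.X.lTensor S₁
  Y := L₁.Y.rTensor S₂ + L₂.Y.lTensor S₁
  E := L₁.E.rTensor S₂ + L₂.E.lTensor S₁
  T := L₁.T.rTensor S₂ + L₂.T.lTensor S₁
  ev := LinearMap.mul' 𝕜 A ∘ₗ TensorProduct.map L₁.ev L₂.ev
  comm_XY := by
    ext p q
    have h₁ := LinearMap.congr_fun L₁.comm_XY p
    have h₂ := LinearMap.congr_fun L₂.comm_XY q
    simp only [Module.End.mul_apply] at h₁ h₂
    simp [h₁, h₂]
    abel
  comm_EX := by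
    ext p q
    have h₁ := LinearMap.congr_fun L₁.comm_EX p
    have h₂ := LinearMap.congr_fun L₂.comm_EX q
    simp only [Module.End.mul_apply] at h₁ h₂
    simp [h₁, h₂]
    abel
  comm_EY := by
    ext p q
    have h₁ := LinearMap.congr_fun L₁.comm_EY p
    have h₂ := LinearMap.congr_fun L₂.comm_EY q
    simp only [Module.End.mul_apply, LinearMap.add_apply] at h₁ h₂
    simp [h₁, h₂, add_tmul, tmul_add]
    abel
  comm_TX := by
    ext p q
    have h₁ := LinearMap.congr_fun L₁.comm_TX p
    have h₂ := LinearMap.congr_fun L₂.comm_TX q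
    simp only [Module.End.mul_apply, LinearMap.add_apply] at h₁ h₂
    simp [h₁, h₂, add_tmul, tmul_add]
    abel
  comm_TY := by
    ext p q
    have h₁ := LinearMap.congr_fun L₁.comm_TY p
    have h₂ := LinearMap.congr_fun L₂.comm_TY q
    simp only [Module.End.mul_apply, LinearMap.add_apply] at h₁ h₂
    simp [h₁, h₂, add_tmul, tmul_add]
    abel
  ev_X x := by
    induction x with
    | zero => simp
    | add x y hx hy =>
      simp only [map_add, hx, hy]
      abel
    | tmul p q =>
      simp [L₁.ev_X, L₂.ev_X, hD]
      ring
  ev_Y x := by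
    induction x with
    | zero => simp
    | add x y hx hy =>
      simp only [map_add, hx, hy]
      abel
    | tmul p q =>
      simp [L₁.ev_Y, L₂.ev_Y]
      ring

/-- The Moyal bivector. -/
def Omega (L₁ : MoyalLift D S₁) (L₂ : MoyalLift D S₂) : Module.End 𝕜 (S₁ ⊗[𝕜] S₂) :=
  TensorProduct.map L₁.X L₂.Y + (-1 : 𝕜) • TensorProduct.map L₁.Y L₂.X

/-- Under commutators `E` behaves like a derivation with `X ↦ 0` and `Y ↦ X`, so it sends `X ⊗ Y - Y
⊗ X` to `X ⊗ X - X ⊗ X = 0`. -/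
lemma commute_E_Omega (L₁ : MoyalLift D S₁) (L₂ : MoyalLift D S₂) :
    (tensor hD L₁ L₂).E * Omega L₁ L₂ = Omega L₁ L₂ * (tensor hD L₁ L₂).E := by
  ext p q
  have h₁ := LinearMap.congr_fun L₁.comm_EX p
  have h₂ := LinearMap.congr_fun L₂.comm_EX q
  have h₃ := LinearMap.congr_fun L₁.comm_EY p
  have h₄ := LinearMap.congr_fun L₂.comm_EY q
  simp only [Module.End.mul_apply, LinearMap.add_apply] at h₁ h₂ h₃ h₄
  simp [tensor, Omega, h₁, h₂, h₃, h₄, add_tmul, tmul_add]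
  abel

lemma commute_T_Omega (L₁ : MoyalLift D S₁) (L₂ : MoyalLift D S₂) :
    (tensor hD L₁ L₂).T * Omega L₁ L₂ =
      Omega L₁ L₂ * (tensor hD L₁ L₂).T + (2 : 𝕜) • Omega L₁ L₂ := by
  ext p q
  have h₁ := LinearMap.congr_fun L₁.comm_TX p
  have h₂ := LinearMap.congr_fun L₂.comm_TX q
  have h₃ := LinearMap.congr_fun L₁.comm_TY p
  have h₄ := LinearMap.congr_fun L₂.comm_TY q
  simp only [Module.End.mul_apply, LinearMap.add_apply] at h₁ h₂ h₃ h₄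
  simp [tensor, Omega, h₁, h₂, h₃, h₄, add_tmul, tmul_add]
  module

/-- The bracket of two lifted elements is thus itself lifted, up to `n!`, with weight increased by
`2n`; this is what allows brackets to be iterated. -/
lemma IsLift.tmul {L₁ : MoyalLift D S₁} {L₂ : MoyalLift D S₂} {v w : ℕ} {ω₁ : S₁} {ω₂ : S₂}
    (h₁ : L₁.IsLift v ω₁) (h₂ : L₂.IsLift w ω₂) (n : ℕ) :
    (tensor hD L₁ L₂).IsLift (v + w + 2 * n) ((Omega L₁ L₂ ^ n) (ω₁ ⊗ₜ ω₂)) := by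
  induction n with
  | zero =>
    constructor
    · simp [tensor, h₁.E_eq, h₂.E_eq]
    · simp [tensor, h₁.T_eq, h₂.T_eq, smul_tmul, add_smul]
  | succ n ih =>
    have e₁ := LinearMap.congr_fun (commute_E_Omega hD L₁ L₂) ((Omega L₁ L₂ ^ n) (ω₁ ⊗ₜ ω₂))
    have e₂ := LinearMap.congr_fun (commute_T_Omega hD L₁ L₂) ((Omega L₁ L₂ ^ n) (ω₁ ⊗ₜ ω₂))
    simp only [Module.End.mul_apply, LinearMap.add_apply, LinearMap.smul_apply, ih.E_eq, ih.T_eq,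
      map_zero, map_smul] at e₁ e₂
    constructor
    · rw [pow_succ', Module.End.mul_apply, e₁]
    · rw [pow_succ', Module.End.mul_apply, e₂]
      push_cast
      module

lemma ev_Omega_pow {L₁ : MoyalLift D S₁} {L₂ : MoyalLift D S₂} {v w : ℕ} {ω₁ : S₁} {ω₂ : S₂}
    (h₁ : L₁.IsLift v ω₁) (h₂ : L₂.IsLift w ω₂) (n : ℕ) :
    (tensor hD L₁ L₂).ev ((Omega L₁ L₂ ^ n) (ω₁ ⊗ₜ ω₂)) =
      (n.factorial : 𝕜) • rcBracket D v w n (L₁.ev ω₁) (L₂.ev ω₂) := by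
  rw [Algebra.smul_def, map_natCast]
  exact moyal_pow_eq_rcBracket L₁.comm_XY L₂.comm_XY (L₁.ev_Y_pow_X_pow_eq_mul h₁)
    (L₂.ev_Y_pow_X_pow_eq_mul h₂) n

variable (L₁ : MoyalLift D S₁) (L₂ : MoyalLift D S₂) (L₃ : MoyalLift D S₃)

lemma commute_XY_Omega :
    Commute (tensor hD L₁ L₂).X (Omega L₁ L₂) ∧ Commute (tensor hD L₁ L₂).Y (Omega L₁ L₂) := by
  constructor <;>
  · rw [commute_iff_eq]
    ext p q
    have h₁ := LinearMap.congr_fun L₁.comm_XY p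
    have h₂ := LinearMap.congr_fun L₂.comm_XY q
    simp only [Module.End.mul_apply] at h₁ h₂
    simp [tensor, Omega, h₁, h₂]
    abel

lemma commute_Omega_left :
    Commute (Omega (tensor hD L₁ L₂) L₃) ((Omega L₁ L₂).rTensor S₃) := by
  obtain ⟨h₁, h₂⟩ := commute_XY_Omega hD L₁ L₂
  have h : ∀ (u : Module.End 𝕜 (S₁ ⊗[𝕜] S₂)) (v : Module.End 𝕜 S₃), Commute u (Omega L₁ L₂) →
      Commute (S := Module.End 𝕜 ((S₁ ⊗[𝕜] S₂) ⊗[𝕜] S₃))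
        (TensorProduct.map u v) ((Omega L₁ L₂).rTensor S₃) := fun u v huv => by
    rw [commute_iff_eq, LinearMap.rTensor, ← TensorProduct.map_mul, ← TensorProduct.map_mul,
      huv.eq]
    rfl
  have h₃ := h _ L₃.Y h₁
  have h₄ := h _ L₃.X h₂
  exact h₃.add_left (h₄.smul_left _)

lemma commute_Omega_right :
    Commute (Omega L₁ (tensor hD L₂ L₃)) ((Omega L₂ L₃).lTensor S₁) := by
  obtain ⟨h₁, h₂⟩ := commute_XY_Omega hD L₂ L₃
  have h : ∀ (u : Module.End 𝕜 (S₂ ⊗[𝕜] S₃)) (v : Module.End 𝕜 S₁), Commute u (Omega L₂ L₃) →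
      Commute (S := Module.End 𝕜 (S₁ ⊗[𝕜] (S₂ ⊗[𝕜] S₃)))
        (TensorProduct.map v u) ((Omega L₂ L₃).lTensor S₁) := fun u v huv => by
    rw [commute_iff_eq, LinearMap.lTensor, ← TensorProduct.map_mul, ← TensorProduct.map_mul,
      huv.eq]
    rfl
  have h₃ := h _ L₁.X h₂
  have h₄ := h _ L₁.Y h₁
  exact h₃.add_left (h₄.smul_left _)

/-- Both sides are `Ω₁₂ + Ω₁₃ + Ω₂₃`, because `X` and `Y` act on a tensor product by the Leibniz
rule. This is the source of associativity. -/
lemma assoc_Omega (x : (S₁ ⊗[𝕜] S₂) ⊗[𝕜] S₃) :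
    TensorProduct.assoc 𝕜 S₁ S₂ S₃
        ((Omega (tensor hD L₁ L₂) L₃ + (Omega L₁ L₂).rTensor S₃) x) =
      (Omega L₁ (tensor hD L₂ L₃) + (Omega L₂ L₃).lTensor S₁)
        (TensorProduct.assoc 𝕜 S₁ S₂ S₃ x) := by
  induction x with
  | zero => simp
  | add x y hx hy => simp only [map_add, hx, hy]
  | tmul x r =>
    induction x with
    | zero => simp
    | add x y hx hy => simp only [add_tmul, map_add, hx, hy]
    | tmul p q =>
      simp [Omega, tensor, add_tmul, tmul_add]
      abel

lemma ev_assoc (x : (S₁ ⊗[𝕜] S₂) ⊗[𝕜] S₃) :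
    (tensor hD L₁ (tensor hD L₂ L₃)).ev (TensorProduct.assoc 𝕜 S₁ S₂ S₃ x) =
      (tensor hD (tensor hD L₁ L₂) L₃).ev x := by
  induction x with
  | zero => simp
  | add x y hx hy => simp only [map_add, hx, hy]
  | tmul x r =>
    induction x with
    | zero => simp
    | add x y hx hy => simp only [add_tmul, map_add, hx, hy]
    | tmul p q => simp [tensor, mul_assoc]

lemma inv_factorial_smul_add_pow [CharZero 𝕜] {P Q : Module.End 𝕜 S} (h : Commute P Q) (n : ℕ)
    (w : S) (L : S →ₗ[𝕜] A) :
    (n.factorial : 𝕜)⁻¹ • L (((P + Q) ^ n) w) = ∑ x ∈ Finset.HasAntidiagonal.antidiagonal n,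
      ((x.1.factorial : 𝕜)⁻¹ * (x.2.factorial : 𝕜)⁻¹) • L ((P ^ x.1) ((Q ^ x.2) w)) := by
  rw [h.add_pow', LinearMap.sum_apply, map_sum, Finset.smul_sum]
  refine Finset.sum_congr rfl fun x hx => ?_
  have hx : x.1 + x.2 = n := Finset.HasAntidiagonal.mem_antidiagonal.1 hx
  rw [LinearMap.smul_apply, map_nsmul, Module.End.mul_apply, ← Nat.cast_smul_eq_nsmul 𝕜, smul_smul]
  congr 1
  subst hx
  have h0 : ∀ r : ℕ, (r.factorial : 𝕜) ≠ 0 := fun r => by exact_mod_cast r.factorial_ne_zero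
  have := Nat.add_choose_mul_factorial_mul_factorial x.1 x.2
  field_simp [h0]
  rw [Nat.choose_symm_add]
  exact_mod_cast this

/-- Evaluate the `n`-th divided power of `Ω₁₂ + Ω₁₃ + Ω₂₃` on `ω₁ ⊗ ω₂ ⊗ ω₃` in two ways, splitting
off `Ω₁₂` or `Ω₂₃`. The part split off commutes with the rest, so the binomial expansion yields the
iterated brackets on either side. -/
lemma sum_rcBracket_assoc [CharZero 𝕜] (hD : ∀ a b, D (a * b) = a * D b + D a * b) {k l m : ℕ} {ω₁ : S₁} {ω₂ : S₂} {ω₃ : S₃}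
    (h₁ : L₁.IsLift k ω₁) (h₂ : L₂.IsLift l ω₂) (h₃ : L₃.IsLift m ω₃) (n : ℕ) :
    ∑ x ∈ Finset.HasAntidiagonal.antidiagonal n,
      rcBracket D (k + l + 2 * x.2) m x.1
        (rcBracket D k l x.2 (L₁.ev ω₁) (L₂.ev ω₂)) (L₃.ev ω₃) =
    ∑ x ∈ Finset.HasAntidiagonal.antidiagonal n,
      rcBracket D k (l + m + 2 * x.2) x.1
        (L₁.ev ω₁) (rcBracket D l m x.2 (L₂.ev ω₂) (L₃.ev ω₃)) := by
  have hev := ev_assoc hD L₁ L₂ L₃ (((Omega (tensor hD L₁ L₂) L₃ +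
    (Omega L₁ L₂).rTensor S₃) ^ n) ((ω₁ ⊗ₜ ω₂) ⊗ₜ ω₃))
  have hpow : ∀ x, TensorProduct.assoc 𝕜 S₁ S₂ S₃
        (((Omega (tensor hD L₁ L₂) L₃ + (Omega L₁ L₂).rTensor S₃) ^ n) x) =
      ((Omega L₁ (tensor hD L₂ L₃) + (Omega L₂ L₃).lTensor S₁) ^ n)
        (TensorProduct.assoc 𝕜 S₁ S₂ S₃ x) := by
    clear hev
    induction n with
    | zero => simp
    | succ n ih =>
      intro x
      rw [pow_succ', Module.End.mul_apply, assoc_Omega, ih, ← Module.End.mul_apply, ← pow_succ']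
  rw [hpow, TensorProduct.assoc_tmul] at hev
  have hev := congrArg ((n.factorial : 𝕜)⁻¹ • ·) hev
  simp only [inv_factorial_smul_add_pow (commute_Omega_left hD L₁ L₂ L₃),
    inv_factorial_smul_add_pow (commute_Omega_right hD L₁ L₂ L₃)] at hev
  have hr : ∀ a, ((Omega L₁ L₂).rTensor S₃ ^ a) ((ω₁ ⊗ₜ ω₂) ⊗ₜ ω₃) =
      ((Omega L₁ L₂ ^ a) (ω₁ ⊗ₜ ω₂)) ⊗ₜ ω₃ := fun a => by
    rw [LinearMap.rTensor_pow, LinearMap.rTensor_tmul]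
  have hl : ∀ a, ((Omega L₂ L₃).lTensor S₁ ^ a) (ω₁ ⊗ₜ (ω₂ ⊗ₜ ω₃)) =
      ω₁ ⊗ₜ ((Omega L₂ L₃ ^ a) (ω₂ ⊗ₜ ω₃)) := fun a => by
    rw [LinearMap.lTensor_pow, LinearMap.lTensor_tmul]
  have hsc : ∀ (a b : ℕ) (c : A), ((a.factorial : 𝕜)⁻¹ * (b.factorial : 𝕜)⁻¹) •
      (a.factorial : 𝕜) • c = (b.factorial : 𝕜)⁻¹ • c := fun a b c => by
    have : (a.factorial : 𝕜) ≠ 0 := by exact_mod_cast a.factorial_ne_zero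
    rw [smul_smul, mul_right_comm, inv_mul_cancel₀ this, one_mul]
  have hbl : ∀ (v w a : ℕ) (c : 𝕜) (f g : A),
      rcBracket D v w a (c • f) g = c • rcBracket D v w a f g := fun v w a c f g => by
    simp only [rcBracket, ← Module.End.pow_apply, map_smul, mul_smul_comm, smul_mul_assoc,
      Finset.smul_sum]
  have hbr : ∀ (v w a : ℕ) (c : 𝕜) (f g : A),
      rcBracket D v w a f (c • g) = c • rcBracket D v w a f g := fun v w a c f g => by
    simp only [rcBracket, ← Module.End.pow_apply, map_smul, mul_smul_comm, Finset.smul_sum]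
  have hinv : ∀ (b : ℕ) (c : A), (b.factorial : 𝕜)⁻¹ • (b.factorial : 𝕜) • c = c := fun b c => by
    rw [smul_smul, inv_mul_cancel₀ (by exact_mod_cast b.factorial_ne_zero), one_smul]
  simp only [hr, hl, ev_Omega_pow hD (h₁.tmul hD h₂ _) h₃, ev_Omega_pow hD h₁ (h₂.tmul hD h₃ _),
    ev_Omega_pow hD h₁ h₂, ev_Omega_pow hD h₂ h₃, hsc, hbl, hbr, hinv] at hev
  exact hev.symm

variable (D) in
/-- The universal lift of an element `f`, of weight `k`: the basis vector `(a, b)` stands for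
`Yᵇ Xᵃ`. -/
def ofElement (k : ℕ) (f : A) : MoyalLift D (ℕ × ℕ →₀ 𝕜) where
  X := Finsupp.linearCombination 𝕜 fun p : ℕ × ℕ => Finsupp.single (p.1 + 1, p.2) (1 : 𝕜)
  Y := Finsupp.linearCombination 𝕜 fun p : ℕ × ℕ => Finsupp.single (p.1, p.2 + 1) (1 : 𝕜)
  E := Finsupp.linearCombination 𝕜 fun p : ℕ × ℕ =>
    (p.2 : 𝕜) • Finsupp.single (p.1 + 1, p.2 - 1) (1 : 𝕜)
  T := Finsupp.linearCombination 𝕜 fun p : ℕ × ℕ =>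
    (k + p.1 + p.2 : 𝕜) • Finsupp.single p (1 : 𝕜)
  ev := Finsupp.linearCombination 𝕜 fun p : ℕ × ℕ =>
    ((-1) ^ p.2 * ((k + p.1).ascFactorial p.2 : 𝕜)) • (D ^ p.1) f
  comm_XY := by ext ⟨a, b⟩; simp
  comm_EX := by ext ⟨a, b⟩; simp
  comm_EY := by
    refine Finsupp.lhom_ext' fun ⟨a, b⟩ => LinearMap.ext_ring ?_
    cases b <;> simp [add_smul, ← Finsupp.single_add]
  comm_TX := by
    refine Finsupp.lhom_ext' fun ⟨a, b⟩ => LinearMap.ext_ring ?_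
    simp [← Finsupp.single_add]
    ring_nf
  comm_TY := by
    refine Finsupp.lhom_ext' fun ⟨a, b⟩ => LinearMap.ext_ring ?_
    simp [← Finsupp.single_add]
    ring_nf
  ev_X p := by
    induction p using Finsupp.induction_linear with
    | zero => simp
    | add p q hp hq => simp only [map_add, hp, hq]; abel
    | single p c =>
      obtain ⟨a, b⟩ := p
      simp only [Finsupp.linearCombination_single, map_smul, one_smul, ← smul_sub]
      congr 1
      rw [← Module.End.mul_apply D, ← pow_succ', smul_smul, ← sub_smul]
      congr 1
      cases b with
      | zero => simp
      | succ b =>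
        -- Both rising factorials are expressed through the one of length `b` starting at `k + a +
        -- 1`; what remains is `(k + a) + (b + 1) = k + a + 1 + b`.
        have h := Nat.ascFactorial_mul_ascFactorial (k + a) 1 b
        rw [Nat.ascFactorial_succ, Nat.ascFactorial_zero, add_comm 1 b] at h
        rw [← h, ← add_assoc, Nat.ascFactorial_succ, Nat.add_sub_cancel]
        push_cast
        ring
  ev_Y p := by
    induction p using Finsupp.induction_linear with
    | zero => simp
    | add p q hp hq => simp only [map_add, hp, hq]; abel
    | single p c =>
      obtain ⟨a, b⟩ := p
      simp only [Finsupp.linearCombination_single, map_smul, one_smul, ← smul_neg]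
      congr 1
      rw [smul_smul, smul_neg, ← neg_smul, Nat.ascFactorial_succ]
      congr 1
      push_cast
      ring

lemma isLift_ofElement (k : ℕ) (f : A) :
    (ofElement D k f).IsLift k (Finsupp.single (0, 0) 1) ∧
      (ofElement D k f).ev (Finsupp.single (0, 0) 1) = f := by
  refine ⟨⟨?_, ?_⟩, ?_⟩ <;> simp [ofElement]

end

end MoyalLift

/-- The Rankin–Cohen brackets are associative. -/
theorem sum_rcBracket_assoc {𝕜 A : Type*} [Field 𝕜] [CharZero 𝕜] [CommRing A] [Algebra 𝕜 A]
    {D : A →ₗ[𝕜] A} (hD : ∀ a b, D (a * b) = a * D b + D a * b) (k l m n : ℕ) (f g h : A) :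
    ∑ x ∈ Finset.HasAntidiagonal.antidiagonal n,
      rcBracket D (k + l + 2 * x.2) m x.1 (rcBracket D k l x.2 f g) h =
    ∑ x ∈ Finset.HasAntidiagonal.antidiagonal n,
      rcBracket D k (l + m + 2 * x.2) x.1 f (rcBracket D l m x.2 g h) := by
  obtain ⟨h₁, e₁⟩ := MoyalLift.isLift_ofElement (D := D) k f
  obtain ⟨h₂, e₂⟩ := MoyalLift.isLift_ofElement (D := D) l g
  obtain ⟨h₃, e₃⟩ := MoyalLift.isLift_ofElement (D := D) m h
  have := MoyalLift.sum_rcBracket_assoc _ _ _ hD h₁ h₂ h₃ n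
  rwa [e₁, e₂, e₃] at this

/-! ### The bilinear extension of the brackets -/

section

variable {A : Type*} [CommRing A] [Algebra ℂ A]

/-- A family of bilinear maps defines an associative product on `A[[ħ]]` as soon as it does so
on `A`. -/
lemma starProd_assoc {μ : ℕ → A →ₗ[ℂ] A →ₗ[ℂ] A}
    (h : ∀ (n : ℕ) (f g h : A), ∑ x ∈ Finset.HasAntidiagonal.antidiagonal n, μ x.1 (μ x.2 f g) h =
      ∑ x ∈ Finset.HasAntidiagonal.antidiagonal n, μ x.1 f (μ x.2 g h)) (F G H : PowerSeries A) :
    starProd μ (starProd μ F G) H = starProd μ F (starProd μ G H) := by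
  ext n
  -- On both sides the sum is regrouped: the total order of the two maps is the outermost index,
  -- followed by the indices of the coefficients of `F`, `G`, `H`. Each innermost sum is then an
  -- instance of the hypothesis.
  have e₁ : PowerSeries.coeff n (starProd μ (starProd μ F G) H) =
      ∑ x ∈ Finset.HasAntidiagonal.antidiagonal n, ∑ y ∈ Finset.HasAntidiagonal.antidiagonal x.2,
        ∑ z ∈ Finset.HasAntidiagonal.antidiagonal y.2,
          ∑ w ∈ Finset.HasAntidiagonal.antidiagonal x.1,
            μ w.1 (μ w.2 (PowerSeries.coeff y.1 F) (PowerSeries.coeff z.1 G))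
              (PowerSeries.coeff z.2 H) := by
    simp only [starProd, PowerSeries.coeff_mk, map_sum, LinearMap.sum_apply]
    simp only [Finset.sum_sigma']
    refine Finset.sum_nbij'
      (fun t => ⟨(t.1.1 + t.2.2.1.1, t.2.2.2.1 + (t.2.2.2.2 + t.2.1.2)),
        (t.2.2.2.1, t.2.2.2.2 + t.2.1.2), (t.2.2.2.2, t.2.1.2), (t.1.1, t.2.2.1.1)⟩)
      (fun t => ⟨(t.2.2.2.1, t.2.2.2.2 + (t.2.1.1 + t.2.2.1.1) + t.2.2.1.2),
        (t.2.2.2.2 + (t.2.1.1 + t.2.2.1.1), t.2.2.1.2), (t.2.2.2.2, t.2.1.1 + t.2.2.1.1),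
        (t.2.1.1, t.2.2.1.1)⟩) ?_ ?_ ?_ ?_ ?_
    all_goals
      rintro ⟨⟨a, b⟩, ⟨c, d⟩, ⟨e, f⟩, i, j⟩ ht
      simp only [Finset.mem_sigma, Finset.HasAntidiagonal.mem_antidiagonal] at ht ⊢
      try simp only [Sigma.mk.injEq, Prod.mk.injEq, heq_eq_eq, true_and, and_true]
      try omega
  have e₂ : PowerSeries.coeff n (starProd μ F (starProd μ G H)) =
      ∑ x ∈ Finset.HasAntidiagonal.antidiagonal n, ∑ y ∈ Finset.HasAntidiagonal.antidiagonal x.2,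
        ∑ z ∈ Finset.HasAntidiagonal.antidiagonal y.2,
          ∑ w ∈ Finset.HasAntidiagonal.antidiagonal x.1,
            μ w.1 (PowerSeries.coeff y.1 F) (μ w.2 (PowerSeries.coeff z.1 G)
              (PowerSeries.coeff z.2 H)) := by
    simp only [starProd, PowerSeries.coeff_mk, map_sum]
    simp only [Finset.sum_sigma']
    refine Finset.sum_nbij'
      (fun t => ⟨(t.1.1 + t.2.2.1.1, t.2.1.1 + (t.2.2.2.1 + t.2.2.2.2)),
        (t.2.1.1, t.2.2.2.1 + t.2.2.2.2), (t.2.2.2.1, t.2.2.2.2), (t.1.1, t.2.2.1.1)⟩)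
      (fun t => ⟨(t.2.2.2.1, t.2.1.1 + (t.2.2.2.2 + (t.2.2.1.1 + t.2.2.1.2))),
        (t.2.1.1, t.2.2.2.2 + (t.2.2.1.1 + t.2.2.1.2)), (t.2.2.2.2, t.2.2.1.1 + t.2.2.1.2),
        (t.2.2.1.1, t.2.2.1.2)⟩) ?_ ?_ ?_ ?_ ?_
    all_goals
      rintro ⟨⟨a, b⟩, ⟨c, d⟩, ⟨e, f⟩, i, j⟩ ht
      simp only [Finset.mem_sigma, Finset.HasAntidiagonal.mem_antidiagonal] at ht ⊢
      try simp only [Sigma.mk.injEq, Prod.mk.injEq, heq_eq_eq, true_and, and_true]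
      try omega
  rw [e₁, e₂]
  exact Finset.sum_congr rfl fun x _ => Finset.sum_congr rfl fun y _ =>
    Finset.sum_congr rfl fun z _ => h _ _ _ _

variable {V : ℕ → Submodule ℂ A} (hV : DirectSum.IsInternal V)

/-- The operator that multiplies the elements of `V k` by `c k`. -/
def gradedScale (c : ℕ → ℂ) : A →ₗ[ℂ] A :=
  DirectSum.toModule ℂ ℕ A (fun k => c k • (V k).subtype) ∘ₗ
    (LinearEquiv.ofBijective (DirectSum.coeLinearMap V) hV).symm.toLinearMap

lemma gradedScale_apply (c : ℕ → ℂ) {k : ℕ} {f : A} (hf : f ∈ V k) :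
    gradedScale hV c f = c k • f := by
  have : (LinearEquiv.ofBijective (DirectSum.coeLinearMap V) hV).symm f =
      DirectSum.lof ℂ ℕ (fun k => V k) k ⟨f, hf⟩ := by
    rw [LinearEquiv.symm_apply_eq]
    exact (DirectSum.coeLinearMap_lof V k ⟨f, hf⟩).symm
  rw [gradedScale, LinearMap.comp_apply, LinearEquiv.coe_coe, this, DirectSum.toModule_lof]
  rfl

include hV in
lemma eq_of_eqOn_graded {B : Type*} [AddCommGroup B] [Module ℂ B] {φ ψ : A →ₗ[ℂ] B}
    (h : ∀ k, ∀ f ∈ V k, φ f = ψ f) : φ = ψ := by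
  have : ⨆ k, V k ≤ LinearMap.eqLocus φ ψ := iSup_le h
  rw [hV.submodule_iSup_eq_top] at this
  exact LinearMap.ext fun f => this (Submodule.mem_top (x := f))

/-- The bilinear extension of the `n`-th Rankin–Cohen bracket. -/
def bracketMap (D : A →ₗ[ℂ] A) (n : ℕ) : A →ₗ[ℂ] A →ₗ[ℂ] A :=
  ∑ r ∈ Finset.range (n + 1), (LinearMap.mul ℂ A).compl₁₂
    ((D ^ r) ∘ₗ gradedScale hV fun k => (-1) ^ r * ((k + n - 1).choose (n - r) : ℂ))
    ((D ^ (n - r)) ∘ₗ gradedScale hV fun l => ((l + n - 1).choose r : ℂ))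

lemma bracketMap_apply (D : A →ₗ[ℂ] A) (n : ℕ) {k l : ℕ} {f g : A} (hf : f ∈ V k) (hg : g ∈ V l) :
    bracketMap hV D n f g = rcBracket D k l n f g := by
  simp only [bracketMap, LinearMap.sum_apply, LinearMap.compl₁₂_apply, LinearMap.comp_apply,
    gradedScale_apply hV _ hf, gradedScale_apply hV _ hg, map_smul, LinearMap.smul_apply,
    LinearMap.mul_apply', rcBracket, Module.End.pow_apply]
  refine Finset.sum_congr rfl fun r _ => ?_
  simp only [Algebra.smul_def, map_mul, map_pow, map_neg, map_one, map_natCast]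
  ring

lemma rcBracket_mem {D : A → A} (hD : ∀ k, ∀ f ∈ V k, D f ∈ V (k + 2))
    (hmul : ∀ k l, ∀ f ∈ V k, ∀ g ∈ V l, f * g ∈ V (k + l)) {k l : ℕ} {f g : A}
    (hf : f ∈ V k) (hg : g ∈ V l) (n : ℕ) : rcBracket D k l n f g ∈ V (k + l + 2 * n) := by
  have hpow : ∀ (r : ℕ) {k : ℕ} {f : A}, f ∈ V k → D^[r] f ∈ V (k + 2 * r) := by
    intro r k f hf
    induction r with
    | zero => exact hf
    | succ r ih =>
      rw [Function.iterate_succ_apply']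
      exact hD _ _ ih
  refine Submodule.sum_mem _ fun r hr => ?_
  have hr : r ≤ n := by simpa [Nat.lt_succ_iff] using hr
  have e : ∀ a b : ℕ, (-1) ^ r * (a : A) * (b : A) * D^[r] f * D^[n - r] g =
      ((-1) ^ r * (a : ℂ) * (b : ℂ)) • (D^[r] f * D^[n - r] g) := fun a b => by
    simp only [Algebra.smul_def, map_mul, map_pow, map_neg, map_one, map_natCast]
    ring
  rw [e]
  refine Submodule.smul_mem _ _ ?_
  have := hmul _ _ _ (hpow r hf) _ (hpow (n - r) hg)
  rwa [show k + 2 * r + (l + 2 * (n - r)) = k + l + 2 * n by omega] at this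

/-- Associativity is an identity of trilinear maps, so homogeneous arguments suffice. The inner
bracket is then homogeneous of the very weight that the outer bracket of the formal identity uses.
-/
lemma isFormalDeformation_bracketMap {D : A →ₗ[ℂ] A}
    (hD : ∀ a b, D (a * b) = a * D b + D a * b) (hDV : ∀ k, ∀ f ∈ V k, D f ∈ V (k + 2))
    (hmul : ∀ k l, ∀ f ∈ V k, ∀ g ∈ V l, f * g ∈ V (k + l)) :
    IsFormalDeformation (bracketMap hV D) where
  zero f g := by
    have : bracketMap hV D 0 = LinearMap.mul ℂ A :=
      eq_of_eqOn_graded hV fun k f hf => eq_of_eqOn_graded hV fun l g hg => by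
        simp [bracketMap_apply hV D 0 hf hg, rcBracket]
    rw [this, LinearMap.mul_apply']
  assoc := by
    refine starProd_assoc fun n f g h => ?_
    let L : A →ₗ[ℂ] A →ₗ[ℂ] A →ₗ[ℂ] A := ∑ x ∈ Finset.HasAntidiagonal.antidiagonal n,
      (bracketMap hV D x.2).compr₂ (bracketMap hV D x.1)
    let R : A →ₗ[ℂ] A →ₗ[ℂ] A →ₗ[ℂ] A := ∑ x ∈ Finset.HasAntidiagonal.antidiagonal n,
      (LinearMap.llcomp ℂ A A A).compl₁₂ (bracketMap hV D x.1) (bracketMap hV D x.2)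
    have hLR : L = R :=
      eq_of_eqOn_graded hV fun k f hf => eq_of_eqOn_graded hV fun l g hg =>
        eq_of_eqOn_graded hV fun m h hh => by
          simp only [L, R, LinearMap.sum_apply, LinearMap.compr₂_apply, LinearMap.compl₁₂_apply,
            LinearMap.llcomp_apply, bracketMap_apply hV D _ hf hg, bracketMap_apply hV D _ hg hh]
          have e₁ := fun a b => bracketMap_apply hV D b (rcBracket_mem hDV hmul hf hg a) hh
          have e₂ := fun a b => bracketMap_apply hV D b hf (rcBracket_mem hDV hmul hg hh a)
          simp only [e₁, e₂]
          exact sum_rcBracket_assoc hD k l m n f g h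
    simpa [L, R] using congr($hLR f g h)

end

/-! ### Invariance of the Rankin–Cohen brackets under changes of variable -/

section

variable {A : Type*} [CommRing A]

/-- The coefficients in the formula for the iterated derivatives of a modular form. -/
def rcCoeff (k i m : ℕ) : ℕ := (i + m).choose i * (k + m).ascFactorial i

lemma ascFactorial_succ_left (n k : ℕ) :
    n.ascFactorial (k + 1) = n * (n + 1).ascFactorial k := by
  have h := Nat.ascFactorial_mul_ascFactorial n 1 k
  rw [Nat.ascFactorial_succ, Nat.ascFactorial_zero, add_comm 1 k] at h
  simpa using h.symm

/-- The recursion produced by one more application of `j² D`, which differentiates either the power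
of `j` or the derivative of `f`. -/
lemma rcCoeff_succ_succ (k i m : ℕ) : rcCoeff k (i + 1) (m + 1) =
    (k + i + 2 * (m + 1)) * rcCoeff k i (m + 1) + rcCoeff k (i + 1) m := by
  have h := Nat.choose_succ_right_eq (i + m + 1) i
  rw [show i + m + 1 - i = m + 1 by omega] at h
  simp only [rcCoeff]
  rw [show i + 1 + (m + 1) = i + m + 1 + 1 by ring, Nat.choose_succ_succ,
    show i + (m + 1) = i + m + 1 by ring, show i + 1 + m = i + m + 1 by ring,
    ascFactorial_succ_left (k + m), Nat.ascFactorial_succ, show k + (m + 1) = k + m + 1 by ring]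
  zify at h ⊢
  linear_combination ((k + m + 1).ascFactorial i : ℤ) * h

/-- Since `D² j = 0`, the element `Dj` is a constant for `D`, and the iterates of `j² D` stay in the
span of the products of powers of `Dj`, powers of `j` and derivatives of `f`. -/
lemma iterate_sq_mul_deriv {D : A → A} (hadd : ∀ a b, D (a + b) = D a + D b)
    (hD : ∀ a b, D (a * b) = a * D b + D a * b) {j : A} (hj : D (D j) = 0) (k a : ℕ) (f : A) :
    (fun x => j ^ 2 * D x)^[a] (j ^ k * f) = ∑ x ∈ Finset.HasAntidiagonal.antidiagonal a,
      (rcCoeff k x.1 x.2 : A) * (D j ^ x.1 * j ^ (k + x.1 + 2 * x.2) * D^[x.2] f) := by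
  have h0 : D 0 = 0 := by simpa using hadd 0 0
  have h1 : D 1 = 0 := by simpa using hD 1 1
  have hsum : ∀ (s : Finset (ℕ × ℕ)) (u : ℕ × ℕ → A), D (∑ x ∈ s, u x) = ∑ x ∈ s, D (u x) :=
    fun s u => map_sum (⟨⟨D, h0⟩, hadd⟩ : A →+ A) u s
  have hnat : ∀ r : ℕ, D r = 0 := fun r => by
    induction r with
    | zero => simpa using h0
    | succ r ih => rw [Nat.cast_succ, hadd, ih, h1, add_zero]
  have hpow : ∀ (b : A) (r : ℕ), D (b ^ r) * b = r * b ^ r * D b := fun b r => by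
    induction r with
    | zero => simp [h1]
    | succ r ih =>
      rw [pow_succ, hD, add_mul, mul_assoc _ b, mul_comm b, ← mul_assoc, ih]
      push_cast
      ring
  have hc : ∀ r : ℕ, D (D j ^ r) = 0 := fun r => by
    induction r with
    | zero => simpa using h1
    | succ r ih => rw [pow_succ, hD, ih, hj]; ring
  induction a with
  | zero => simp [rcCoeff]
  | succ a ih =>
    let t : ℕ → ℕ → A := fun i m => D j ^ i * j ^ (k + i + 2 * m) * D^[m] f
    have ht : ∀ i m, j ^ 2 * D (t i m) = (k + i + 2 * m : ℕ) * t (i + 1) m + t i (m + 1) := by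
      intro i m
      simp only [t, Function.iterate_succ_apply', hD, hc]
      linear_combination (D j ^ i * D^[m] f * j) * hpow j (k + i + 2 * m)
    -- The contributions to the coefficient at `(i, m)` coming from `(i - 1, m)` and from `(i, m -
    -- 1)`, set to zero where there is no predecessor.
    let c₁ : ℕ → ℕ → ℕ := fun i m =>
      match i with
      | 0 => 0
      | i + 1 => (k + i + 2 * m) * rcCoeff k i m
    let c₂ : ℕ → ℕ → ℕ := fun i m =>
      match m with
      | 0 => 0
      | m + 1 => rcCoeff k i m
    have hcc : ∀ i m, i + m = a + 1 → rcCoeff k i m = c₁ i m + c₂ i m := by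
      intro i m h
      cases i with
      | zero => cases m with
        | zero => simp at h
        | succ m => simp [c₁, c₂, rcCoeff]
      | succ i => cases m with
        | zero => simp [c₁, c₂, rcCoeff, Nat.ascFactorial_succ]
        | succ m => simp [c₁, c₂, rcCoeff_succ_succ]
    rw [Function.iterate_succ_apply', ih, hsum, Finset.mul_sum]
    have e : ∑ x ∈ Finset.HasAntidiagonal.antidiagonal (a + 1),
        (rcCoeff k x.1 x.2 : A) * t x.1 x.2 =
        ∑ x ∈ Finset.HasAntidiagonal.antidiagonal (a + 1), (c₁ x.1 x.2 : A) * t x.1 x.2 +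
        ∑ x ∈ Finset.HasAntidiagonal.antidiagonal (a + 1), (c₂ x.1 x.2 : A) * t x.1 x.2 := by
      rw [← Finset.sum_add_distrib]
      refine Finset.sum_congr rfl fun x hx => ?_
      rw [hcc _ _ (Finset.HasAntidiagonal.mem_antidiagonal.1 hx)]
      push_cast
      ring
    refine Eq.trans ?_ e.symm
    rw [Finset.Nat.sum_antidiagonal_succ, Finset.Nat.sum_antidiagonal_succ' (n := a)
      (f := fun x => (c₂ x.1 x.2 : A) * t x.1 x.2)]
    simp only [c₁, c₂, Nat.cast_zero, zero_mul, zero_add, ← Finset.sum_add_distrib]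
    refine Finset.sum_congr rfl fun x _ => ?_
    rw [hD, hnat]
    change j ^ 2 * ((rcCoeff k x.1 x.2 : A) * D (t x.1 x.2) + 0 * _) = _
    have := ht x.1 x.2
    push_cast at this ⊢
    linear_combination (rcCoeff k x.1 x.2 : A) * this

/-- The Rankin–Cohen brackets are covariant: if `σ` is an automorphism with `σ D = j² D σ` and
`σ f = jᵏ f`, `σ g = jˡ g`, then `σ` multiplies the bracket by `j ^ (k + l + 2n)`. -/
lemma rcBracket_sq_mul_deriv {D : A → A} (hadd : ∀ a b, D (a + b) = D a + D b)
    (hD : ∀ a b, D (a * b) = a * D b + D a * b) {j : A} (hj : D (D j) = 0) (k l n : ℕ) (f g : A) :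
    n.factorial * rcBracket (fun x => j ^ 2 * D x) k l n (j ^ k * f) (j ^ l * g) =
      n.factorial * (j ^ (k + l + 2 * n) * rcBracket D k l n f g) := by
  let X : Module.End A (ℕ × ℕ →₀ A) :=
    Finsupp.linearCombination A fun p : ℕ × ℕ => Finsupp.single (p.1 + 1, p.2) (1 : A)
  let Y : Module.End A (ℕ × ℕ →₀ A) :=
    Finsupp.linearCombination A fun p : ℕ × ℕ => Finsupp.single (p.1, p.2 + 1) (1 : A)
  -- The operator that lifts `j² D` acting on `jᵏ f`: the binomial expansion of its powers is the
  -- formula of `iterate_sq_mul_deriv`.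
  let X' : Module.End A (ℕ × ℕ →₀ A) := (j ^ 2) • X + (-(D j * j)) • Y
  have hXY : X * Y = Y * X := by ext ⟨a, b⟩; simp [X, Y]
  have hXY' : X' * Y = Y * X' := by
    simp only [X', add_mul, mul_add, smul_mul_assoc, mul_smul_comm, hXY]
  let ω : ℕ × ℕ →₀ A := Finsupp.single (0, 0) 1
  have hω : ∀ a b : ℕ, (Y ^ b) ((X ^ a) ω) = Finsupp.single (a, b) 1 := by
    intro a b
    have h1 : ∀ a : ℕ, (X ^ a) ω = Finsupp.single (a, 0) 1 := fun a => by
      induction a with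
      | zero => simp [ω]
      | succ a ih => rw [pow_succ', Module.End.mul_apply, ih]; simp [X]
    induction b with
    | zero => simp [h1]
    | succ b ih => rw [pow_succ', Module.End.mul_apply, ih]; simp [Y]
  let ev : ℕ → A → (ℕ × ℕ →₀ A) →ₗ[A] A := fun k f =>
    Finsupp.linearCombination A fun p : ℕ × ℕ =>
      (-1) ^ p.2 * ((k + p.1).ascFactorial p.2 : A) * D^[p.1] f
  have hev : ∀ k f a b, ev k f ((Y ^ b) ((X ^ a) ω)) =
      (-1) ^ b * (k + a).ascFactorial b * D^[a] f := fun k f a b => by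
    rw [hω]
    simp [ev]
  have hev' : ∀ k f a b, (j ^ k • ev k f) ((Y ^ b) ((X' ^ a) ω)) =
      (-1) ^ b * (k + a).ascFactorial b * (fun x => j ^ 2 * D x)^[a] (j ^ k * f) := by
    intro k f a b
    rw [iterate_sq_mul_deriv hadd hD hj]
    have hc : Commute ((-(D j * j)) • Y) ((j ^ 2) • X) :=
      ((show Commute Y X from hXY.symm).smul_left _).smul_right _
    rw [show X' = (-(D j * j)) • Y + (j ^ 2) • X from add_comm _ _, hc.add_pow',
      LinearMap.sum_apply, map_sum, map_sum, Finset.mul_sum]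
    refine Finset.sum_congr rfl fun x hx => ?_
    have hx : x.1 + x.2 = a := Finset.HasAntidiagonal.mem_antidiagonal.1 hx
    rw [LinearMap.smul_apply, LinearMap.smul_apply, map_nsmul, map_nsmul, smul_pow, smul_pow, smul_mul_smul_comm,
      LinearMap.smul_apply, map_smul, map_smul, Module.End.mul_apply, ← Module.End.mul_apply (Y ^ b),
      ← pow_add, hev, rcCoeff]
    have ha : (k + x.2).ascFactorial (b + x.1) =
        (k + x.2).ascFactorial x.1 * (k + a).ascFactorial b := by
      rw [← hx, add_comm b, ← Nat.ascFactorial_mul_ascFactorial]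
      congr 2
      ring
    have hs : ((-1 : A) ^ x.1) * (-1) ^ x.1 = 1 := by rw [← mul_pow]; simp
    rw [ha, hx, neg_pow]
    simp only [smul_eq_mul, nsmul_eq_mul]
    push_cast
    linear_combination ((a.choose x.1 : A) * (D j * j) ^ x.1 * (j ^ 2) ^ x.2 * j ^ k * (-1) ^ b *
      (k + x.2).ascFactorial x.1 * (k + a).ascFactorial b * D^[x.2] f) * hs
  -- The multiples of `Y ⊗ Y` cancel by antisymmetry, so only the factor `j²` is left.
  have hΩ : TensorProduct.map X' Y + (-1 : A) • TensorProduct.map Y X' =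
      (j ^ 2) • (TensorProduct.map X Y + (-1 : A) • TensorProduct.map Y X) := by
    simp only [X', TensorProduct.map_add_left, TensorProduct.map_add_right,
      TensorProduct.map_smul_left, TensorProduct.map_smul_right]
    module
  have e₁ := moyal_pow_eq_rcBracket hXY' hXY' (hev' k f) (hev' l g) n
  have e₂ := moyal_pow_eq_rcBracket hXY hXY (hev k f) (hev l g) n
  rw [← e₁, mul_left_comm, ← e₂, hΩ, smul_pow, LinearMap.smul_apply, map_smul,
    TensorProduct.map_smul_left, TensorProduct.map_smul_right]
  simp only [LinearMap.comp_smul, LinearMap.smul_apply, smul_eq_mul]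
  ring

end

/-! ### Modular forms and their Rankin–Cohen brackets -/

open scoped ModularForm

/-- A bracket is a polynomial with integer coefficients in iterated derivatives; to compare two
brackets in a common ring it suffices to compare the derivatives. -/
lemma map_rcBracket_congr {R₁ R₂ S : Type*} [CommRing R₁] [CommRing R₂] [CommRing S]
    (φ₁ : R₁ →+* S) (φ₂ : R₂ →+* S) {δ₁ : R₁ → R₁} {δ₂ : R₂ → R₂} {f₁ g₁ : R₁} {f₂ g₂ : R₂}
    (hf : ∀ r, φ₁ (δ₁^[r] f₁) = φ₂ (δ₂^[r] f₂)) (hg : ∀ r, φ₁ (δ₁^[r] g₁) = φ₂ (δ₂^[r] g₂))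
    (k l n : ℕ) : φ₁ (rcBracket δ₁ k l n f₁ g₁) = φ₂ (rcBracket δ₂ k l n f₂ g₂) := by
  simp only [rcBracket, map_sum, map_mul, map_pow, map_neg, map_one, map_natCast, hf, hg]

/-- Functions of `τ` regarded as functions of `(τ, z)`, as a ring homomorphism. -/
def pullHom : (ℍ → ℂ) →+* Fn where
  toFun := pull
  map_one' := rfl
  map_mul' _ _ := rfl
  map_zero' := rfl
  map_add' _ _ := rfl

lemma ofComplex_coe_dom (p : dom) :
    UpperHalfPlane.ofComplex p.1.1 = ⟨p.1.1, p.2.1⟩ :=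
  UpperHalfPlane.ofComplex_apply_of_im_pos p.2.1

lemma pull_apply (φ : ℍ → ℂ) (p : dom) : pull φ p = (φ ∘ UpperHalfPlane.ofComplex) p.1.1 := by
  rw [Function.comp_apply, ofComplex_coe_dom]
  rfl

lemma mdiff_dtauH {φ : ℍ → ℂ} (h : MDiff φ) : MDiff (dtauH φ) :=
  (mdifferentiable_const (c := tauConst)).mul (mdiff_deriv h)

lemma isBoundedAtImInfty_dtauH {φ : ℍ → ℂ} (h : MDiff φ)
    (hb : UpperHalfPlane.IsBoundedAtImInfty φ) : UpperHalfPlane.IsBoundedAtImInfty (dtauH φ) :=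
  (const_boundedAtFilter _ tauConst).mul (isBoundedAtImInfty_deriv h hb)

lemma d_pull {φ : ℍ → ℂ} (h : MDiff φ) : d (pull φ) = pull (dtauH φ) := by
  ext p
  have h1 : dz (pull φ) p = 0 :=
    dz_apply_of_formula (u := fun t _ => (φ ∘ UpperHalfPlane.ofComplex) t) (pull_apply φ) p
      (hasDerivAt_const _ _)
  have h2 := dtau_apply_of_formula (u := fun t _ => (φ ∘ UpperHalfPlane.ofComplex) t)
    (pull_apply φ) p ((UpperHalfPlane.mdifferentiable_iff.1 h).differentiableAt
      (UpperHalfPlane.isOpen_upperHalfPlaneSet.mem_nhds p.2.1)).hasDerivAt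
  simp only [d, Pi.add_apply, Pi.smul_apply, Pi.mul_apply, h1, h2, mul_zero, smul_zero, add_zero]
  rfl

lemma mdiff_iterate_dtauH {φ : ℍ → ℂ} (h : MDiff φ) (r : ℕ) : MDiff (dtauH^[r] φ) := by
  induction r with
  | zero => exact h
  | succ r ih => rw [Function.iterate_succ_apply']; exact mdiff_dtauH ih

lemma isBoundedAtImInfty_iterate_dtauH {φ : ℍ → ℂ} (h : MDiff φ)
    (hb : UpperHalfPlane.IsBoundedAtImInfty φ) (r : ℕ) :
    UpperHalfPlane.IsBoundedAtImInfty (dtauH^[r] φ) := by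
  induction r with
  | zero => exact hb
  | succ r ih =>
    rw [Function.iterate_succ_apply']
    exact isBoundedAtImInfty_dtauH (mdiff_iterate_dtauH h r) ih

lemma iterate_d_pull {φ : ℍ → ℂ} (h : MDiff φ) (r : ℕ) :
    d^[r] (pull φ) = pull (dtauH^[r] φ) := by
  induction r with
  | zero => rfl
  | succ r ih =>
    rw [Function.iterate_succ_apply', Function.iterate_succ_apply', ih,
      d_pull (mdiff_iterate_dtauH h r)]

lemma rcBracket_d_pull {φ ψ : ℍ → ℂ} (hφ : MDiff φ) (hψ : MDiff ψ) (k l n : ℕ) :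
    rcBracket d k l n (pull φ) (pull ψ) = pull (rcBracket dtauH k l n φ ψ) :=
  map_rcBracket_congr (RingHom.id Fn) pullHom (iterate_d_pull hφ) (iterate_d_pull hψ) k l n

lemma mdiff_rcBracket_dtauH {φ ψ : ℍ → ℂ} (hφ : MDiff φ) (hψ : MDiff ψ) (k l n : ℕ) :
    MDiff (rcBracket dtauH k l n φ ψ) := by
  refine Finset.sum_induction _ (fun u : ℍ → ℂ => MDiff u) (fun _ _ h1 h2 => h1.add h2)
    mdifferentiable_const fun r _ => ?_
  refine MDifferentiable.mul (MDifferentiable.mul ?_ (mdiff_iterate_dtauH hφ _))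
    (mdiff_iterate_dtauH hψ _)
  exact mdifferentiable_const (c := (-1) ^ r * ((k + n - 1).choose (n - r) : ℂ) *
    ((l + n - 1).choose r : ℂ))

lemma isBoundedAtImInfty_rcBracket_dtauH {φ ψ : ℍ → ℂ} (hφ : MDiff φ) (hψ : MDiff ψ)
    (hbφ : UpperHalfPlane.IsBoundedAtImInfty φ) (hbψ : UpperHalfPlane.IsBoundedAtImInfty ψ)
    (k l n : ℕ) : UpperHalfPlane.IsBoundedAtImInfty (rcBracket dtauH k l n φ ψ) := by
  refine Finset.sum_induction _ UpperHalfPlane.IsBoundedAtImInfty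
    (fun _ _ h1 h2 => h1.add h2) (const_boundedAtFilter _ _) fun r _ => ?_
  refine Filter.BoundedAtFilter.mul (Filter.BoundedAtFilter.mul ?_
    (isBoundedAtImInfty_iterate_dtauH hφ hbφ _)) (isBoundedAtImInfty_iterate_dtauH hψ hbψ _)
  exact const_boundedAtFilter _ ((-1) ^ r * ((k + n - 1).choose (n - r) : ℂ) *
    ((l + n - 1).choose r : ℂ))

/-- The normalisations compare through `π/2i = π² / (2πi)`. -/
lemma dtauH_eq_smul (φ : ℍ → ℂ) : dtauH φ = (Real.pi : ℂ) ^ 2 • Derivative.normalizedDerivOfComplex φ := by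
  ext τ
  have := Real.pi_ne_zero
  have := Complex.I_ne_zero
  simp only [dtauH, Derivative.normalizedDerivOfComplex, Pi.smul_apply, smul_eq_mul]
  field_simp

lemma mdiff_iterate_normalizedDeriv {φ : ℍ → ℂ} (h : MDiff φ) (r : ℕ) :
    MDiff (Derivative.normalizedDerivOfComplex^[r] φ) := by
  induction r with
  | zero => exact h
  | succ r ih =>
    rw [Function.iterate_succ_apply']
    exact Derivative.normalizedDerivOfComplex_mdifferentiable ih

lemma iterate_dtauH {φ : ℍ → ℂ} (h : MDiff φ) (r : ℕ) :
    dtauH^[r] φ = ((Real.pi : ℂ) ^ 2) ^ r • Derivative.normalizedDerivOfComplex^[r] φ := by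
  induction r with
  | zero => simp
  | succ r ih =>
    rw [Function.iterate_succ_apply', Function.iterate_succ_apply', ih, dtauH_eq_smul,
      Derivative.normalizedDerivOfComplex_smul _ _ (mdiff_iterate_normalizedDeriv h r), smul_smul,
      pow_succ' ((Real.pi : ℂ) ^ 2) r]

lemma rcBracket_dtauH {φ ψ : ℍ → ℂ} (hφ : MDiff φ) (hψ : MDiff ψ) (k l n : ℕ) :
    rcBracket dtauH k l n φ ψ =
      (Real.pi : ℂ) ^ (2 * n) • rcBracket Derivative.normalizedDerivOfComplex k l n φ ψ := by
  rw [rcBracket, rcBracket, Finset.smul_sum]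
  refine Finset.sum_congr rfl fun r hr => ?_
  have hr : r ≤ n := by simpa [Nat.lt_succ_iff] using hr
  rw [iterate_dtauH hφ, iterate_dtauH hψ, mul_smul_comm, mul_smul_comm, smul_mul_assoc, smul_smul,
    ← pow_add, Nat.sub_add_cancel hr, ← pow_mul]

/-! ### Covariance of the brackets of modular forms. -/

/-- The algebra of holomorphic functions on the upper half-plane. -/
def Hol : Subalgebra ℂ (ℍ → ℂ) where
  carrier := {φ | MDiff φ}
  mul_mem' h1 h2 := MDifferentiable.mul h1 h2
  add_mem' h1 h2 := MDifferentiable.add h1 h2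
  algebraMap_mem' _ := mdifferentiable_const

/-- The derivation `(1 / 2πi) d/dτ` of the algebra of holomorphic functions. -/
def Hol.D : Hol →ₗ[ℂ] Hol where
  toFun φ := ⟨Derivative.normalizedDerivOfComplex φ.1, Derivative.normalizedDerivOfComplex_mdifferentiable φ.2⟩
  map_add' φ ψ := Subtype.ext (Derivative.normalizedDerivOfComplex_add φ.1 ψ.1 φ.2 ψ.2)
  map_smul' c φ := Subtype.ext (Derivative.normalizedDerivOfComplex_smul c φ.1 φ.2)

lemma Hol.D_mul (φ ψ : Hol) : D (φ * ψ) = φ * D ψ + D φ * ψ :=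
  Subtype.ext ((Derivative.normalizedDerivOfComplex_mul φ.1 ψ.1 φ.2 ψ.2).trans (add_comm _ _))

lemma Hol.coe_iterate_D (φ : Hol) (r : ℕ) :
    ((D^[r] φ : Hol) : ℍ → ℂ) = Derivative.normalizedDerivOfComplex^[r] (φ : ℍ → ℂ) := by
  induction r with
  | zero => rfl
  | succ r ih =>
    rw [Function.iterate_succ_apply', Function.iterate_succ_apply', ← ih]
    rfl

/-- The automorphy factor `cτ + d`. -/
def autFactor (g : SL(2, ℤ)) : Hol :=
  ⟨fun τ => (g 1 0 : ℂ) * τ + g 1 1, by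
    change MDiff fun τ : ℍ => (g 1 0 : ℂ) * τ + g 1 1
    refine UpperHalfPlane.mdifferentiable_iff.2 (DifferentiableOn.congr (f := fun z : ℂ =>
      (g 1 0 : ℂ) * z + g 1 1) (by fun_prop) fun z hz => ?_)
    simp [UpperHalfPlane.ofComplex_apply_of_im_pos hz]⟩

lemma D_autFactor (g : SL(2, ℤ)) :
    Hol.D (autFactor g) = algebraMap ℂ Hol ((2 * Real.pi * Complex.I)⁻¹ * g 1 0) := by
  refine Subtype.ext (funext fun τ => congrArg ((2 * Real.pi * Complex.I)⁻¹ * ·) ?_)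
  refine HasDerivAt.deriv (((hasDerivAt_id (τ : ℂ)).const_mul (g 1 0 : ℂ)).add_const
    (g 1 1 : ℂ) |>.congr_of_eventuallyEq ?_ |>.congr_deriv (mul_one _))
  filter_upwards [UpperHalfPlane.isOpen_upperHalfPlaneSet.mem_nhds τ.im_pos] with z hz
  simp [autFactor, UpperHalfPlane.ofComplex_apply_of_im_pos hz]

lemma D_D_autFactor (g : SL(2, ℤ)) : Hol.D (Hol.D (autFactor g)) = 0 := by
  rw [D_autFactor]
  exact Subtype.ext (Derivative.normalizedDerivOfComplex_const _)

lemma denom_eq_autFactor (g : SL(2, ℤ)) (τ : ℍ) :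
    UpperHalfPlane.denom g τ = (autFactor g : ℍ → ℂ) τ := by
  simp [UpperHalfPlane.denom, autFactor]

lemma autFactor_ne_zero (g : SL(2, ℤ)) (τ : ℍ) : (autFactor g : ℍ → ℂ) τ ≠ 0 :=
  denom_eq_autFactor g τ ▸ UpperHalfPlane.denom_ne_zero _ _

/-- This is the slash formula for `D` in weight zero, where the anomalous term, proportional to the
weight, vanishes. -/
lemma D_smul_eq {g : SL(2, ℤ)} {φ ψ : Hol} (h : ∀ τ : ℍ, φ.1 (g • τ) = ψ.1 τ) (τ : ℍ) :
    (Hol.D φ).1 (g • τ) = (autFactor g ^ 2 * Hol.D ψ).1 τ := by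
  have e : φ.1 ∣[(0 : ℤ)] g = ψ.1 := by
    ext τ
    rw [ModularForm.SL_slash_apply, h]
    simp
  have := congrFun (Derivative.normalizedDerivOfComplex_SL_slash (k := 0) φ.2 (γ := g)) τ
  rw [e, Pi.sub_apply, ModularForm.SL_slash_apply, denom_eq_autFactor] at this
  have h0 := autFactor_ne_zero g τ
  change Derivative.normalizedDerivOfComplex φ.1 (g • τ) = (autFactor g).1 τ ^ 2 *
    Derivative.normalizedDerivOfComplex ψ.1 τ
  rw [this]
  simp
  field_simp

lemma iterate_D_smul_eq {g : SL(2, ℤ)} {φ ψ : Hol} (h : ∀ τ : ℍ, φ.1 (g • τ) = ψ.1 τ) (r : ℕ)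
    (τ : ℍ) : (Hol.D^[r] φ).1 (g • τ) = ((fun x => autFactor g ^ 2 * Hol.D x)^[r] ψ).1 τ := by
  induction r generalizing τ with
  | zero => exact h τ
  | succ r ih =>
    rw [Function.iterate_succ_apply', Function.iterate_succ_apply']
    exact D_smul_eq ih τ

/-- The evaluation of holomorphic functions at a point. -/
def Hol.eval (τ : ℍ) : Hol →+* ℂ := (Pi.evalRingHom (fun _ : ℍ => ℂ) τ).comp Hol.val.toRingHom

/-- At `g • τ` the derivatives of `φ` are the iterates of `j² D` on `jᵏ φ` at `τ`, so the algebraic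
covariance of the brackets applies. Its factor `n!` is cancelled after evaluation in `ℂ`. -/
lemma rcBracket_smul {g : SL(2, ℤ)} {k l : ℕ} {φ ψ : Hol}
    (hφ : ∀ τ : ℍ, φ.1 (g • τ) = (autFactor g).1 τ ^ k * φ.1 τ)
    (hψ : ∀ τ : ℍ, ψ.1 (g • τ) = (autFactor g).1 τ ^ l * ψ.1 τ) (n : ℕ) (τ : ℍ) :
    (rcBracket Hol.D k l n φ ψ).1 (g • τ) =
      (autFactor g).1 τ ^ (k + l + 2 * n) * (rcBracket Hol.D k l n φ ψ).1 τ := by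
  have h1 := map_rcBracket_congr (Hol.eval (g • τ)) (Hol.eval τ)
    (fun r => iterate_D_smul_eq (ψ := autFactor g ^ k * φ) hφ r τ)
    (fun r => iterate_D_smul_eq (ψ := autFactor g ^ l * ψ) hψ r τ) k l n
  have h2 := congrArg (Hol.eval τ) (rcBracket_sq_mul_deriv (fun a b => map_add Hol.D a b) Hol.D_mul
    (D_D_autFactor g) k l n φ ψ)
  rw [map_mul, map_mul, map_natCast, ← h1] at h2
  have := mul_left_cancel₀ (by exact_mod_cast n.factorial_ne_zero) h2
  rw [map_mul, map_pow] at this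
  exact this

lemma modularForm_smul {k : ℕ} (φ : ModularForm 𝒮ℒ (k : ℤ)) (g : SL(2, ℤ)) (τ : ℍ) :
    φ (g • τ) = (autFactor g).1 τ ^ k * φ τ := by
  have h := congrFun (SlashInvariantForm.slash_action_eqn φ _
    (⟨g, rfl⟩ : Matrix.SpecialLinearGroup.mapGL ℝ g ∈ 𝒮ℒ)) τ
  have h' : ((φ : ℍ → ℂ) ∣[(k : ℤ)] g) τ = φ τ := h
  rw [ModularForm.SL_slash_apply, denom_eq_autFactor, zpow_neg, zpow_natCast] at h'
  have h0 := autFactor_ne_zero g τ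
  rw [← h']
  field_simp

lemma mdiff_modularForm {k : ℤ} (φ : ModularForm 𝒮ℒ k) : MDiff (φ : ℍ → ℂ) := φ.holo'

/-- The Rankin–Cohen bracket of two modular forms. -/
def rcModularForm {k l : ℕ} (n : ℕ) (φ : ModularForm 𝒮ℒ (k : ℤ)) (ψ : ModularForm 𝒮ℒ (l : ℤ)) :
    ModularForm 𝒮ℒ ((k + l + 2 * n : ℕ) : ℤ) :=
  have inv : ∀ g : SL(2, ℤ), rcBracket dtauH k l n φ ψ ∣[((k + l + 2 * n : ℕ) : ℤ)] g =
      rcBracket dtauH k l n φ ψ := fun g => by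
    ext τ
    have e : rcBracket dtauH k l n φ ψ = (Real.pi : ℂ) ^ (2 * n) •
        (rcBracket Hol.D k l n ⟨φ, mdiff_modularForm φ⟩ ⟨ψ, mdiff_modularForm ψ⟩ : Hol).1 := by
      rw [rcBracket_dtauH (mdiff_modularForm φ) (mdiff_modularForm ψ)]
      congr 1
      exact map_rcBracket_congr (RingHom.id (ℍ → ℂ)) Hol.val.toRingHom
        (fun r => (Hol.coe_iterate_D ⟨φ, mdiff_modularForm φ⟩ r).symm)
        (fun r => (Hol.coe_iterate_D ⟨ψ, mdiff_modularForm ψ⟩ r).symm) k l n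
    have h0 := autFactor_ne_zero g τ
    rw [ModularForm.SL_slash_apply, e, Pi.smul_apply, Pi.smul_apply,
      rcBracket_smul (modularForm_smul φ g) (modularForm_smul ψ g), denom_eq_autFactor, zpow_neg,
      zpow_natCast, smul_eq_mul, smul_eq_mul]
    field_simp
  { toFun := rcBracket dtauH k l n φ ψ
    slash_action_eq' := by
      rintro _ ⟨g, rfl⟩
      exact inv g
    holo' := mdiff_rcBracket_dtauH (mdiff_modularForm φ) (mdiff_modularForm ψ) k l n
    -- All cusps are equivalent to `i∞` under `SL(2, ℤ)`, so by invariance boundedness there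
    -- suffices.
    bdd_at_cusps' := fun hc => (OnePoint.isBoundedAt_iff_forall_SL2Z hc).2 fun g _ => by
      rw [inv g]
      exact isBoundedAtImInfty_rcBracket_dtauH (mdiff_modularForm φ) (mdiff_modularForm ψ)
        (ModularFormClass.bdd_at_infty φ) (ModularFormClass.bdd_at_infty ψ) k l n }

/-! ### Modular forms are quasi-Jacobi forms -/

lemma isSingular_pull {φ : ℍ → ℂ} (h : MDiff φ) (hb : UpperHalfPlane.IsBoundedAtImInfty φ)
    (hp : ∀ τ : ℍ, φ ((1 : ℝ) +ᵥ τ) = φ τ) : IsSingular (pull φ) where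
  holo := isHolo_of_formula (u := fun t _ => (φ ∘ UpperHalfPlane.ofComplex) t) (pull_apply φ) <|
    (UpperHalfPlane.mdifferentiable_iff.1 h).comp (f := Prod.fst) differentiableOn_fst
      fun _ hp => hp.1
  z_add_one τ z := by
    by_cases hd : (τ, z) ∈ dom
    · rw [ext_of_mem _ hd, ext_of_mem _ ((mem_dom_z τ z).2 hd)]
      rfl
    · simp [ext, hd, mem_dom_z]
  tau_add_one τ z := by
    by_cases hd : (τ, z) ∈ dom
    · rw [ext_of_mem _ hd, ext_of_mem _ ((mem_dom_tau τ z).2 hd)]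
      refine Eq.trans (congrArg φ ?_) (hp ⟨τ, hd.1⟩)
      ext
      simp [add_comm]
    · simp [ext, hd, mem_dom_tau]
  poles := by
    refine ⟨0, fun τ m n => ?_⟩
    have h : (fun _ => φ τ) =ᶠ[𝓝[≠] ((m : ℂ) + n * (τ : ℂ))] ext (pull φ) τ :=
      (lattice_isolated τ m n).mono fun z hz => (ext_of_mem (pull φ) hz).symm
    refine ⟨(MeromorphicAt.const (φ τ) _).congr h, ?_⟩
    rw [← meromorphicOrderAt_congr h]
    simpa using (analyticAt_const (v := φ τ)).meromorphicOrderAt_nonneg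
  laurent := by
    refine ⟨0, fun n => if n = 0 then φ else fun _ => 0, fun n => ?_, fun τ => ?_⟩
    · dsimp only
      split_ifs
      · exact ⟨h, hb⟩
      · exact ⟨mdifferentiable_const, const_boundedAtFilter _ _⟩
    · have h := lattice_isolated τ 0 0
      simp only [Int.cast_zero, zero_mul, add_zero] at h
      filter_upwards [h] with z hz
      rw [ext_of_mem _ hz]
      convert hasSum_ite_eq 0 (φ τ) using 2
      · split_ifs with h0 <;> simp [h0]
      · simp [pull]

lemma MF_le_QJS (k : ℕ) : MF k ≤ QJS k := by
  rintro _ ⟨φ, rfl⟩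
  have hs : IsSingular (pull φ) := by
    refine isSingular_pull (mdiff_modularForm φ) (ModularFormClass.bdd_at_infty φ) fun τ => ?_
    have h := modularForm_smul φ ModularGroup.T τ
    rw [UpperHalfPlane.modular_T_smul] at h
    simpa [autFactor, ModularGroup.T] using h
  refine ⟨hs, 0, 0, fun _ _ => pull φ, fun _ _ => hs, fun g l m => ?_⟩
  ext p
  have hden : (g 1 0 : ℂ) * p.1.1 + g 1 1 ≠ 0 := denom_ne_zero g p.2.1
  have e : pull φ ⟨_, act_mem_dom g l m p⟩ =
      ((g 1 0 : ℂ) * p.1.1 + g 1 1) ^ k * pull φ p := by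
    refine Eq.trans (congrArg φ ?_) (modularForm_smul φ g ⟨p.1.1, p.2.1⟩)
    ext
    rw [UpperHalfPlane.specialLinearGroup_apply]
    rfl
  rw [slash, ext_of_mem _ (act_mem_dom g l m p), e, zpow_neg, zpow_natCast]
  simp
  field_simp

lemma M_le_JSinf : M ≤ JSinf := fun _ hf =>
  (iSup_mono MF_le_QJS : ⨆ k, MF k ≤ ⨆ k, QJS k) hf

/-! ### The deformation of the algebra of quasi-Jacobi forms -/

lemma isHolo_and_d_mem_JSinf {f : Fn} (hf : f ∈ JSinf) : IsHolo f ∧ d f ∈ JSinf := by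
  refine Submodule.iSup_induction QJS (motive := fun f => IsHolo f ∧ d f ∈ JSinf) hf
    (fun k f hf => ⟨hf.1.holo, QJS_le_JSinf (d_mem_QJS hf)⟩) ?_ ?_
  · exact ⟨isHolo_const 0, (d_const 0 : d 0 = 0).symm ▸ JSinf.zero_mem⟩
  · rintro f g ⟨hf, hf'⟩ ⟨hg, hg'⟩
    exact ⟨hf.add hg, d_add hf hg ▸ JSinf.add_mem hf' hg'⟩

/-- The derivation `d` of the algebra of quasi-Jacobi forms. -/
def JSinf.deriv : JSinf →ₗ[ℂ] JSinf where
  toFun f := ⟨d f, (isHolo_and_d_mem_JSinf f.2).2⟩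
  map_add' f g := Subtype.ext
    (d_add (isHolo_and_d_mem_JSinf f.2).1 (isHolo_and_d_mem_JSinf g.2).1)
  map_smul' c f := Subtype.ext (d_smul c (isHolo_and_d_mem_JSinf f.2).1)

lemma JSinf.deriv_mul (f g : JSinf) : JSinf.deriv (f * g) = f * JSinf.deriv g + JSinf.deriv f * g :=
  Subtype.ext ((d_mul (isHolo_and_d_mem_JSinf f.2).1 (isHolo_and_d_mem_JSinf g.2).1).trans
    (congrArg _ (mul_comm _ _)))

lemma JSinf.coe_iterate_deriv (f : JSinf) (r : ℕ) :
    ((JSinf.deriv^[r] f : JSinf) : Fn) = d^[r] (f : Fn) := by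
  induction r with
  | zero => rfl
  | succ r ih =>
    rw [Function.iterate_succ_apply', Function.iterate_succ_apply', ← ih]
    rfl

/-- The Rankin–Cohen brackets of quasi-Jacobi forms. -/
def JSinf.bracket (n : ℕ) : JSinf →ₗ[ℂ] JSinf →ₗ[ℂ] JSinf :=
  bracketMap isInternal_weight JSinf.deriv n

lemma JSinf.coe_bracket {n k l : ℕ} {f g : JSinf} (hf : (f : Fn) ∈ QJS k) (hg : (g : Fn) ∈ QJS l) :
    (JSinf.bracket n f g : Fn) = rcBracket d k l n (f : Fn) (g : Fn) := by
  rw [JSinf.bracket, bracketMap_apply isInternal_weight JSinf.deriv n (k := k) (l := l) hf hg]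
  exact map_rcBracket_congr JSinf.val.toRingHom (RingHom.id Fn) (JSinf.coe_iterate_deriv f)
    (JSinf.coe_iterate_deriv g) k l n

lemma JSinf.bracket_mem_M (n : ℕ) {f g : JSinf} (hf : (f : Fn) ∈ M) (hg : (g : Fn) ∈ M) :
    (JSinf.bracket n f g : Fn) ∈ M := by
  -- Bilinearity reduces to homogeneous forms, one argument at a time. The existential carries the
  -- membership in `JSinf` through an induction over elements of `Fn`.
  have h1 : ∃ h : (f : Fn) ∈ JSinf, ∀ g : JSinf, (g : Fn) ∈ M →
      (JSinf.bracket n ⟨f, h⟩ g : Fn) ∈ M := by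
    refine Submodule.iSup_induction MF (motive := fun f => ∃ h : f ∈ JSinf, ∀ g : JSinf,
      (g : Fn) ∈ M → (JSinf.bracket n ⟨f, h⟩ g : Fn) ∈ M) hf ?_ ?_ ?_
    · intro k f hf
      refine ⟨QJS_le_JSinf (MF_le_QJS k hf), fun g hg => ?_⟩
      have h2 : ∃ h : (g : Fn) ∈ JSinf,
          (JSinf.bracket n ⟨f, QJS_le_JSinf (MF_le_QJS k hf)⟩ ⟨g, h⟩ : Fn) ∈ M := by
        refine Submodule.iSup_induction MF (motive := fun g => ∃ h : g ∈ JSinf,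
          (JSinf.bracket n ⟨f, QJS_le_JSinf (MF_le_QJS k hf)⟩ ⟨g, h⟩ : Fn) ∈ M) hg ?_ ?_ ?_
        · intro l g hg
          refine ⟨QJS_le_JSinf (MF_le_QJS l hg), ?_⟩
          rw [JSinf.coe_bracket (MF_le_QJS k hf) (MF_le_QJS l hg)]
          obtain ⟨φ, hφ⟩ := hf
          obtain ⟨ψ, hψ⟩ := hg
          refine Submodule.mem_iSup_of_mem (k + l + 2 * n) ⟨rcModularForm n φ ψ, ?_⟩
          dsimp only
          rw [hφ, hψ]
          exact rcBracket_d_pull φ.holo' ψ.holo' k l n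
        · refine ⟨JSinf.zero_mem, ?_⟩
          rw [show (⟨0, JSinf.zero_mem⟩ : JSinf) = 0 from rfl, map_zero]
          exact M.zero_mem
        · rintro g₁ g₂ ⟨h₁, m₁⟩ ⟨h₂, m₂⟩
          refine ⟨JSinf.add_mem h₁ h₂, ?_⟩
          rw [show (⟨g₁ + g₂, JSinf.add_mem h₁ h₂⟩ : JSinf) = ⟨g₁, h₁⟩ + ⟨g₂, h₂⟩ from rfl, map_add]
          exact M.add_mem m₁ m₂
      exact h2.2
    · refine ⟨JSinf.zero_mem, fun g _ => ?_⟩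
      rw [show (⟨0, JSinf.zero_mem⟩ : JSinf) = 0 from rfl, map_zero]
      exact M.zero_mem
    · rintro f₁ f₂ ⟨h₁, m₁⟩ ⟨h₂, m₂⟩
      refine ⟨JSinf.add_mem h₁ h₂, fun g hg => ?_⟩
      rw [show (⟨f₁ + f₂, JSinf.add_mem h₁ h₂⟩ : JSinf) = ⟨f₁, h₁⟩ + ⟨f₂, h₂⟩ from rfl, map_add]
      exact M.add_mem (m₁ g hg) (m₂ g hg)
  exact h1.2 g hg

end

end QuasiJacobi

/-! ### The main theorem. -/

theorem mainTheorem9 :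
    ∃ B : ℕ → QuasiJacobi.JSinf →ₗ[ℂ] QuasiJacobi.JSinf →ₗ[ℂ] QuasiJacobi.JSinf,
      -- the bilinear extension exists, takes values in `JS^∞`, and is unique
      QuasiJacobi.ExtendsBracket B ∧
      (∀ B' : ℕ → QuasiJacobi.JSinf →ₗ[ℂ] QuasiJacobi.JSinf →ₗ[ℂ] QuasiJacobi.JSinf,
        QuasiJacobi.ExtendsBracket B' → B' = B) ∧
      -- (i)
      (∀ (n k l : ℕ) (f g : QuasiJacobi.JSinf),
        (f : QuasiJacobi.Fn) ∈ QuasiJacobi.QJS k → (g : QuasiJacobi.Fn) ∈ QuasiJacobi.QJS l →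
          (B n f g : QuasiJacobi.Fn) ∈ QuasiJacobi.QJS (k + l + 2 * n)) ∧
      -- (ii)
      QuasiJacobi.IsFormalDeformation B ∧
      -- (iii)
      QuasiJacobi.M ≤ QuasiJacobi.JSinf ∧
      (∀ (n : ℕ) (f g : QuasiJacobi.JSinf),
        (f : QuasiJacobi.Fn) ∈ QuasiJacobi.M → (g : QuasiJacobi.Fn) ∈ QuasiJacobi.M →
          (B n f g : QuasiJacobi.Fn) ∈ QuasiJacobi.M) ∧
      (∀ (n k l : ℕ) (φ : ModularForm 𝒮ℒ (k : ℤ)) (ψ : ModularForm 𝒮ℒ (l : ℤ))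
        (f g : QuasiJacobi.JSinf),
        (f : QuasiJacobi.Fn) = QuasiJacobi.pull φ → (g : QuasiJacobi.Fn) = QuasiJacobi.pull ψ →
          ∃ χ : ModularForm 𝒮ℒ ((k + l + 2 * n : ℕ) : ℤ),
            (B n f g : QuasiJacobi.Fn) = QuasiJacobi.pull χ ∧
            -- the classical bracket for the derivation `(π / 2i) d/dτ`
            (χ : ℍ → ℂ) = QuasiJacobi.rcBracket QuasiJacobi.dtauH k l n (φ : ℍ → ℂ) ψ ∧
            -- the same in terms of the derivation `(1 / 2πi) d/dτ`
            (χ : ℍ → ℂ) = ((Real.pi : ℂ) ^ (2 * n)) •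
              QuasiJacobi.rcBracket Derivative.normalizedDerivOfComplex k l n
                (φ : ℍ → ℂ) ψ) := by
  open QuasiJacobi in
  refine ⟨JSinf.bracket, fun n k l f g hf hg => JSinf.coe_bracket hf hg, fun B' hB' => ?_,
    fun n k l f g hf hg => ?_, ?_, M_le_JSinf, fun n f g hf hg => JSinf.bracket_mem_M n hf hg,
    fun n k l φ ψ f g hf hg => ⟨rcModularForm n φ ψ, ?_, rfl, ?_⟩⟩
  -- Two bilinear extensions agree on homogeneous elements, and these span `JSinf`.
  · refine funext fun n => eq_of_eqOn_graded isInternal_weight fun k f hf =>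
      eq_of_eqOn_graded isInternal_weight fun l g hg => Subtype.ext ?_
    rw [hB' n k l f g hf hg, JSinf.coe_bracket hf hg]
  · rw [JSinf.coe_bracket hf hg]
    exact rcBracket_mem (fun k f hf => d_mem_QJS hf) (fun k l f hf g hg => mul_mem_QJS hf hg)
      hf hg n
  · exact isFormalDeformation_bracketMap isInternal_weight JSinf.deriv_mul
      (fun k f hf => d_mem_QJS (k := k) hf) fun k l f hf g hg => mul_mem_QJS (k := k) (l := l) hf hg
  · rw [JSinf.coe_bracket (MF_le_QJS k ⟨φ, hf⟩) (MF_le_QJS l ⟨ψ, hg⟩), hf, hg]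
    exact rcBracket_d_pull φ.holo' ψ.holo' k l n
  · exact rcBracket_dtauH φ.holo' ψ.holo' k l n
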